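/- Let $n\ge 1$, $1<\alpha<2$, and put $$\kappa_{n,\alpha}=\pi^{\frac{n-1}{2}}\,\frac{\Gamma(\frac{1+\alpha}{2})}{\Gamma(\frac{n+\alpha}{2})}\,\frac{B\left(\frac{1+\alpha}{2},\frac{2-\alpha}{2}\right)-2^{\alpha}}{\alpha 2^{\alpha}},\qquad \lambda_{n,\alpha}=\frac{\pi^{\frac{n-1}{2}}\,\Gamma(\frac{\alpha}{2})\,(4-2^{3-\alpha})}{\alpha\,\Gamma(\frac{n+\alpha-1}{2})},$$ where $B$ is the Euler beta function. For a bounded open set $\Omega\subset\mathbb{R}^n$, $x\in\Omega$ and $w\in S^{n-1}$ let $$d_{w,\Omega}(x)=\min\{|t|: x+tw\notin\Omega\},\qquad \delta_{w,\Omega}(x)=\sup\{|t|: x+tw\in\Omega\},$$ and for $\beta>0$ let $M_\beta(x)>0$ be defined by $$\frac{1}{M_\beta(x)^\beta}=\frac{\int_{S^{n-1}}\left[\frac{1}{d_{w,\Omega}(x)}+\frac{1}{\delta_{w,\Omega}(x)}\right]^\beta dw}{\int_{S^{n-1}}|w_n|^\beta\,dw}.$$ Let $C_c(\Omega)$ be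 the class of continuous functions $u:\Omega\to\mathbb{R}$ with compact support in $\Omega$. (i) Let $\Omega\subset\mathbb{R}^n$ be a bounded domain (nonempty, open, connected). For every $u\in C_c(\Omega)$, $$\frac12\int_{\Omega\times\Omega}\frac{(u(x)-u(y))^2}{|x-y|^{n+\alpha}}\,dx\,dy\ \ge\ \kappa_{n,\alpha}\int_\Omega\frac{u^2(x)}{M_\alpha(x)^\alpha}\,dx+\frac{\lambda_{n,\alpha}}{\operatorname{diam}\Omega}\int_\Omega\frac{u^2(x)}{M_{\alpha-1}(x)^{\alpha-1}}\,dx. \tag{1}$$ (ii) If $\Omega$ is a bounded convex domain, then for every $u\in C_c(\Omega)$, $$\frac12\int_{\Omega\times\Omega}\frac{(u(x)-u(y))^2}{|x-y|^{n+\alpha}}\,dx\,dy\ \ge\ \kappa_{n,\alpha}\int_\Omega\frac{u^2(x)}{\operatorname{dist}(x,\Omega^c)^\alpha}\,dx+\frac{\lambda_{n,\alpha}}{\operatorname{diam}\Omega}\int_\Omega\frac{u^2(x)}{\operatorname{dist}(x,\Omega^c)^{\alpha-1}}\,dx. \tag{2}$$ (The left-hand sides may be $+\infty$.) (iii) The constant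 $\kappa_{n,\alpha}$ in (1) and in (2) may not be replaced by a bigger constant: for every bounded convex domain $\Omega\subset\mathbb{R}^n$ and every $C>\kappa_{n,\alpha}$, inequality (1) with $C$ in place of $\kappa_{n,\alpha}$ fails for some $u\in C_c(\Omega)$, and inequality (2) with $C$ in place of $\kappa_{n,\alpha}$ fails for some $u\in C_c(\Omega)$. -/

import Mathlib

open MeasureTheory Set
open scoped ENNReal

noncomputable section

/-- The constant
`κ_{n,α} = π^((n-1)/2) · Γ((1+α)/2) / Γ((n+α)/2) · (B((1+α)/2, (2-α)/2) - 2^α) / (α 2^α)`,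
where `B` is the Euler beta function. -/
def hardyKappa (n : ℕ) (α : ℝ) : ℝ :=
  Real.pi ^ (((n : ℝ) - 1) / 2) * (Real.Gamma ((1 + α) / 2) / Real.Gamma (((n : ℝ) + α) / 2)) *
    ((ProbabilityTheory.beta ((1 + α) / 2) ((2 - α) / 2) - (2 : ℝ) ^ α) / (α * (2 : ℝ) ^ α))

/-- The constant `π^((n-1)/2) Γ(α/2) (4 - 2^(3-α)) / (α Γ((n+α-1)/2))` of the lower-order term. -/
def hardyLambda (n : ℕ) (α : ℝ) : ℝ :=
  Real.pi ^ (((n : ℝ) - 1) / 2) * Real.Gamma (α / 2) * (4 - (2 : ℝ) ^ (3 - α)) /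
    (α * Real.Gamma (((n : ℝ) + α - 1) / 2))

/-- `d_{w,Ω}(x) = min {|t| : x + t w ∉ Ω}`. -/
def dirDist {n : ℕ} (Ω : Set (EuclideanSpace ℝ (Fin n))) (w x : EuclideanSpace ℝ (Fin n)) : ℝ :=
  sInf {r : ℝ | ∃ t : ℝ, r = |t| ∧ x + t • w ∉ Ω}

/-- `δ_{w,Ω}(x) = sup {|t| : x + t w ∈ Ω}`. -/
def dirReach {n : ℕ} (Ω : Set (EuclideanSpace ℝ (Fin n))) (w x : EuclideanSpace ℝ (Fin n)) : ℝ :=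
  sSup {r : ℝ | ∃ t : ℝ, r = |t| ∧ x + t • w ∈ Ω}

/-- The Loss–Sloane directional mean distance `M_β`, determined (for `β > 0`) by
`1 / M_β(x)^β = ∫_{S^{n-1}} (1 / d_{w,Ω}(x) + 1 / δ_{w,Ω}(x))^β dw / ∫_{S^{n-1}} |w_n|^β dw`,
where `dw` is the surface measure and `w_n` the last coordinate of `w`. -/
def lossSloaneM {n : ℕ} [NeZero n] (Ω : Set (EuclideanSpace ℝ (Fin n))) (β : ℝ)
    (x : EuclideanSpace ℝ (Fin n)) : ℝ≥0∞ :=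
  ((∫⁻ w : Metric.sphere (0 : EuclideanSpace ℝ (Fin n)) 1,
        ENNReal.ofReal (|w.1 ⟨n - 1, Nat.sub_one_lt (NeZero.ne n)⟩| ^ β)
          ∂(volume : Measure (EuclideanSpace ℝ (Fin n))).toSphere) /
    (∫⁻ w : Metric.sphere (0 : EuclideanSpace ℝ (Fin n)) 1,
        ENNReal.ofReal ((1 / dirDist Ω w.1 x + 1 / dirReach Ω w.1 x) ^ β)
          ∂(volume : Measure (EuclideanSpace ℝ (Fin n))).toSphere)) ^ (1 / β)

/-- `dist(x, Ωᶜ)`, as an extended nonnegative real. -/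
def distCompl {n : ℕ} (Ω : Set (EuclideanSpace ℝ (Fin n))) (x : EuclideanSpace ℝ (Fin n)) :
    ℝ≥0∞ :=
  Metric.infEDist x Ωᶜ

/-- `u ∈ C_c(Ω)`: `u` (extended by zero outside the open set `Ω`) is continuous with compact
support contained in `Ω`. -/
structure IsCc {n : ℕ} (Ω : Set (EuclideanSpace ℝ (Fin n))) (u : EuclideanSpace ℝ (Fin n) → ℝ) :
    Prop where
  continuous : Continuous u
  hasCompactSupport : HasCompactSupport u
  tsupport_subset : tsupport u ⊆ Ω

/-- The regional fractional form
`(1/2) ∫_Ω ∫_Ω (u(x) - u(y))² / |x - y|^(n+α) dx dy ∈ [0, ∞]`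
(it may be infinite for a merely continuous `u`). -/
def regionalForm {n : ℕ} (Ω : Set (EuclideanSpace ℝ (Fin n))) (α : ℝ)
    (u : EuclideanSpace ℝ (Fin n) → ℝ) : ℝ≥0∞ :=
  (1 / 2) * ∫⁻ x in Ω, ∫⁻ y in Ω, ENNReal.ofReal ((u x - u y) ^ 2 / ‖x - y‖ ^ ((n : ℝ) + α))

/-- The weighted integral `∫_Ω u(x)² / ρ(x)^β dx`. -/
def weightedInt {n : ℕ} (Ω : Set (EuclideanSpace ℝ (Fin n))) (ρ : EuclideanSpace ℝ (Fin n) → ℝ≥0∞)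
    (β : ℝ) (u : EuclideanSpace ℝ (Fin n) → ℝ) : ℝ≥0∞ :=
  ∫⁻ x in Ω, ENNReal.ofReal (u x ^ 2) / ρ x ^ β

end

/-!
Along the line through `x` in the direction `w`, let `γ(x, w)` be the reciprocal of the time at
which the ray leaves `Ω`. Pairing `u` with the ratio `((1 + γ(x, -z)) (1 - γ(x, z)))^((α - 1) / 2)`,
where `z = y - x`, which on an interval is the ratio of the values at `y` and at `x` of the ground
state `((x - a) (b - x))^((α - 1) / 2)`, and completing the square bounds the energy below by `u²`
times an integral over `y`; polar coordinates turn this integral into a spherical average of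
one-variable integrals, which are beta functions and produce the two constants. The kernel is
truncated symmetrically in `x` and `y`, since neither half of the square is integrable near the
diagonal.

On a convex set the supporting half-space at a nearest boundary point gives
`1 / d_{w,Ω}(x) ≥ |⟨e, w⟩| / dist(x, Ωᶜ)`, hence `M_β ≤ dist(·, Ωᶜ)`. For a half-space the completed
square is an identity; its remainder, evaluated on the ground state times a cutoff that is linear on
the logarithmic scale of the distance to the boundary, is negligible against the Hardy integral. A
convex set contains a ball touching such a half-space from inside, and the test functions are
supported there, so the constant is sharp.
-/

section PowerInequalities

open Filter Topology

theorem two_mul_rpow_le_add_rpow_add_sub_rpow {α V x : ℝ} (hα : 1 ≤ α) (hx : |x| ≤ V) :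
    2 * V ^ α ≤ (V + x) ^ α + (V - x) ^ α := by
  obtain ⟨hnx, hxV⟩ := abs_le.1 hx
  have hmid := (convexOn_rpow hα).2 (mem_Ici.2 (by linarith : 0 ≤ V + x))
    (mem_Ici.2 (by linarith : 0 ≤ V - x)) one_half_pos.le one_half_pos.le (add_halves 1)
  simp only [smul_eq_mul] at hmid
  rw [show 1 / 2 * (V + x) + 1 / 2 * (V - x) = V by ring] at hmid
  linarith

theorem rpow_sub_rpow_le_mul_sub {p a b : ℝ} (hp : 1 ≤ p) (ha : 0 ≤ a) (hb : 0 < b) :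
    b ^ p - a ^ p ≤ p * b ^ (p - 1) * (b - a) := by
  have bernoulli := one_add_mul_self_le_rpow_one_add (s := a / b - 1)
    (by linarith [div_nonneg ha hb.le]) hp
  rw [add_sub_cancel, Real.div_rpow ha hb.le, le_div_iff₀ (by positivity)] at bernoulli
  calc b ^ p - a ^ p ≤ b ^ p - (1 + p * (a / b - 1)) * b ^ p := by linarith
    _ = p * b ^ (p - 1) * (b - a) := by rw [Real.rpow_sub_one hb.ne']; field_simp; ring

theorem rpow_sub_rpow_le_mul_sub_of_le_one {p a b : ℝ} (hp0 : 0 ≤ p) (hp1 : p ≤ 1) (ha : 0 < a)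
    (hb : 0 ≤ b) : b ^ p - a ^ p ≤ p * a ^ (p - 1) * (b - a) := by
  have bernoulli := rpow_one_add_le_one_add_mul_self (s := b / a - 1)
    (by linarith [div_nonneg hb ha.le]) hp0 hp1
  rw [add_sub_cancel, Real.div_rpow hb ha.le, div_le_iff₀ (by positivity)] at bernoulli
  calc b ^ p - a ^ p ≤ (1 + p * (b / a - 1)) * a ^ p - a ^ p := by linarith
    _ = p * a ^ (p - 1) * (b - a) := by rw [Real.rpow_sub_one ha.ne']; field_simp; ring

theorem rpow_second_difference_le {α V : ℝ} (hα1 : 1 ≤ α) (hα2 : α ≤ 2) (hV : 1 < V) :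
    (V + 1) ^ α + (V - 1) ^ α - 2 * V ^ α ≤ 2 * α * (α - 1) * (V - 1) ^ (α - 2) := by
  have hright := rpow_sub_rpow_le_mul_sub hα1 (a := V) (b := V + 1) (by linarith) (by linarith)
  have hleft := rpow_sub_rpow_le_mul_sub hα1 (a := V) (b := V - 1) (by linarith) (by linarith)
  have hslope := rpow_sub_rpow_le_mul_sub_of_le_one (p := α - 1) (a := V - 1) (b := V + 1)
    (by linarith) (by linarith) (by linarith) (by linarith)
  rw [show α - 1 - 1 = α - 2 by ring] at hslope
  nlinarith [mul_le_mul_of_nonneg_left hslope (by linarith : 0 ≤ α)]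

theorem tendsto_rpow_second_difference {α : ℝ} (hα1 : 1 ≤ α) (hα2 : α < 2) :
    Tendsto (fun V : ℝ => (V + 1) ^ α + (V - 1) ^ α - 2 * V ^ α) atTop (𝓝 0) := by
  have hbound : Tendsto (fun V : ℝ => 2 * α * (α - 1) * (V - 1) ^ (α - 2)) atTop (𝓝 0) := by
    have hpow := (tendsto_rpow_neg_atTop (y := 2 - α) (by linarith)).comp
      (tendsto_atTop_add_const_right atTop (-1 : ℝ) tendsto_id)
    simpa [Function.comp_def, ← sub_eq_add_neg] using hpow.const_mul (2 * α * (α - 1))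
  refine squeeze_zero' ?_ ?_ hbound <;> filter_upwards [eventually_gt_atTop 1] with V hV
  · have := two_mul_rpow_le_add_rpow_add_sub_rpow (V := V) (x := 1) hα1 (by simpa using hV.le)
    linarith
  · exact rpow_second_difference_le hα1 hα2.le hV

theorem hasDerivAt_one_add_mul_rpow (p c : ℝ) {s : ℝ} (h : 1 + c * s ≠ 0 ∨ 1 ≤ p) :
    HasDerivAt (fun s : ℝ => (1 + c * s) ^ p) (c * p * (1 + c * s) ^ (p - 1)) s := by
  simpa using (((hasDerivAt_id s).const_mul c).const_add 1).rpow_const (p := p) h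

theorem convexOn_one_add_rpow_sub_one_sub_rpow {β : ℝ} (hβ0 : 0 ≤ β) (hβ1 : β ≤ 1) :
    ConvexOn ℝ (Ico 0 1) fun s : ℝ => (1 + 1 * s) ^ β - (1 + -1 * s) ^ β := by
  have hd (c p : ℝ) (hc : |c| = 1) {s : ℝ} (hs : s ∈ Ico (0 : ℝ) 1) :
      HasDerivAt (fun s : ℝ => (1 + c * s) ^ p) (c * p * (1 + c * s) ^ (p - 1)) s := by
    refine hasDerivAt_one_add_mul_rpow p c (Or.inl ?_)
    rcases eq_or_eq_neg_of_abs_eq hc with rfl | rfl <;> linarith [hs.1, hs.2]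
  have hsub : interior (Ico (0 : ℝ) 1) ⊆ Ico 0 1 := interior_subset
  refine convexOn_of_hasDerivWithinAt2_nonneg (convex_Ico 0 1)
    (fun s hs => ((hd 1 β (by simp) hs).sub (hd (-1) β (by simp) hs)).continuousAt
      |>.continuousWithinAt)
    (fun s hs => ((hd 1 β (by simp) (hsub hs)).sub
      (hd (-1) β (by simp) (hsub hs))).hasDerivWithinAt)
    (fun s hs => (((hd 1 (β - 1) (by simp) (hsub hs)).const_mul (1 * β)).sub
      ((hd (-1) (β - 1) (by simp) (hsub hs)).const_mul (-1 * β))).hasDerivWithinAt)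
    fun s hs => ?_
  have hanti : (1 + 1 * s) ^ (β - 1 - 1) ≤ (1 + -1 * s) ^ (β - 1 - 1) :=
    Real.rpow_le_rpow_of_nonpos (by linarith [(hsub hs).2]) (by linarith [(hsub hs).1])
      (by linarith)
  have := mul_nonneg (mul_nonneg hβ0 (sub_nonneg.2 hβ1)) (sub_nonneg.2 hanti)
  linarith

theorem one_add_rpow_sub_one_sub_rpow_le {β x t : ℝ} (hβ0 : 0 ≤ β) (hβ1 : β ≤ 1) (hx0 : 0 ≤ x)
    (hx1 : x ≤ 1) (ht0 : 0 ≤ t) (ht1 : t < 1) :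
    (1 + x * t) ^ β - (1 - x * t) ^ β ≤ x * ((1 + t) ^ β - (1 - t) ^ β) := by
  have hchord := (convexOn_one_add_rpow_sub_one_sub_rpow hβ0 hβ1).2
    (mem_Ico.2 ⟨ht0, ht1⟩) (left_mem_Ico.2 one_pos) hx0 (sub_nonneg.2 hx1) (add_sub_cancel x 1)
  simpa [← sub_eq_add_neg] using hchord

theorem one_add_rpow_add_one_sub_rpow_le_of_nonneg {α x : ℝ} (hα1 : 1 ≤ α) (hα2 : α ≤ 2)
    (hx0 : 0 ≤ x) (hx1 : x ≤ 1) :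
    (1 + x) ^ α + (1 - x) ^ α ≤ 2 + (2 ^ α - 2) * x ^ 2 := by
  -- `x² ((1+s)^α + (1-s)^α) - ((1+xs)^α + (1-xs)^α)` increases from `s = 0` to `s = 1`.
  have hd (c s : ℝ) : HasDerivAt (fun s : ℝ => (1 + c * s) ^ α + (1 + -c * s) ^ α)
      (α * c * ((1 + c * s) ^ (α - 1) - (1 - c * s) ^ (α - 1))) s := by
    refine ((hasDerivAt_one_add_mul_rpow α c (Or.inr hα1)).add
      (hasDerivAt_one_add_mul_rpow α (-c) (Or.inr hα1))).congr_deriv ?_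
    ring_nf
  have hφ (s : ℝ) := ((hd 1 s).const_mul (x ^ 2)).sub (hd x s)
  have hmono := monotoneOn_of_deriv_nonneg (convex_Icc 0 1)
    (fun s _ => (hφ s).continuousAt.continuousWithinAt)
    (fun s _ => (hφ s).differentiableAt.differentiableWithinAt) fun s hs => by
      rw [interior_Icc] at hs
      rw [(hφ s).deriv]
      have hle := one_add_rpow_sub_one_sub_rpow_le (β := α - 1) (by linarith) (by linarith)
        hx0 hx1 hs.1.le hs.2
      have := mul_nonneg (mul_nonneg (by linarith : 0 ≤ α) hx0) (sub_nonneg.2 hle)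
      simp only [one_mul, mul_one]
      linarith
  have hends := hmono (left_mem_Icc.2 zero_le_one) (right_mem_Icc.2 zero_le_one) zero_le_one
  simp only [Pi.sub_apply, mul_zero, mul_one, add_zero, Real.one_rpow, add_neg_cancel,
    Real.zero_rpow (by linarith : α ≠ 0), ← sub_eq_add_neg] at hends
  norm_num at hends
  linarith

theorem one_add_rpow_add_one_sub_rpow_le {α x : ℝ} (hα1 : 1 ≤ α) (hα2 : α ≤ 2) (hx : |x| ≤ 1) :
    (1 + x) ^ α + (1 - x) ^ α ≤ 2 + (2 ^ α - 2) * x ^ 2 := by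
  have habs := one_add_rpow_add_one_sub_rpow_le_of_nonneg hα1 hα2 (abs_nonneg x) hx
  rw [sq_abs] at habs
  rcases abs_choice x with h | h <;> rw [h] at habs
  · exact habs
  · rwa [sub_neg_eq_add, ← sub_eq_add_neg, add_comm] at habs

theorem two_lt_two_rpow {α : ℝ} (hα : 1 < α) : (2 : ℝ) < 2 ^ α := by
  simpa using Real.rpow_lt_rpow_of_exponent_lt one_lt_two hα

end PowerInequalities

noncomputable section BetaLimit

open Filter Topology ProbabilityTheory

/-- The truncated integral `∫_1^V (v² - 1)^p dv`. For `p = (α - 1) / 2` its divergent part is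
`V^α / α`, and the finite part carries the beta function of the sharp constant. -/
def truncInt (p V : ℝ) : ℝ := ∫ v in (1 : ℝ)..V, (v ^ 2 - 1) ^ p

theorem continuous_sq_sub_one_rpow {p : ℝ} (hp : 0 ≤ p) :
    Continuous fun v : ℝ => (v ^ 2 - 1) ^ p :=
  (by fun_prop : Continuous fun v : ℝ => v ^ 2 - 1).rpow_const fun _ => Or.inr hp

theorem truncInt_nonneg {p V : ℝ} (hV : 1 ≤ V) : 0 ≤ truncInt p V :=
  intervalIntegral.integral_nonneg hV fun v hv => Real.rpow_nonneg (by nlinarith [hv.1]) _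

theorem pos_of_mem_uIcc {a b v : ℝ} (ha : 0 < a) (hb : 0 < b) (hv : v ∈ uIcc a b) : 0 < v :=
  (lt_min ha hb).trans_le hv.1

theorem hasDerivAt_sq_sub_one_rpow_mul_inv {p v : ℝ} (hp : 0 ≤ p) (hv : 1 ≤ v) :
    HasDerivAt (fun v : ℝ => (v ^ 2 - 1) ^ (p + 1) * v⁻¹)
      ((2 * p + 1) * (v ^ 2 - 1) ^ p + (v ^ 2 - 1) ^ p * v⁻¹ ^ 2) v := by
  have hv0 : 0 < v := by linarith
  have hpow : HasDerivAt (fun v : ℝ => (v ^ 2 - 1) ^ (p + 1)) _ v :=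
    ((hasDerivAt_pow 2 v).sub_const 1).rpow_const (p := p + 1) (Or.inr (by linarith))
  refine (hpow.mul (hasDerivAt_inv hv0.ne')).congr_deriv ?_
  simp only [Real.rpow_add_one' (by nlinarith : 0 ≤ v ^ 2 - 1) (by linarith : p + 1 ≠ 0),
    add_sub_cancel_right]
  field_simp
  push_cast
  ring

theorem truncInt_add_integral {p V : ℝ} (hp : 0 ≤ p) (hV : 1 ≤ V) :
    (2 * p + 1) * truncInt p V + ∫ v in (1 : ℝ)..V, (v ^ 2 - 1) ^ p * v⁻¹ ^ 2 =
      (V ^ 2 - 1) ^ (p + 1) / V := by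
  have hc := continuous_sq_sub_one_rpow hp
  have hi1 : IntervalIntegrable (fun v : ℝ => (2 * p + 1) * (v ^ 2 - 1) ^ p) volume 1 V :=
    (hc.intervalIntegrable _ _).const_mul _
  have hi2 : IntervalIntegrable (fun v : ℝ => (v ^ 2 - 1) ^ p * v⁻¹ ^ 2) volume 1 V :=
    (hc.continuousOn.mul ((continuousOn_id.inv₀ fun v hv =>
      (pos_of_mem_uIcc one_pos (by linarith) hv).ne').pow 2)).intervalIntegrable
  have hd : ∀ v ∈ uIcc 1 V, HasDerivAt (fun v : ℝ => (v ^ 2 - 1) ^ (p + 1) * v⁻¹)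
      ((2 * p + 1) * (v ^ 2 - 1) ^ p + (v ^ 2 - 1) ^ p * v⁻¹ ^ 2) v := fun v hv =>
    hasDerivAt_sq_sub_one_rpow_mul_inv hp (by rw [uIcc_of_le hV] at hv; exact hv.1)
  have hftc := intervalIntegral.integral_eq_sub_of_hasDerivAt hd (hi1.add hi2)
  rw [intervalIntegral.integral_add hi1 hi2, intervalIntegral.integral_const_mul] at hftc
  rw [truncInt, hftc]
  simp [Real.zero_rpow (by linarith : p + 1 ≠ 0), div_eq_mul_inv]

theorem sq_sub_one_rpow_mul_inv_sq {p v : ℝ} (hv : 1 ≤ v) :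
    (v ^ 2 - 1) ^ p * v⁻¹ ^ 2 =
      1 / 2 * ((1 - v⁻¹ ^ 2) ^ p * (v⁻¹ ^ 2) ^ (-(p + 1 / 2)) * (2 * v⁻¹ ^ 3)) := by
  have : 0 < v := by linarith
  have hfactor : (1 : ℝ) - v⁻¹ ^ 2 = (v ^ 2 - 1) * v⁻¹ ^ 2 := by field_simp
  have hpow : (v⁻¹ ^ 2 : ℝ) ^ p * (v⁻¹ ^ 2) ^ (-(p + 1 / 2)) = v := by
    rw [← Real.rpow_add (by positivity), ← Real.rpow_natCast, ← Real.rpow_mul (by positivity),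
      show ((2 : ℕ) : ℝ) * (p + -(p + 1 / 2)) = -1 by push_cast; ring, Real.rpow_neg_one, inv_inv]
  rw [hfactor, Real.mul_rpow (by nlinarith) (by positivity)]
  calc (v ^ 2 - 1) ^ p * v⁻¹ ^ 2 = (v ^ 2 - 1) ^ p * (v * v⁻¹ ^ 3) := by field_simp
    _ = (v ^ 2 - 1) ^ p * (((v⁻¹ ^ 2 : ℝ) ^ p * (v⁻¹ ^ 2) ^ (-(p + 1 / 2))) * v⁻¹ ^ 3) := by
      rw [hpow]
    _ = _ := by ring

theorem integral_eq_half_incomplete_beta {p V : ℝ} (hp : 0 ≤ p) (hV : 1 ≤ V) :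
    ∫ v in (1 : ℝ)..V, (v ^ 2 - 1) ^ p * v⁻¹ ^ 2 =
      1 / 2 * ∫ t in (0 : ℝ)..1 - V⁻¹ ^ 2, t ^ p * (1 - t) ^ (-(p + 1 / 2)) := by
  have hpos : ∀ v ∈ uIcc 1 V, 0 < v := fun v => pos_of_mem_uIcc one_pos (by linarith)
  have hsub := intervalIntegral.integral_comp_mul_deriv'' (a := 1) (b := V)
    (f := fun v : ℝ => 1 - v⁻¹ ^ 2) (f' := fun v => 2 * v⁻¹ ^ 3)
    (g := fun t : ℝ => t ^ p * (1 - t) ^ (-(p + 1 / 2))) ?_ ?_ ?_ ?_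
  · simp only [inv_one, one_pow, sub_self] at hsub
    rw [← hsub, ← intervalIntegral.integral_const_mul]
    refine intervalIntegral.integral_congr fun v hv => ?_
    rw [uIcc_of_le hV] at hv
    simpa only [Function.comp, sub_sub_cancel] using sq_sub_one_rpow_mul_inv_sq hv.1
  · exact continuousOn_const.sub ((continuousOn_id.inv₀ fun v hv => (hpos v hv).ne').pow 2)
  · intro v hv
    have hv0 : 0 < v := hpos v (Ioo_subset_Icc_self hv)
    refine (((hasDerivAt_inv hv0.ne').pow 2).const_sub 1).hasDerivWithinAt.congr_deriv ?_
    norm_num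
    field_simp
  · exact continuousOn_const.mul ((continuousOn_id.inv₀ fun v hv => (hpos v hv).ne').pow 3)
  · rintro _ ⟨v, hv, rfl⟩
    have hv0 := hpos v hv
    refine ContinuousAt.continuousWithinAt (ContinuousAt.mul ?_ ?_)
    · exact Real.continuousAt_rpow_const _ _ (Or.inr hp)
    · refine ContinuousAt.rpow_const (by fun_prop) (Or.inl ?_)
      simp only [sub_sub_cancel]
      positivity

theorem re_betaIntegrand (a b : ℝ) {x : ℝ} (hx : x ∈ Ioc (0 : ℝ) 1) :
    ((x : ℂ) ^ ((a : ℂ) - 1) * (1 - (x : ℂ)) ^ ((b : ℂ) - 1)).re =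
      x ^ (a - 1) * (1 - x) ^ (b - 1) := by
  norm_cast
  rw [← Complex.ofReal_cpow hx.1.le, ← Complex.ofReal_cpow (by linarith [hx.2]),
    Complex.re_mul_ofReal, Complex.ofReal_re]

theorem integrableOn_betaIntegrand {a b : ℝ} (ha : 0 < a) (hb : 0 < b) :
    IntegrableOn (fun x : ℝ => (x : ℂ) ^ ((a : ℂ) - 1) * (1 - (x : ℂ)) ^ ((b : ℂ) - 1))
      (Ioc 0 1) :=
  (intervalIntegrable_iff_integrableOn_Ioc_of_le zero_le_one).1
    (Complex.betaIntegral_convergent (by simpa) (by simpa))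

theorem intervalIntegrable_beta {a b : ℝ} (ha : 0 < a) (hb : 0 < b) :
    IntervalIntegrable (fun t : ℝ => t ^ (a - 1) * (1 - t) ^ (b - 1)) volume 0 1 :=
  (intervalIntegrable_iff_integrableOn_Ioc_of_le zero_le_one).2
    ((integrableOn_congr_fun (fun _ hx => re_betaIntegrand a b hx) measurableSet_Ioc).1
      (integrableOn_betaIntegrand ha hb).re)

theorem beta_eq_integral {a b : ℝ} (ha : 0 < a) (hb : 0 < b) :
    beta a b = ∫ t in (0 : ℝ)..1, t ^ (a - 1) * (1 - t) ^ (b - 1) := by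
  rw [beta_eq_betaIntegralReal a b ha hb, Complex.betaIntegral,
    intervalIntegral.integral_of_le zero_le_one, intervalIntegral.integral_of_le zero_le_one,
    ← RCLike.re_to_complex, ← integral_re (integrableOn_betaIntegrand ha hb)]
  exact setIntegral_congr_fun measurableSet_Ioc fun _ hx => re_betaIntegrand a b hx

theorem inv_sq_mem_Icc {V : ℝ} (hV : 1 ≤ V) : V⁻¹ ^ 2 ∈ Icc (0 : ℝ) 1 :=
  ⟨by positivity, pow_le_one₀ (by positivity) (inv_le_one_of_one_le₀ hV)⟩

theorem tendsto_incomplete_beta {a b : ℝ} (ha : 0 < a) (hb : 0 < b) :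
    Tendsto (fun V : ℝ => ∫ t in (0 : ℝ)..1 - V⁻¹ ^ 2, t ^ (a - 1) * (1 - t) ^ (b - 1)) atTop
      (𝓝 (beta a b)) := by
  rw [beta_eq_integral ha hb]
  have hcont := intervalIntegral.continuousOn_primitive_interval' (intervalIntegrable_beta ha hb)
    left_mem_uIcc
  rw [uIcc_of_le zero_le_one] at hcont
  refine (hcont 1 (right_mem_Icc.2 zero_le_one)).tendsto.comp
    (tendsto_nhdsWithin_iff.2 ⟨?_, ?_⟩)
  · simpa using ((tendsto_inv_atTop_zero (𝕜 := ℝ)).pow 2).const_sub 1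
  · filter_upwards [eventually_ge_atTop 1] with V hV
    obtain ⟨h0, h1⟩ := inv_sq_mem_Icc hV
    exact ⟨by linarith, by linarith⟩

theorem sq_sub_one_rpow_div {α V : ℝ} (hV : 1 ≤ V) :
    (V ^ 2 - 1) ^ ((α - 1) / 2 + 1) / V = V ^ α * (1 + -(V⁻¹ ^ 2)) ^ ((α - 1) / 2 + 1) := by
  have hV0 : 0 < V := by linarith
  have hfactor : V ^ 2 - 1 = V ^ 2 * (1 + -(V⁻¹ ^ 2)) := by field_simp; ring
  rw [hfactor, Real.mul_rpow (by positivity) (by linarith [(inv_sq_mem_Icc hV).2]),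
    ← Real.rpow_natCast V 2, ← Real.rpow_mul hV0.le,
    show ((2 : ℕ) : ℝ) * ((α - 1) / 2 + 1) = α + 1 by push_cast; ring, Real.rpow_add_one hV0.ne']
  field_simp

theorem tendsto_rpow_sub_sq_sub_one {α : ℝ} (hα1 : 1 ≤ α) (hα2 : α < 2) :
    Tendsto (fun V : ℝ => V ^ α - (V ^ 2 - 1) ^ ((α - 1) / 2 + 1) / V) atTop (𝓝 0) := by
  have hlim : Tendsto (fun V : ℝ => ((α - 1) / 2 + 1) * V ^ (-(2 - α))) atTop (𝓝 0) := by
    simpa using (tendsto_rpow_neg_atTop (y := 2 - α) (by linarith)).const_mul ((α - 1) / 2 + 1)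
  refine squeeze_zero' ?_ ?_ hlim
  · filter_upwards [eventually_ge_atTop 1] with V hV
    obtain ⟨h0, h1⟩ := inv_sq_mem_Icc hV
    rw [sq_sub_one_rpow_div hV, sub_nonneg]
    exact mul_le_of_le_one_right (Real.rpow_nonneg (by linarith) _)
      (Real.rpow_le_one (by linarith) (by linarith) (by linarith))
  · filter_upwards [eventually_ge_atTop 1] with V hV
    have hV0 : 0 < V := by linarith
    have h1 := (inv_sq_mem_Icc hV).2
    have hbernoulli := one_add_mul_self_le_rpow_one_add (s := -(V⁻¹ ^ 2)) (by linarith)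
      (p := (α - 1) / 2 + 1) (by linarith)
    have hpow : V ^ (-(2 - α)) = V ^ α * V⁻¹ ^ 2 := by
      rw [show -(2 - α) = α - (2 : ℕ) by push_cast; ring, Real.rpow_sub_natCast hV0.ne', inv_pow,
        div_eq_mul_inv]
    rw [sq_sub_one_rpow_div hV, hpow]
    linarith [mul_le_mul_of_nonneg_left hbernoulli (Real.rpow_nonneg hV0.le α)]

theorem tendsto_two_rpow_sub_truncInt {α : ℝ} (hα1 : 1 ≤ α) (hα2 : α < 2) :
    Tendsto (fun V : ℝ => 2 * V ^ α - 2 * α * truncInt ((α - 1) / 2) V) atTop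
      (𝓝 (beta ((1 + α) / 2) ((2 - α) / 2))) := by
  have hlim := ((tendsto_rpow_sub_sq_sub_one hα1 hα2).const_mul 2).add
    (tendsto_incomplete_beta (a := (1 + α) / 2) (b := (2 - α) / 2) (by linarith) (by linarith))
  rw [mul_zero, zero_add] at hlim
  refine hlim.congr' ?_
  filter_upwards [eventually_ge_atTop 1] with V hV
  have hparts := truncInt_add_integral (p := (α - 1) / 2) (V := V) (by linarith) hV
  rw [integral_eq_half_incomplete_beta (by linarith) hV] at hparts
  rw [show (1 + α) / 2 - 1 = (α - 1) / 2 by ring,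
    show (2 - α) / 2 - 1 = -((α - 1) / 2 + 1 / 2) by ring, ← hparts]
  ring

theorem tendsto_add_one_rpow_add_sub_one_rpow_sub_truncInt {α : ℝ} (hα1 : 1 ≤ α) (hα2 : α < 2) :
    Tendsto (fun V : ℝ => (V + 1) ^ α + (V - 1) ^ α - 2 * α * truncInt ((α - 1) / 2) V) atTop
      (𝓝 (beta ((1 + α) / 2) ((2 - α) / 2))) := by
  have hlim := (tendsto_two_rpow_sub_truncInt hα1 hα2).add
    (tendsto_rpow_second_difference hα1 hα2)
  rw [add_zero] at hlim
  exact hlim.congr fun V => by ring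

theorem two_mul_sq_sub_one_rpow_le {q v : ℝ} (hv : 1 ≤ v) :
    2 * (v ^ 2 - 1) ^ (q / 2) ≤ (v + 1) ^ q + (v + -1) ^ q := by
  have hprod : (v ^ 2 - 1) ^ (q / 2) = (v + 1) ^ (q / 2) * (v + -1) ^ (q / 2) := by
    rw [← Real.mul_rpow (by linarith) (by linarith)]
    ring_nf
  have hsq : ∀ y : ℝ, 0 ≤ y → y ^ q = (y ^ (q / 2)) ^ 2 := fun y hy => by
    rw [← Real.rpow_mul_natCast hy]
    norm_num
  rw [hprod, hsq _ (by linarith), hsq _ (by linarith), ← mul_assoc]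
  exact two_mul_le_add_sq _ _

theorem two_mul_truncInt_le {α V : ℝ} (hα : 1 ≤ α) (hV : 1 ≤ V) :
    2 * α * truncInt ((α - 1) / 2) V ≤ (V + 1) ^ α + (V - 1) ^ α - 2 ^ α := by
  have hint : ∀ c : ℝ, IntervalIntegrable (fun v : ℝ => (v + c) ^ (α - 1)) volume 1 V := fun c =>
    ((continuous_id.add continuous_const).rpow_const fun _ =>
      Or.inr (by linarith)).intervalIntegrable _ _
  have hshift : ∀ c : ℝ, ∫ v in (1 : ℝ)..V, (v + c) ^ (α - 1) =
      ((V + c) ^ α - (1 + c) ^ α) / α := fun c => by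
    rw [intervalIntegral.integral_comp_add_right (fun v => v ^ (α - 1)) c,
      integral_rpow (Or.inl (by linarith)), sub_add_cancel]
  have hle : 2 * truncInt ((α - 1) / 2) V ≤
      ∫ v in (1 : ℝ)..V, ((v + 1) ^ (α - 1) + (v + -1) ^ (α - 1)) := by
    rw [truncInt, ← intervalIntegral.integral_const_mul]
    exact intervalIntegral.integral_mono_on hV
      (((continuous_sq_sub_one_rpow (by linarith)).intervalIntegrable _ _).const_mul _)
      ((hint 1).add (hint (-1))) fun v hv => two_mul_sq_sub_one_rpow_le hv.1
  rw [intervalIntegral.integral_add (hint 1) (hint (-1)), hshift, hshift,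
    add_neg_cancel, Real.zero_rpow (by linarith), ← add_div, le_div_iff₀ (by linarith),
    one_add_one_eq_two, ← sub_eq_add_neg] at hle
  linarith

theorem two_rpow_le_beta {α : ℝ} (hα1 : 1 ≤ α) (hα2 : α < 2) :
    (2 : ℝ) ^ α ≤ beta ((1 + α) / 2) ((2 - α) / 2) := by
  refine ge_of_tendsto (tendsto_add_one_rpow_add_sub_one_rpow_sub_truncInt hα1 hα2) ?_
  filter_upwards [eventually_ge_atTop 1] with V hV
  linarith [two_mul_truncInt_le hα1 hV]

end BetaLimit

noncomputable section Ray

open Filter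

/-- The upper limit `(V (A + B) + A - B) / 2` of the inverse radii selected by the symmetric
truncation at level `V` on a ray with forward and backward exit times `1 / A` and `1 / B`. -/
def rayTruncation (V A B : ℝ) : ℝ := (V * (A + B) + A - B) / 2

/-- The mass of `t^(α-1) dt` on the inverse radii selected by the symmetric truncation; in terms
of the radius `r = 1 / t` it is the kernel `r^(-1-α) dr`. -/
def rayMass (α V A B : ℝ) : ℝ := ∫ t in A..rayTruncation V A B, t ^ (α - 1)

/-- The same mass as `rayMass`, weighted by the ratio of the values of the ground state. -/
def rayGround (α V A B : ℝ) : ℝ :=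
  ∫ t in A..rayTruncation V A B, ((t - A) * (t + B)) ^ ((α - 1) / 2)

/-- The constant `κ` of a one-dimensional section. -/
def lineKappa (α : ℝ) : ℝ :=
  (ProbabilityTheory.beta ((1 + α) / 2) ((2 - α) / 2) - (2 : ℝ) ^ α) / (α * (2 : ℝ) ^ α)

/-- The constant `λ` of a one-dimensional section. -/
def lineLambda (α : ℝ) : ℝ := (4 - (2 : ℝ) ^ (3 - α)) / α

theorem lineKappa_nonneg {α : ℝ} (hα1 : 1 ≤ α) (hα2 : α < 2) : 0 ≤ lineKappa α :=
  div_nonneg (sub_nonneg.2 (two_rpow_le_beta hα1 hα2)) (by positivity)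

theorem lineLambda_eq (α : ℝ) : lineLambda α = 4 * (2 ^ α - 2) / (α * 2 ^ α) := by
  have : (2 : ℝ) ^ α ≠ 0 := by positivity
  rw [lineLambda, Real.rpow_sub two_pos]
  norm_num
  field_simp
  ring

theorem lineLambda_nonneg {α : ℝ} (hα : 1 < α) : 0 ≤ lineLambda α := by
  rw [lineLambda_eq]
  have := two_lt_two_rpow hα
  exact div_nonneg (by linarith) (by positivity)

theorem le_rayTruncation {V A B : ℝ} (hV : 1 ≤ V) (hAB : 0 ≤ A + B) : A ≤ rayTruncation V A B := by
  have := mul_le_mul_of_nonneg_right hV hAB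
  rw [rayTruncation]
  linarith

theorem rayMass_eq {α : ℝ} (hα : 0 < α) (V A B : ℝ) :
    rayMass α V A B = (rayTruncation V A B ^ α - A ^ α) / α := by
  rw [rayMass, integral_rpow (Or.inl (by linarith)), sub_add_cancel]

theorem rayMass_nonneg {α V A B : ℝ} (hV : 1 ≤ V) (hA : 0 ≤ A) (hB : 0 ≤ B) :
    0 ≤ rayMass α V A B :=
  intervalIntegral.integral_nonneg (le_rayTruncation hV (add_nonneg hA hB)) fun _ ht =>
    Real.rpow_nonneg (hA.trans ht.1) _

theorem measurable_rayMass {Y : Type*} [MeasurableSpace Y] {α : ℝ} (hα : 0 < α) (V : ℝ)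
    {f g : Y → ℝ} (hf : Measurable f) (hg : Measurable g) :
    Measurable fun y => rayMass α V (f y) (g y) := by
  simp only [rayMass_eq hα, rayTruncation]
  fun_prop

theorem rayGround_eq {α V A B : ℝ} (hα : 0 < α) (hV : 1 ≤ V) (hA : 0 ≤ A) (hB : 0 ≤ B) :
    rayGround α V A B = ((A + B) / 2) ^ α * truncInt ((α - 1) / 2) V := by
  rcases (add_nonneg hA hB).eq_or_lt with hq | hq
  · obtain ⟨rfl, rfl⟩ := (add_eq_zero_iff_of_nonneg hA hB).1 hq.symm
    simp [rayGround, rayTruncation, Real.zero_rpow hα.ne']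
  have hc : 0 < (A + B) / 2 := by positivity
  have haffine : ∀ v ∈ uIcc 1 V, ((((A + B) / 2 * v + (A - B) / 2) - A) *
      (((A + B) / 2 * v + (A - B) / 2) + B)) ^ ((α - 1) / 2) =
      ((A + B) / 2) ^ (α - 1) * (v ^ 2 - 1) ^ ((α - 1) / 2) := by
    intro v hv
    rw [uIcc_of_le hV] at hv
    rw [show (((A + B) / 2 * v + (A - B) / 2) - A) * (((A + B) / 2 * v + (A - B) / 2) + B) =
      ((A + B) / 2) ^ 2 * (v ^ 2 - 1) by ring,
      Real.mul_rpow (by positivity) (by nlinarith [hv.1]), ← Real.rpow_natCast_mul hc.le]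
    congr 2
    push_cast; ring
  have hsub := intervalIntegral.integral_comp_mul_add (a := 1) (b := V)
    (fun t : ℝ => ((t - A) * (t + B)) ^ ((α - 1) / 2)) hc.ne' ((A - B) / 2)
  rw [show (A + B) / 2 * 1 + (A - B) / 2 = A by ring,
    show (A + B) / 2 * V + (A - B) / 2 = rayTruncation V A B by rw [rayTruncation]; ring,
    eq_inv_smul_iff₀ hc.ne', intervalIntegral.integral_congr haffine,
    intervalIntegral.integral_const_mul, smul_eq_mul, ← mul_assoc,
    ← Real.rpow_one_add' hc.le (by linarith), add_sub_cancel] at hsub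
  exact hsub.symm

theorem rayMass_add_swap {α V q x : ℝ} (hα : 0 < α) (hV : 1 ≤ V) (hq : 0 ≤ q) (hx : |x| ≤ 1) :
    rayMass α V (q / 2 * (1 + x)) (q / 2 * (1 - x)) +
        rayMass α V (q / 2 * (1 - x)) (q / 2 * (1 + x)) =
      (q / 2) ^ α * (((V + x) ^ α + (V - x) ^ α - ((1 + x) ^ α + (1 - x) ^ α)) / α) := by
  obtain ⟨hx0, hx1⟩ := abs_le.1 hx
  have hpos : rayTruncation V (q / 2 * (1 + x)) (q / 2 * (1 - x)) = q / 2 * (V + x) := by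
    rw [rayTruncation]; ring
  have hneg : rayTruncation V (q / 2 * (1 - x)) (q / 2 * (1 + x)) = q / 2 * (V - x) := by
    rw [rayTruncation]; ring
  rw [rayMass_eq hα, rayMass_eq hα, hpos, hneg,
    Real.mul_rpow (by linarith) (by linarith), Real.mul_rpow (by linarith) (by linarith),
    Real.mul_rpow (by linarith) (by linarith), Real.mul_rpow (by linarith) (by linarith)]
  ring

theorem four_div_le_one_sub_sq {D A B : ℝ} (hA : 0 < A) (hB : 0 < B) (hD : 1 / A + 1 / B ≤ D) :
    4 * (1 / D) / (A + B) ≤ 1 - ((A - B) / (A + B)) ^ 2 := by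
  have hD0 : 0 < D := lt_of_lt_of_le (by positivity) hD
  have hharmonic : (A + B) / (A * B) ≤ D := by
    refine le_trans (le_of_eq ?_) hD
    field_simp
    ring
  rw [div_le_iff₀ (by positivity)] at hharmonic
  rw [show 1 - ((A - B) / (A + B)) ^ 2 = 4 * A * B / (A + B) ^ 2 by field_simp; ring,
    mul_one_div, div_div, div_le_div_iff₀ (by positivity) (by positivity)]
  nlinarith [mul_le_mul_of_nonneg_left hharmonic (show 0 ≤ 4 * (A + B) by positivity)]

theorem two_mul_truncInt_add_le {α V x s η : ℝ} (hα1 : 1 < α) (hα2 : α < 2) (hV1 : 1 ≤ V)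
    (hV : ProbabilityTheory.beta ((1 + α) / 2) ((2 - α) / 2) - η ≤
      2 * V ^ α - 2 * α * truncInt ((α - 1) / 2) V)
    (hx : |x| ≤ 1) (hs : s ≤ 1 - x ^ 2) :
    2 * α * truncInt ((α - 1) / 2) V +
        (ProbabilityTheory.beta ((1 + α) / 2) ((2 - α) / 2) - 2 ^ α) + (2 ^ α - 2) * s ≤
      (V + x) ^ α + (V - x) ^ α - ((1 + x) ^ α + (1 - x) ^ α) + η := by
  have hconv := two_mul_rpow_le_add_rpow_add_sub_rpow (α := α) hα1.le (hx.trans hV1)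
  have hunit := one_add_rpow_add_one_sub_rpow_le hα1.le hα2.le hx
  have := mul_le_mul_of_nonneg_left hs (sub_nonneg.2 (two_lt_two_rpow hα1).le)
  linarith

theorem exists_rayGround_add_le_rayMass {α : ℝ} (hα1 : 1 < α) (hα2 : α < 2) {δ : ℝ} (hδ : 0 < δ) :
    ∃ V : ℝ, 1 ≤ V ∧ ∀ D A B : ℝ, 0 < A → 0 < B → 1 / A + 1 / B ≤ D →
      2 * rayGround α V A B + (lineKappa α * (A + B) ^ α +
          lineLambda α * (1 / D) * (A + B) ^ (α - 1)) ≤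
        rayMass α V A B + rayMass α V B A + δ * (A + B) ^ α := by
  have hα0 : 0 < α := by linarith
  have hev := (tendsto_two_rpow_sub_truncInt hα1.le hα2).eventually
    (eventually_ge_nhds (sub_lt_self _ (show 0 < δ * (α * 2 ^ α) by positivity)))
  obtain ⟨V, hV1, hV⟩ := ((eventually_ge_atTop (1 : ℝ)).and hev).exists
  refine ⟨V, hV1, fun D A B hA hB hD => ?_⟩
  have hcore := four_div_le_one_sub_sq hA hB hD
  rw [rayGround_eq hα0 hV1 hA.le hB.le]
  set q := A + B
  have hq0 : 0 < q := by positivity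
  set x := (A - B) / q with hx
  have hqx : q * x = A - B := mul_div_cancel₀ _ hq0.ne'
  have hx1 : |x| ≤ 1 := by
    rw [hx, abs_div, abs_of_pos hq0, div_le_one hq0, abs_le]
    constructor <;> linarith
  have hmass := rayMass_add_swap hα0 hV1 hq0.le hx1
  rw [show q / 2 * (1 + x) = A by linarith, show q / 2 * (1 - x) = B by linarith] at hmass
  have hscaled := mul_le_mul_of_nonneg_left (two_mul_truncInt_add_le hα1 hα2 hV1 hV hx1 hcore)
    (show 0 ≤ q ^ α / (2 ^ α * α) by positivity)
  rw [hmass, Real.div_rpow hq0.le two_pos.le, lineLambda_eq, lineKappa, Real.rpow_sub_one hq0.ne']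
  refine le_trans (le_of_eq ?_) (hscaled.trans (le_of_eq ?_))
  · field_simp
    ring
  · field_simp

theorem eventually_rayMass_le_rayGround_add {α : ℝ} (hα1 : 1 ≤ α) (hα2 : α < 2) {δ : ℝ}
    (hδ : 0 < δ) :
    ∀ᶠ V : ℝ in atTop, ∀ q : ℝ, 0 ≤ q →
      rayMass α V q 0 + rayMass α V 0 q ≤
        2 * rayGround α V q 0 + (lineKappa α + δ) * q ^ α := by
  have hα0 : 0 < α := by linarith
  filter_upwards [eventually_ge_atTop (1 : ℝ),
    (tendsto_add_one_rpow_add_sub_one_rpow_sub_truncInt hα1 hα2).eventually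
    (eventually_le_nhds (lt_add_of_pos_right _ (show 0 < δ * (α * 2 ^ α) by positivity)))]
    with V hV1 hV q hq
  have hmass := rayMass_add_swap (x := 1) hα0 hV1 hq (by simp)
  rw [show q / 2 * (1 + 1) = q by ring, sub_self, mul_zero, Real.zero_rpow hα0.ne', add_zero,
    one_add_one_eq_two] at hmass
  rw [hmass, rayGround_eq hα0 hV1 hq le_rfl, add_zero, lineKappa, Real.div_rpow hq two_pos.le]
  have hscaled := mul_le_mul_of_nonneg_left hV (show 0 ≤ q ^ α / (2 ^ α * α) by positivity)
  refine le_trans (le_of_eq ?_) ((add_le_add_left hscaled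
    (q ^ α / (2 ^ α * α) * (2 * α * truncInt ((α - 1) / 2) V - 2 ^ α))).trans (le_of_eq ?_)) <;>
  · field_simp
    ring

theorem lintegral_Ioi_comp_inv (F : ℝ → ℝ≥0∞) :
    ∫⁻ r in Ioi (0 : ℝ), F r = ∫⁻ t in Ioi (0 : ℝ), ENNReal.ofReal ((t ^ 2)⁻¹) * F t⁻¹ := by
  have himg : (fun t : ℝ => t⁻¹) '' Ioi 0 = Ioi 0 := by
    ext r
    simp
  have hsub := lintegral_image_eq_lintegral_abs_deriv_mul (s := Ioi (0 : ℝ))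
    (f := fun t : ℝ => t⁻¹) (f' := fun t => -(t ^ 2)⁻¹) measurableSet_Ioi
    (fun t ht => (hasDerivAt_inv (ne_of_gt ht)).hasDerivWithinAt)
    inv_injective.injOn F
  rw [himg] at hsub
  simp only [hsub, abs_neg, abs_inv, abs_sq]

/-- The radii `r` selected by the symmetric truncation at level `V` on a ray whose exit times
forwards and backwards are `1 / A` and `1 / B`. -/
def raySet (V A B : ℝ) : Set ℝ := {r | r * A < 1 ∧ 2 + r * B - r * A ≤ V * (r * A + r * B)}

theorem inv_mem_raySet_iff {V A B t : ℝ} (ht : 0 < t) :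
    t⁻¹ ∈ raySet V A B ↔ t ∈ Ioc A (rayTruncation V A B) := by
  rw [raySet, mem_ofPred_eq, mem_Ioc, rayTruncation, ← mul_lt_mul_iff_of_pos_left ht,
    ← mul_le_mul_iff_of_pos_left ht (a := t) (b := 2 + t⁻¹ * B - t⁻¹ * A),
    show t * (t⁻¹ * A) = A by field_simp,
    show t * (2 + t⁻¹ * B - t⁻¹ * A) = 2 * t + B - A by field_simp,
    show t * (V * (t⁻¹ * A + t⁻¹ * B)) = V * (A + B) by field_simp, mul_one]
  constructor <;> rintro ⟨h1, h2⟩ <;> constructor <;> linarith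

theorem lintegral_raySet {α V A B : ℝ} (hA : 0 ≤ A) (h : ℝ → ℝ≥0∞) :
    ∫⁻ r in Ioi (0 : ℝ), ENNReal.ofReal (r ^ (-1 - α)) * (raySet V A B).indicator h r =
      ∫⁻ t in Ioc A (rayTruncation V A B), ENNReal.ofReal (t ^ (α - 1)) * h t⁻¹ := by
  rw [lintegral_Ioi_comp_inv, ← lintegral_indicator measurableSet_Ioi,
    ← lintegral_indicator measurableSet_Ioc]
  refine lintegral_congr fun t => ?_
  rcases le_or_gt t 0 with ht | ht
  · rw [indicator_of_notMem (show t ∉ Ioi 0 from ht.not_gt),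
      indicator_of_notMem fun hm => (hA.trans_lt hm.1).not_ge ht]
  rw [indicator_of_mem (show t ∈ Ioi 0 from ht)]
  by_cases hm : t ∈ Ioc A (rayTruncation V A B)
  · have hpow : (t ^ 2)⁻¹ * t⁻¹ ^ (-1 - α) = t ^ (α - 1) := by
      rw [Real.inv_rpow ht.le, ← Real.rpow_neg ht.le, ← Real.rpow_natCast, ← Real.rpow_neg ht.le,
        ← Real.rpow_add ht]
      congr 1
      push_cast; ring
    rw [indicator_of_mem hm, indicator_of_mem ((inv_mem_raySet_iff ht).2 hm), ← mul_assoc,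
      ← ENNReal.ofReal_mul (by positivity), hpow]
  · rw [indicator_of_notMem hm, indicator_of_notMem (hm ∘ (inv_mem_raySet_iff ht).1), mul_zero,
      mul_zero]

theorem lintegral_Ioc_ofReal {f : ℝ → ℝ} {a b : ℝ} (hab : a ≤ b) (hf : Continuous f)
    (h0 : ∀ t ∈ Ioc a b, 0 ≤ f t) :
    ∫⁻ t in Ioc a b, ENNReal.ofReal (f t) = ENNReal.ofReal (∫ t in a..b, f t) := by
  rw [intervalIntegral.integral_of_le hab, ofReal_integral_eq_lintegral_ofReal]
  · exact (intervalIntegrable_iff_integrableOn_Ioc_of_le hab).1 (hf.intervalIntegrable _ _)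
  · filter_upwards [ae_restrict_mem measurableSet_Ioc] with t ht using h0 t ht

theorem lintegral_raySet_one {α V A B : ℝ} (hα : 1 ≤ α) (hV : 1 ≤ V) (hA : 0 ≤ A) (hB : 0 ≤ B) :
    ∫⁻ r in Ioi (0 : ℝ), ENNReal.ofReal (r ^ (-1 - α)) * (raySet V A B).indicator 1 r =
      ENNReal.ofReal (rayMass α V A B) := by
  rw [lintegral_raySet hA]
  simp only [Pi.one_apply, mul_one]
  exact lintegral_Ioc_ofReal (le_rayTruncation hV (add_nonneg hA hB))
    (Real.continuous_rpow_const (by linarith)) fun t ht => Real.rpow_nonneg (hA.trans ht.1.le) _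

theorem lintegral_raySet_ground {α V A B : ℝ} (hα : 1 ≤ α) (hV : 1 ≤ V) (hA : 0 ≤ A)
    (hB : 0 ≤ B) :
    ∫⁻ r in Ioi (0 : ℝ), ENNReal.ofReal (r ^ (-1 - α)) * (raySet V A B).indicator
        (fun r => ENNReal.ofReal (((1 - r * A) * (1 + r * B)) ^ ((α - 1) / 2))) r =
      ENNReal.ofReal (rayGround α V A B) := by
  rw [lintegral_raySet hA, rayGround, ← lintegral_Ioc_ofReal
    (le_rayTruncation hV (add_nonneg hA hB)) ((by fun_prop : Continuous fun t : ℝ =>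
      (t - A) * (t + B)).rpow_const fun _ => Or.inr (by linarith))
    (fun t ht => Real.rpow_nonneg (mul_nonneg (by linarith [ht.1]) (by linarith [ht.1])) _)]
  refine setLIntegral_congr_fun measurableSet_Ioc fun t ht => ?_
  have ht0 : 0 < t := hA.trans_lt ht.1
  have hpow : t ^ (α - 1) = (t ^ 2) ^ ((α - 1) / 2) := by
    rw [← Real.rpow_natCast_mul ht0.le]
    congr 1
    push_cast; ring
  have hinside : 0 ≤ 1 - t⁻¹ * A := by
    rw [sub_nonneg, inv_mul_le_iff₀ ht0]
    linarith [ht.1]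
  rw [← ENNReal.ofReal_mul (by positivity), hpow, ← Real.mul_rpow (by positivity) (by positivity)]
  congr 2
  field_simp

end Ray

noncomputable section Sphere

open Metric

section Polar

open scoped Pointwise

theorem Ioo_smul_preimage_inter_sphere {E : Type*} [SeminormedAddCommGroup E]
    [NormedSpace ℝ E] (Φ : E ≃ₗᵢ[ℝ] E) (s : Set E) :
    Ioo (0 : ℝ) 1 • (Φ ⁻¹' s ∩ sphere 0 1) = Φ ⁻¹' (Ioo (0 : ℝ) 1 • (s ∩ sphere 0 1)) := by
  ext y
  simp only [mem_smul, mem_inter_iff, mem_preimage, mem_sphere_zero_iff_norm]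
  constructor
  · rintro ⟨r, hr, w, ⟨hws, hw⟩, rfl⟩
    exact ⟨r, hr, Φ w, ⟨hws, by rw [Φ.norm_map, hw]⟩, (map_smul Φ r w).symm⟩
  · rintro ⟨r, hr, w, ⟨hws, hw⟩, hy⟩
    exact ⟨r, hr, Φ.symm w, ⟨by simpa using hws, by rw [Φ.symm.norm_map, hw]⟩,
      Φ.injective (by simpa using hy)⟩

variable {E : Type*} [NormedAddCommGroup E] [NormedSpace ℝ E] [MeasurableSpace E] [BorelSpace E]

theorem lintegral_eq_lintegral_sphere [FiniteDimensional ℝ E] [Nontrivial E] (μ : Measure E)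
    [μ.IsAddHaarMeasure] {F : E → ℝ≥0∞} (hF : Measurable F) :
    ∫⁻ y, F y ∂μ = ∫⁻ w : sphere (0 : E) 1, (∫⁻ r in Ioi (0 : ℝ),
      ENNReal.ofReal (r ^ (Module.finrank ℝ E - 1)) * F (r • w.1)) ∂μ.toSphere := by
  calc ∫⁻ y, F y ∂μ = ∫⁻ y : ({(0 : E)}ᶜ : Set E), F y ∂(μ.comap (↑)) := by
        rw [lintegral_subtype_comap (measurableSet_singleton _).compl, restrict_compl_singleton]
    _ = ∫⁻ x : sphere (0 : E) 1 × Ioi (0 : ℝ), F (x.2.1 • x.1.1)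
          ∂μ.toSphere.prod (.volumeIoiPow (Module.finrank ℝ E - 1)) := by
        rw [← μ.measurePreserving_homeomorphUnitSphereProd.lintegral_comp_emb
          (Homeomorph.measurableEmbedding _)]
        refine lintegral_congr fun y => ?_
        have : ‖y.1‖ ≠ 0 := norm_ne_zero_iff.2 y.2
        simp [smul_smul, mul_inv_cancel₀ this]
    _ = ∫⁻ w : sphere (0 : E) 1, ∫⁻ r : Ioi (0 : ℝ), F (r.1 • w.1)
          ∂(.volumeIoiPow (Module.finrank ℝ E - 1)) ∂μ.toSphere :=
        lintegral_prod _ (by fun_prop)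
    _ = _ := by
        refine lintegral_congr fun w => ?_
        rw [Measure.volumeIoiPow, lintegral_withDensity_eq_lintegral_mul _ (by fun_prop)
          (by fun_prop)]
        exact lintegral_subtype_comap measurableSet_Ioi
          (fun r : ℝ => ENNReal.ofReal (r ^ (Module.finrank ℝ E - 1)) * F (r • w.1))

theorem measurePreserving_map_toSphere {μ : Measure E} {Φ : E ≃ₗᵢ[ℝ] E}
    (hΦ : MeasurePreserving Φ μ μ) :
    MeasurePreserving Φ (μ.toSphere.map (↑)) (μ.toSphere.map (↑)) := by
  refine ⟨hΦ.measurable, Measure.ext fun s hs => ?_⟩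
  rw [Measure.map_apply hΦ.measurable hs,
    Measure.map_apply measurable_subtype_coe (hΦ.measurable hs),
    Measure.map_apply measurable_subtype_coe hs,
    Measure.toSphere_apply' _ (measurable_subtype_coe (hΦ.measurable hs)),
    Measure.toSphere_apply' _ (measurable_subtype_coe hs), Subtype.image_preimage_coe,
    Subtype.image_preimage_coe, inter_comm, inter_comm _ s, Ioo_smul_preimage_inter_sphere,
    hΦ.measure_preimage_emb Φ.toHomeomorph.measurableEmbedding]

theorem lintegral_sphere_isometry {μ : Measure E} {Φ : E ≃ₗᵢ[ℝ] E} (hΦ : MeasurePreserving Φ μ μ)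
    {G : E → ℝ≥0∞} (hG : Measurable G) :
    ∫⁻ w : sphere (0 : E) 1, G (Φ w) ∂μ.toSphere = ∫⁻ w : sphere (0 : E) 1, G w ∂μ.toSphere := by
  rw [← lintegral_map hG measurable_subtype_coe,
    ← (measurePreserving_map_toSphere hΦ).lintegral_comp hG]
  exact (lintegral_map (hG.comp hΦ.measurable) measurable_subtype_coe).symm

theorem lintegral_sphere_neg [FiniteDimensional ℝ E] (μ : Measure E) [μ.IsAddHaarMeasure]
    {G : E → ℝ≥0∞} (hG : Measurable G) :
    ∫⁻ w : sphere (0 : E) 1, G (-w.1) ∂μ.toSphere = ∫⁻ w : sphere (0 : E) 1, G w ∂μ.toSphere :=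
  lintegral_sphere_isometry (Φ := LinearIsometryEquiv.neg ℝ) (Measure.measurePreserving_neg μ) hG

end Polar

theorem exists_isometry_map_eq {F : Type*} [NormedAddCommGroup F] [InnerProductSpace ℝ F]
    [FiniteDimensional ℝ F] {v w : F} (h : ‖v‖ = ‖w‖) : ∃ Φ : F ≃ₗᵢ[ℝ] F, Φ v = w :=
  ⟨_, Submodule.reflection_sub h⟩

theorem integrable_abs_rpow_mul_exp_neg_sq {β : ℝ} (hβ : -1 < β) :
    Integrable fun t : ℝ => |t| ^ β * Real.exp (-t ^ 2) := by
  have hpos : IntegrableOn (fun t : ℝ => |t| ^ β * Real.exp (-t ^ 2)) (Ioi 0) :=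
    (integrableOn_rpow_mul_exp_neg_rpow hβ two_pos).congr_fun
      (fun t (ht : 0 < t) => by simp [abs_of_pos ht]) measurableSet_Ioi
  have hneg : IntegrableOn (fun t : ℝ => |t| ^ β * Real.exp (-t ^ 2)) (Iic 0) := by
    have := ((Measure.measurePreserving_neg (volume : Measure ℝ)).integrableOn_comp_preimage
      (Homeomorph.neg ℝ).measurableEmbedding).2 hpos
    rw [integrableOn_Iic_iff_integrableOn_Iio]
    simpa [Function.comp_def] using this
  rw [← integrableOn_univ, ← Iic_union_Ioi (a := (0 : ℝ))]
  exact hneg.union hpos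

theorem integral_abs_rpow_mul_exp_neg_sq {β : ℝ} (hβ : -1 < β) :
    ∫ t : ℝ, |t| ^ β * Real.exp (-t ^ 2) = Real.Gamma ((1 + β) / 2) := by
  have heven := integral_comp_abs (f := fun t : ℝ => t ^ β * Real.exp (-t ^ 2))
  have hhalf := integral_rpow_mul_exp_neg_rpow (p := 2) (q := β) two_pos hβ
  simp only [sq_abs] at heven
  simp only [Real.rpow_two] at hhalf
  rw [heven, hhalf, add_comm β 1]
  ring

variable {n : ℕ}

local notation "𝔼" => EuclideanSpace ℝ (Fin n)

theorem lintegral_sphere_inner {e : 𝔼} (he : ‖e‖ = 1) (i : Fin n) (β : ℝ) :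
    ∫⁻ w : sphere (0 : 𝔼) 1, ENNReal.ofReal (|inner ℝ e w.1| ^ β)
        ∂(volume : Measure 𝔼).toSphere =
      ∫⁻ w : sphere (0 : 𝔼) 1, ENNReal.ofReal (|w.1 i| ^ β) ∂(volume : Measure 𝔼).toSphere := by
  obtain ⟨Φ, hΦ⟩ := exists_isometry_map_eq (v := EuclideanSpace.single i (1 : ℝ)) (w := e)
    (by simp [he])
  rw [← lintegral_sphere_isometry Φ.measurePreserving
    (G := fun w => ENNReal.ofReal (|inner ℝ e w| ^ β)) (by fun_prop)]
  refine lintegral_congr fun w => ?_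
  rw [← hΦ, LinearIsometryEquiv.inner_map_map, EuclideanSpace.inner_single_left]
  simp

theorem prod_gaussian_mul_abs_rpow (i : Fin n) (β : ℝ) (x : Fin n → ℝ) :
    ∏ j, (if j = i then |x j| ^ β else 1) * Real.exp (-x j ^ 2) =
      |x i| ^ β * Real.exp (-∑ j, x j ^ 2) := by
  rw [Finset.prod_mul_distrib, ← Real.exp_sum, Finset.sum_neg_distrib, Finset.prod_ite_eq']
  simp

theorem prod_ite_Gamma_sqrt_pi (i : Fin n) (c : ℝ) :
    ∏ j, (if j = i then c else Real.sqrt Real.pi) = Real.pi ^ (((n : ℝ) - 1) / 2) * c := by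
  rw [Finset.prod_ite, Finset.filter_eq' Finset.univ i]
  simp only [Finset.mem_univ, if_true, Finset.prod_const, Finset.card_singleton, pow_one]
  rw [Finset.filter_ne' Finset.univ i, Finset.card_erase_of_mem (Finset.mem_univ i),
    Finset.card_univ, Fintype.card_fin, mul_comm, Real.sqrt_eq_rpow, ← Real.rpow_natCast,
    ← Real.rpow_mul Real.pi_pos.le, Nat.cast_sub (Fin.pos i)]
  congr 2
  push_cast; ring

theorem lintegral_abs_rpow_mul_exp_neg_norm_sq {β : ℝ} (hβ : -1 < β) (i : Fin n) :
    ∫⁻ y : 𝔼, ENNReal.ofReal (|y i| ^ β * Real.exp (-‖y‖ ^ 2)) =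
      ENNReal.ofReal (Real.pi ^ (((n : ℝ) - 1) / 2) * Real.Gamma ((1 + β) / 2)) := by
  set f : Fin n → ℝ → ℝ := fun j t => (if j = i then |t| ^ β else 1) * Real.exp (-t ^ 2) with hf
  have hfi : ∀ j, Integrable (f j) := by
    intro j
    by_cases h : j = i
    · simpa [hf, h] using integrable_abs_rpow_mul_exp_neg_sq hβ
    · simpa [hf, h] using integrable_exp_neg_mul_sq one_pos
  have hfint : ∀ j, ∫ t, f j t =
      if j = i then Real.Gamma ((1 + β) / 2) else Real.sqrt Real.pi := by
    intro j
    by_cases h : j = i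
    · simpa [hf, h] using integral_abs_rpow_mul_exp_neg_sq hβ
    · simpa [hf, h] using integral_gaussian 1
  have hval : ∫ x : Fin n → ℝ, ∏ j, f j (x j) =
      Real.pi ^ (((n : ℝ) - 1) / 2) * Real.Gamma ((1 + β) / 2) := by
    simp only [integral_fintype_prod_volume_eq_prod, hfint, prod_ite_Gamma_sqrt_pi]
  rw [← hval, ofReal_integral_eq_lintegral_ofReal]
  · rw [← (EuclideanSpace.volume_preserving_symm_measurableEquiv_toLp (Fin n)).lintegral_comp_emb
      (MeasurableEquiv.measurableEmbedding _)]
    refine lintegral_congr fun y => ?_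
    rw [prod_gaussian_mul_abs_rpow, EuclideanSpace.norm_eq, Real.sq_sqrt (by positivity)]
    simp
  · exact Integrable.fintype_prod hfi
  · refine Filter.Eventually.of_forall fun x => ?_
    simp only [Pi.zero_apply, hf, prod_gaussian_mul_abs_rpow]
    positivity

theorem lintegral_rpow_mul_exp_neg_sq {s : ℝ} (hs : -1 < s) :
    ∫⁻ r in Ioi (0 : ℝ), ENNReal.ofReal (r ^ s * Real.exp (-r ^ 2)) =
      ENNReal.ofReal (Real.Gamma ((s + 1) / 2) / 2) := by
  have hint := integrableOn_rpow_mul_exp_neg_rpow hs two_pos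
  have hval := integral_rpow_mul_exp_neg_rpow two_pos hs
  simp only [Real.rpow_two] at hint hval
  rw [← ofReal_integral_eq_lintegral_ofReal hint, hval, one_div_mul_eq_div]
  filter_upwards [ae_restrict_mem measurableSet_Ioi] with r hr
  exact mul_nonneg (Real.rpow_nonneg (mem_Ioi.1 hr).le _) (Real.exp_pos _).le

theorem lintegral_ray_abs_rpow_mul_exp {β : ℝ} (hβ : 0 < β) (i : Fin n) (w : sphere (0 : 𝔼) 1) :
    ∫⁻ r in Ioi (0 : ℝ), ENNReal.ofReal (r ^ (n - 1)) *
        ENNReal.ofReal (|(r • w.1) i| ^ β * Real.exp (-‖r • w.1‖ ^ 2)) =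
      ENNReal.ofReal (|w.1 i| ^ β) * ENNReal.ofReal (Real.Gamma (((n : ℝ) + β) / 2) / 2) := by
  have hn : (1 : ℝ) ≤ n := by exact_mod_cast Fin.pos i
  rw [show (n : ℝ) + β = (n : ℝ) - 1 + β + 1 by ring,
    ← lintegral_rpow_mul_exp_neg_sq (by linarith), ← lintegral_const_mul _ (by fun_prop)]
  refine setLIntegral_congr_fun measurableSet_Ioi fun r (hr : 0 < r) => ?_
  rw [← ENNReal.ofReal_mul (by positivity), ← ENNReal.ofReal_mul (by positivity)]
  congr 1
  rw [norm_smul, norm_eq_of_mem_sphere, Real.norm_of_nonneg hr.le, mul_one, PiLp.smul_apply,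
    smul_eq_mul, abs_mul, abs_of_pos hr, Real.mul_rpow hr.le (abs_nonneg _), Real.rpow_add hr,
    show (n : ℝ) - 1 = ((n - 1 : ℕ) : ℝ) by push_cast [Nat.cast_sub (Fin.pos i)]; ring,
    Real.rpow_natCast]
  ring

/-- The moment `∫_{S^{n-1}} |w_i|^β dw` of a coordinate, evaluated for `β > 0` in
`lintegral_sphere_abs_rpow`. -/
def sphereMoment (n : ℕ) (β : ℝ) : ℝ :=
  2 * Real.pi ^ (((n : ℝ) - 1) / 2) * Real.Gamma ((1 + β) / 2) / Real.Gamma (((n : ℝ) + β) / 2)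

theorem sphereMoment_pos {β : ℝ} (n : ℕ) (hβ : 0 < β) : 0 < sphereMoment n β :=
  div_pos (mul_pos (by positivity) (Real.Gamma_pos_of_pos (by positivity)))
    (Real.Gamma_pos_of_pos (by positivity))

/-- Obtained by integrating `|y i|^β exp (-|y|²)` in Cartesian and in polar coordinates. -/
theorem lintegral_sphere_abs_rpow {β : ℝ} (hβ : 0 < β) (i : Fin n) :
    ∫⁻ w : sphere (0 : 𝔼) 1, ENNReal.ofReal (|w.1 i| ^ β) ∂(volume : Measure 𝔼).toSphere =
      ENNReal.ofReal (sphereMoment n β) := by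
  have : NeZero n := ⟨(Fin.pos i).ne'⟩
  have hG : 0 < Real.Gamma (((n : ℝ) + β) / 2) := Real.Gamma_pos_of_pos (by positivity)
  have hgauss := lintegral_abs_rpow_mul_exp_neg_norm_sq (by linarith : -1 < β) i
  rw [lintegral_eq_lintegral_sphere _ (by fun_prop), finrank_euclideanSpace_fin] at hgauss
  simp only [lintegral_ray_abs_rpow_mul_exp hβ] at hgauss
  rw [lintegral_mul_const _ (by fun_prop)] at hgauss
  rw [ENNReal.eq_div_iff (by simpa using hG) ENNReal.ofReal_ne_top |>.2
    ((mul_comm _ _).trans hgauss), ← ENNReal.ofReal_div_of_pos (by positivity)]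
  congr 1
  rw [sphereMoment]
  field_simp

end Sphere

section Gauge

variable {E : Type*} [NormedAddCommGroup E] [NormedSpace ℝ E] [MeasurableSpace E]

/-- `σ x z` is the reciprocal of the first time at which the ray `x + t z`, `t ≥ 0`, leaves `Ω`
(and `0` if it never does). -/
structure IsGauge (Ω : Set E) (σ : E → E → ℝ) : Prop where
  nonneg : ∀ x z, 0 ≤ σ x z
  measurable : Measurable fun q : E × E => σ q.1 q.2
  lt_iff : ∀ x ∈ Ω, ∀ z, ∀ t : ℝ, 0 < t → (t * σ x z < 1 ↔ ∀ s ∈ Icc 0 t, x + s • z ∈ Ω)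

theorem le_of_forall_mul_lt_one {a b : ℝ} (hb : 0 ≤ b)
    (h : ∀ t : ℝ, 0 < t → t * b < 1 → t * a < 1) : a ≤ b := by
  by_contra! hab
  have ha : 0 < a := hb.trans_lt hab
  have hlt := h a⁻¹ (inv_pos.2 ha) (by rwa [inv_mul_lt_iff₀ ha, mul_one])
  rw [inv_mul_cancel₀ ha.ne'] at hlt
  exact lt_irrefl _ hlt

theorem eq_of_forall_mul_lt_one_iff {a b : ℝ} (ha : 0 ≤ a) (hb : 0 ≤ b)
    (h : ∀ t : ℝ, 0 < t → (t * a < 1 ↔ t * b < 1)) : a = b :=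
  le_antisymm (le_of_forall_mul_lt_one hb fun t ht => (h t ht).2)
    (le_of_forall_mul_lt_one ha fun t ht => (h t ht).1)

namespace IsGauge

variable {Ω : Set E} {σ : E → E → ℝ} {x z : E}

theorem apply_smul (h : IsGauge Ω σ) (hx : x ∈ Ω) {r : ℝ} (hr : 0 < r) :
    σ x (r • z) = r * σ x z := by
  refine eq_of_forall_mul_lt_one_iff (h.nonneg _ _) (mul_nonneg hr.le (h.nonneg _ _)) fun t ht => ?_
  rw [h.lt_iff x hx _ t ht, ← mul_assoc, h.lt_iff x hx z _ (mul_pos ht hr)]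
  constructor
  · intro H s hs
    have := H (s / r) ⟨div_nonneg hs.1 hr.le, (div_le_iff₀ hr).2 hs.2⟩
    rwa [smul_smul, div_mul_cancel₀ _ hr.ne'] at this
  · intro H s hs
    rw [smul_smul]
    exact H _ ⟨mul_nonneg hs.1 hr.le, mul_le_mul_of_nonneg_right hs.2 hr.le⟩

theorem segment_mem (h : IsGauge Ω σ) (hx : x ∈ Ω) (hz : σ x z < 1) {s : ℝ}
    (hs : s ∈ Icc (0 : ℝ) 1) : x + s • z ∈ Ω :=
  (h.lt_iff x hx z 1 one_pos).1 (by simpa using hz) s hs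

theorem add_mem (h : IsGauge Ω σ) (hx : x ∈ Ω) (hz : σ x z < 1) : x + z ∈ Ω := by
  simpa using h.segment_mem hx hz (right_mem_Icc.2 zero_le_one)

theorem apply_add_self (h : IsGauge Ω σ) (hx : x ∈ Ω) (hz : σ x z < 1) :
    σ (x + z) z = σ x z / (1 - σ x z) := by
  have h1 : 0 < 1 - σ x z := by linarith
  refine eq_of_forall_mul_lt_one_iff (h.nonneg _ _) (div_nonneg (h.nonneg _ _) h1.le)
    fun t ht => ?_
  rw [h.lt_iff _ (h.add_mem hx hz) _ t ht, mul_div_assoc', div_lt_one h1,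
    show t * σ x z < 1 - σ x z ↔ (t + 1) * σ x z < 1 by constructor <;> intro <;> linarith,
    h.lt_iff x hx z _ (by linarith)]
  constructor
  · intro H s hs
    by_cases hs1 : s ≤ 1
    · exact h.segment_mem hx hz ⟨hs.1, hs1⟩
    · have := H (s - 1) ⟨by linarith, by linarith [hs.2]⟩
      rwa [add_assoc, sub_smul, one_smul, add_sub_cancel] at this
  · intro H s hs
    have := H (s + 1) ⟨by linarith [hs.1], by linarith [hs.2]⟩
    rwa [add_smul, one_smul, add_comm (s • z), ← add_assoc] at this

theorem apply_add_self_neg (h : IsGauge Ω σ) (hx : x ∈ Ω) (hz : σ x z < 1) :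
    σ (x + z) (-z) = σ x (-z) / (1 + σ x (-z)) := by
  have hneg := h.nonneg x (-z)
  have hpos : 0 < 1 + σ x (-z) := by linarith
  refine eq_of_forall_mul_lt_one_iff (h.nonneg _ _) (div_nonneg hneg hpos.le) fun t ht => ?_
  rw [h.lt_iff _ (h.add_mem hx hz) _ t ht, mul_div_assoc', div_lt_one hpos]
  have hback : ∀ s : ℝ, x + z + s • -z = x + (s - 1) • -z := fun s => by module
  have hforth : ∀ s : ℝ, x + z + s • -z = x + (1 - s) • z := fun s => by module
  by_cases ht1 : t ≤ 1
  · refine iff_of_true (fun s hs => ?_) (by nlinarith)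
    rw [hforth]
    exact h.segment_mem hx hz ⟨by linarith [hs.2], by linarith [hs.1]⟩
  · rw [show t * σ x (-z) < 1 + σ x (-z) ↔ (t - 1) * σ x (-z) < 1 by
      constructor <;> intro <;> linarith, h.lt_iff x hx _ _ (by linarith)]
    constructor
    · intro H s hs
      have := H (s + 1) ⟨by linarith [hs.1], by linarith [hs.2]⟩
      rwa [hback, add_sub_cancel_right] at this
    · intro H s hs
      by_cases hs1 : s ≤ 1
      · rw [hforth]
        exact h.segment_mem hx hz ⟨by linarith, by linarith [hs.1]⟩
      · rw [hback]
        exact H (s - 1) ⟨by linarith, by linarith [hs.2]⟩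

theorem apply_le_inv (h : IsGauge Ω σ) (hx : x ∈ Ω) {d : ℝ} (hd : 0 < d)
    (hb : Metric.ball x d ⊆ Ω) (hz : ‖z‖ = 1) : σ x z ≤ d⁻¹ := by
  by_contra! hlt
  have hσ : 0 < σ x z := lt_trans (inv_pos.2 hd) hlt
  have h1 : ¬ ((σ x z)⁻¹ * σ x z < 1) := by rw [inv_mul_cancel₀ hσ.ne']; exact lt_irrefl _
  rw [h.lt_iff x hx z _ (inv_pos.2 hσ)] at h1
  refine h1 fun s hs => hb ?_
  rw [Metric.mem_ball, dist_self_add_left, norm_smul, hz, mul_one, Real.norm_of_nonneg hs.1]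
  exact lt_of_le_of_lt hs.2 (inv_lt_of_inv_lt₀ hd hlt)

end IsGauge

/-- The symmetric truncation at level `V` of the set of pairs `(x, y)` of points of `Ω` joined by a
segment in `Ω`: in terms of the two exit times of the line through `x` and `y`, the last condition
is invariant under exchanging `x` and `y`. -/
def truncRegion (Ω : Set E) (σ : E → E → ℝ) (V : ℝ) : Set (E × E) :=
  {q | q.1 ∈ Ω ∧ σ q.1 (q.2 - q.1) < 1 ∧
    2 + σ q.1 (q.1 - q.2) - σ q.1 (q.2 - q.1) ≤ V * (σ q.1 (q.2 - q.1) + σ q.1 (q.1 - q.2))}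

/-- The quotient of the values at `y` and at `x` of the one-dimensional ground state
`t ↦ (t (L - t)) ^ ((α - 1) / 2)` of the chord of length `L` through `x` and `y`. -/
noncomputable def groundRatio (σ : E → E → ℝ) (α : ℝ) (q : E × E) : ℝ :=
  ((1 - σ q.1 (q.2 - q.1)) * (1 + σ q.1 (q.1 - q.2))) ^ ((α - 1) / 2)

variable {Ω : Set E} {σ : E → E → ℝ} {V α : ℝ}

namespace IsGauge

theorem eq_div_one_add_of_mem_truncRegion (h : IsGauge Ω σ) {x y : E}
    (hq : (x, y) ∈ truncRegion Ω σ V) : σ y (x - y) = σ x (x - y) / (1 + σ x (x - y)) := by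
  have := h.apply_add_self_neg hq.1 hq.2.1
  rwa [neg_sub, add_sub_cancel] at this

theorem eq_div_one_sub_of_mem_truncRegion (h : IsGauge Ω σ) {x y : E}
    (hq : (x, y) ∈ truncRegion Ω σ V) : σ y (y - x) = σ x (y - x) / (1 - σ x (y - x)) := by
  have := h.apply_add_self hq.1 hq.2.1
  rwa [add_sub_cancel] at this

theorem snd_mem_of_mem_truncRegion (h : IsGauge Ω σ) {x y : E}
    (hq : (x, y) ∈ truncRegion Ω σ V) : y ∈ Ω := by
  simpa using h.add_mem hq.1 hq.2.1

theorem swap_mem_truncRegion (h : IsGauge Ω σ) {x y : E} (hq : (x, y) ∈ truncRegion Ω σ V) :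
    (y, x) ∈ truncRegion Ω σ V := by
  have hx' := h.eq_div_one_add_of_mem_truncRegion hq
  have hy' := h.eq_div_one_sub_of_mem_truncRegion hq
  refine ⟨h.snd_mem_of_mem_truncRegion hq, ?_, ?_⟩ <;>
  obtain ⟨-, hlt, hV⟩ := hq <;> dsimp only at hlt hV ⊢ <;> have hs := h.nonneg x (x - y)
  · rw [hx', div_lt_one (by linarith)]
    linarith
  · rw [hx', hy']
    set s := σ x (y - x)
    set s' := σ x (x - y)
    have hs1 : 0 < 1 - s := by linarith
    have : 0 < 1 + s' := by linarith
    calc 2 + s / (1 - s) - s' / (1 + s') = (2 + s' - s) / ((1 - s) * (1 + s')) := by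
          field_simp; ring
      _ ≤ V * (s + s') / ((1 - s) * (1 + s')) := by gcongr
      _ = V * (s' / (1 + s') + s / (1 - s)) := by field_simp; ring

theorem groundRatio_pos (h : IsGauge Ω σ) {q : E × E} (hq : q ∈ truncRegion Ω σ V) :
    0 < groundRatio σ α q := by
  have := h.nonneg q.1 (q.1 - q.2)
  exact Real.rpow_pos_of_pos (mul_pos (by linarith [hq.2.1]) (by linarith)) _

theorem groundRatio_swap (h : IsGauge Ω σ) {q : E × E} (hq : q ∈ truncRegion Ω σ V) :
    groundRatio σ α q.swap = (groundRatio σ α q)⁻¹ := by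
  obtain ⟨x, y⟩ := q
  have hs1 : 0 < 1 - σ x (y - x) := sub_pos.2 hq.2.1
  have : 0 < 1 + σ x (x - y) := by linarith [h.nonneg x (x - y)]
  simp only [groundRatio, Prod.swap_prod_mk]
  rw [h.eq_div_one_add_of_mem_truncRegion hq, h.eq_div_one_sub_of_mem_truncRegion hq,
    ← Real.inv_rpow (by positivity)]
  congr 1
  field_simp
  ring

variable [BorelSpace E] [SecondCountableTopology E]

theorem measurable_forward (h : IsGauge Ω σ) :
    Measurable fun q : E × E => σ q.1 (q.2 - q.1) :=
  h.measurable.comp (by fun_prop : Measurable fun q : E × E => (q.1, q.2 - q.1))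

theorem measurable_backward (h : IsGauge Ω σ) :
    Measurable fun q : E × E => σ q.1 (q.1 - q.2) :=
  h.measurable.comp (by fun_prop : Measurable fun q : E × E => (q.1, q.1 - q.2))

theorem measurableSet_truncRegion (h : IsGauge Ω σ) (hΩ : MeasurableSet Ω) (V : ℝ) :
    MeasurableSet (truncRegion Ω σ V) := by
  have hf := h.measurable_forward
  have hb := h.measurable_backward
  exact (measurable_fst hΩ).inter ((measurableSet_lt hf measurable_const).inter
    (measurableSet_le ((measurable_const.add hb).sub hf) ((hf.add hb).const_mul V)))

theorem measurable_groundRatio (h : IsGauge Ω σ) (α : ℝ) : Measurable (groundRatio σ α) :=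
  ((measurable_const.sub h.measurable_forward).mul
    (measurable_const.add h.measurable_backward)).pow_const _

end IsGauge

end Gauge

section GroundState

variable {X : Type*}

/-- The remainder density of the ground state representation: if `ρ (x, y) = g y / g x` and
`u = g v` it is `g x * g y * (v x - v y) ^ 2`. -/
noncomputable def groundRemainder (ρ : X × X → ℝ) (u : X → ℝ) (q : X × X) : ℝ≥0∞ :=
  ENNReal.ofReal ((ρ q)⁻¹ * (ρ q * u q.1 - u q.2) ^ 2)

theorem ofReal_sub_sq_add_eq {ρ : ℝ} (hρ : 0 < ρ) (a b : ℝ) :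
    ENNReal.ofReal ((a - b) ^ 2) +
        (ENNReal.ofReal ρ * ENNReal.ofReal (a ^ 2) + ENNReal.ofReal ρ⁻¹ * ENNReal.ofReal (b ^ 2)) =
      ENNReal.ofReal (a ^ 2) + ENNReal.ofReal (b ^ 2) +
        ENNReal.ofReal (ρ⁻¹ * (ρ * a - b) ^ 2) := by
  rw [← ENNReal.ofReal_mul hρ.le, ← ENNReal.ofReal_mul (inv_pos.2 hρ).le,
    ← ENNReal.ofReal_add (by positivity) (by positivity),
    ← ENNReal.ofReal_add (by positivity) (by positivity),
    ← ENNReal.ofReal_add (by positivity) (by positivity),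
    ← ENNReal.ofReal_add (by positivity) (by positivity)]
  congr 1
  field_simp
  ring

variable [MeasurableSpace X]

theorem lintegral_prod_snd_mul_of_symm (μ : Measure X) [SFinite μ] (f : X → ℝ≥0∞)
    {K L : X × X → ℝ≥0∞} (hKL : ∀ q, K q.swap = L q) :
    ∫⁻ q, f q.2 * K q ∂μ.prod μ = ∫⁻ q, f q.1 * L q ∂μ.prod μ := by
  rw [← lintegral_prod_swap]
  exact lintegral_congr fun q => by rw [hKL, Prod.snd_swap]

theorem groundState_identity (μ : Measure X) [SFinite μ] {K : X × X → ℝ≥0∞} (hK : Measurable K)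
    (hsymm : ∀ q, K q.swap = K q) {ρ : X × X → ℝ} (hρ : Measurable ρ)
    (hpos : ∀ q, K q ≠ 0 → 0 < ρ q) (hswap : ∀ q, K q ≠ 0 → ρ q.swap = (ρ q)⁻¹)
    {u : X → ℝ} (hu : Measurable u) :
    (1 / 2) * ∫⁻ q, ENNReal.ofReal ((u q.1 - u q.2) ^ 2) * K q ∂μ.prod μ +
        ∫⁻ q, ENNReal.ofReal (u q.1 ^ 2) * (ENNReal.ofReal (ρ q) * K q) ∂μ.prod μ =
      ∫⁻ q, ENNReal.ofReal (u q.1 ^ 2) * K q ∂μ.prod μ +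
        (1 / 2) * ∫⁻ q, groundRemainder ρ u q * K q ∂μ.prod μ := by
  have hratio : ∀ q, ENNReal.ofReal (ρ q.swap)⁻¹ * K q.swap = ENNReal.ofReal (ρ q) * K q := by
    intro q
    by_cases h : K q = 0
    · simp [hsymm, h]
    · rw [hsymm, hswap q h, inv_inv]
  have hpointwise : ∀ q, ENNReal.ofReal ((u q.1 - u q.2) ^ 2) * K q +
      (ENNReal.ofReal (u q.1 ^ 2) * (ENNReal.ofReal (ρ q) * K q) +
        ENNReal.ofReal (u q.2 ^ 2) * (ENNReal.ofReal (ρ q)⁻¹ * K q)) =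
      ENNReal.ofReal (u q.1 ^ 2) * K q + ENNReal.ofReal (u q.2 ^ 2) * K q +
        groundRemainder ρ u q * K q := by
    intro q
    by_cases h : K q = 0
    · simp [h]
    · rw [← add_mul, groundRemainder, ← add_mul, ← ofReal_sub_sq_add_eq (hpos q h)]
      ring
  have hdouble := lintegral_congr (μ := μ.prod μ) hpointwise
  rw [lintegral_add_left (by fun_prop), lintegral_add_left (by fun_prop),
    lintegral_add_left (by fun_prop), lintegral_add_left (by fun_prop),
    lintegral_prod_snd_mul_of_symm μ (fun x => ENNReal.ofReal (u x ^ 2)) hratio,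
    lintegral_prod_snd_mul_of_symm μ (fun x => ENNReal.ofReal (u x ^ 2)) hsymm,
    ← two_mul, ← two_mul] at hdouble
  have hhalf := congrArg (fun t => (1 / 2 : ℝ≥0∞) * t) hdouble
  have htwo : (1 / 2 : ℝ≥0∞) * 2 = 1 := by
    rw [one_div, ENNReal.inv_mul_cancel (by simp) (by simp)]
  simpa only [mul_add, ← mul_assoc, htwo, one_mul] using hhalf

end GroundState

noncomputable section Slicing

variable {n : ℕ}

local notation "𝔼" => EuclideanSpace ℝ (Fin n)
local notation "𝕊" => Metric.sphere (0 : EuclideanSpace ℝ (Fin n)) 1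
local notation "dS" => Measure.toSphere (volume : Measure (EuclideanSpace ℝ (Fin n)))

/-- The Riesz kernel `|x - y| ^ (-(n + α))` restricted to the truncated region. -/
def truncKernel (Ω : Set 𝔼) (σ : 𝔼 → 𝔼 → ℝ) (α V : ℝ) : 𝔼 × 𝔼 → ℝ≥0∞ :=
  (truncRegion Ω σ V).indicator fun q => ENNReal.ofReal (‖q.1 - q.2‖ ^ (-((n : ℝ) + α)))

/-- The energy `(1/2) ∫∫ (u(x) - u(y))² K(x, y) dx dy` of the truncated Riesz kernel `K`. -/
def truncEnergy (Ω : Set 𝔼) (σ : 𝔼 → 𝔼 → ℝ) (α V : ℝ) (u : 𝔼 → ℝ) : ℝ≥0∞ :=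
  (1 / 2) * ∫⁻ q : 𝔼 × 𝔼, ENNReal.ofReal ((u q.1 - u q.2) ^ 2) * truncKernel Ω σ α V q

/-- The energy which `u` retains after the ground states of all lines are divided out. -/
def remainderEnergy (Ω : Set 𝔼) (σ : 𝔼 → 𝔼 → ℝ) (α V : ℝ) (u : 𝔼 → ℝ) : ℝ≥0∞ :=
  (1 / 2) * ∫⁻ q : 𝔼 × 𝔼, groundRemainder (groundRatio σ α) u q * truncKernel Ω σ α V q

/-- The directional integral `∫_{S^{n-1}} (σ(x, w) + σ(x, -w))^β dw`. -/
def dirIntegral (σ : 𝔼 → 𝔼 → ℝ) (β : ℝ) (x : 𝔼) : ℝ≥0∞ :=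
  ∫⁻ w : 𝕊, ENNReal.ofReal ((σ x w.1 + σ x (-w.1)) ^ β) ∂dS

/-- The mass `∫ K(x, y) dy` of the truncated kernel at a point `x` of the domain, in polar
coordinates. -/
def dirMass (σ : 𝔼 → 𝔼 → ℝ) (α V : ℝ) (x : 𝔼) : ℝ≥0∞ :=
  ∫⁻ w : 𝕊, ENNReal.ofReal (rayMass α V (σ x w.1) (σ x (-w.1))) ∂dS

variable {Ω : Set (EuclideanSpace ℝ (Fin n))}
  {σ : EuclideanSpace ℝ (Fin n) → EuclideanSpace ℝ (Fin n) → ℝ} {α V : ℝ}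

theorem regionalForm_eq (Ω : Set 𝔼) (α : ℝ) (u : 𝔼 → ℝ) :
    regionalForm Ω α u = (1 / 2) * ∫⁻ x in Ω, ∫⁻ y in Ω,
      ENNReal.ofReal ((u x - u y) ^ 2) * ENNReal.ofReal (‖x - y‖ ^ (-((n : ℝ) + α))) := by
  simp only [regionalForm, Real.rpow_neg (norm_nonneg _), div_eq_mul_inv,
    ENNReal.ofReal_mul (sq_nonneg _)]

theorem mem_of_truncKernel_ne_zero {q : 𝔼 × 𝔼} (hq : truncKernel Ω σ α V q ≠ 0) :
    q ∈ truncRegion Ω σ V :=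
  mem_of_indicator_ne_zero hq

theorem truncKernel_eq_zero_of_notMem {x : 𝔼} (hx : x ∉ Ω) (y : 𝔼) :
    truncKernel Ω σ α V (x, y) = 0 :=
  indicator_of_notMem (fun h => hx h.1) _

namespace IsGauge

theorem measurable_truncKernel (h : IsGauge Ω σ) (hΩ : MeasurableSet Ω) (α V : ℝ) :
    Measurable (truncKernel Ω σ α V) :=
  (by fun_prop : Measurable fun q : 𝔼 × 𝔼 =>
    ENNReal.ofReal (‖q.1 - q.2‖ ^ (-((n : ℝ) + α)))).indicator (h.measurableSet_truncRegion hΩ V)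

theorem truncKernel_swap (h : IsGauge Ω σ) (q : 𝔼 × 𝔼) :
    truncKernel Ω σ α V q.swap = truncKernel Ω σ α V q := by
  obtain ⟨x, y⟩ := q
  rw [Prod.swap_prod_mk, truncKernel]
  by_cases hq : (x, y) ∈ truncRegion Ω σ V
  · rw [indicator_of_mem hq, indicator_of_mem (h.swap_mem_truncRegion hq), norm_sub_rev]
  · rw [indicator_of_notMem hq, indicator_of_notMem fun hq' => hq (h.swap_mem_truncRegion hq')]

theorem mem_truncRegion_ray_iff (h : IsGauge Ω σ) {x w : 𝔼} (hx : x ∈ Ω) {r : ℝ} (hr : 0 < r) :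
    (x, x + r • w) ∈ truncRegion Ω σ V ↔ r ∈ raySet V (σ x w) (σ x (-w)) := by
  simp only [truncRegion, mem_ofPred_eq, add_sub_cancel_left, sub_add_cancel_left, ← smul_neg,
    h.apply_smul hx hr, hx, true_and]
  rfl

theorem groundRatio_ray (h : IsGauge Ω σ) {x w : 𝔼} (hx : x ∈ Ω) {r : ℝ} (hr : 0 < r) (α : ℝ) :
    groundRatio σ α (x, x + r • w) =
      ((1 - r * σ x w) * (1 + r * σ x (-w))) ^ ((α - 1) / 2) := by
  simp only [groundRatio, add_sub_cancel_left, sub_add_cancel_left, ← smul_neg,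
    h.apply_smul hx hr]

theorem pow_mul_truncKernel_ray [NeZero n] (h : IsGauge Ω σ) {x w : 𝔼} (hx : x ∈ Ω) (hw : ‖w‖ = 1)
    {r : ℝ} (hr : 0 < r) (c : ℝ≥0∞) :
    ENNReal.ofReal (r ^ (n - 1)) * (c * truncKernel Ω σ α V (x, x + r • w)) =
      ENNReal.ofReal (r ^ (-1 - α)) *
        (raySet V (σ x w) (σ x (-w))).indicator (fun _ => c) r := by
  by_cases hm : r ∈ raySet V (σ x w) (σ x (-w))
  · have hdist : ‖x - (x + r • w)‖ = r := by
      rw [sub_add_cancel_left, norm_neg, norm_smul, hw, mul_one, Real.norm_of_nonneg hr.le]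
    have hpow : r ^ (n - 1) * r ^ (-((n : ℝ) + α)) = r ^ (-1 - α) := by
      rw [← Real.rpow_natCast, ← Real.rpow_add hr, Nat.cast_pred (NeZero.pos n)]
      ring_nf
    rw [indicator_of_mem hm, truncKernel,
      indicator_of_mem ((h.mem_truncRegion_ray_iff hx hr).2 hm), hdist, ← hpow,
      ENNReal.ofReal_mul (by positivity)]
    ring
  · rw [indicator_of_notMem hm, truncKernel,
      indicator_of_notMem fun hq => hm ((h.mem_truncRegion_ray_iff hx hr).1 hq)]
    simp

theorem lintegral_mul_truncKernel [NeZero n] (h : IsGauge Ω σ) (hΩ : MeasurableSet Ω) {x : 𝔼}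
    (hx : x ∈ Ω) {g : 𝔼 → ℝ≥0∞} (hg : Measurable g) :
    ∫⁻ y, g y * truncKernel Ω σ α V (x, y) = ∫⁻ w : 𝕊, (∫⁻ r in Ioi (0 : ℝ),
      ENNReal.ofReal (r ^ (-1 - α)) * (raySet V (σ x w.1) (σ x (-w.1))).indicator
        (fun r => g (x + r • w.1)) r) ∂dS := by
  have hK := h.measurable_truncKernel hΩ α V
  rw [← lintegral_add_left_eq_self _ x, lintegral_eq_lintegral_sphere _ (by fun_prop),
    finrank_euclideanSpace_fin]
  refine lintegral_congr fun w => setLIntegral_congr_fun measurableSet_Ioi fun r hr => ?_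
  exact h.pow_mul_truncKernel_ray hx (norm_eq_of_mem_sphere w) hr _

theorem lintegral_truncKernel [NeZero n] (h : IsGauge Ω σ) (hα : 1 ≤ α) (hV : 1 ≤ V)
    (hΩ : MeasurableSet Ω) {x : 𝔼} (hx : x ∈ Ω) :
    ∫⁻ y, truncKernel Ω σ α V (x, y) = dirMass σ α V x := by
  have hpolar := h.lintegral_mul_truncKernel (α := α) (V := V) hΩ hx (g := 1) measurable_one
  simp only [Pi.one_apply, one_mul] at hpolar
  rw [hpolar]
  exact lintegral_congr fun w => lintegral_raySet_one hα hV (h.nonneg _ _) (h.nonneg _ _)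

theorem lintegral_groundRatio_mul_truncKernel [NeZero n] (h : IsGauge Ω σ) (hα : 1 ≤ α)
    (hV : 1 ≤ V) (hΩ : MeasurableSet Ω) {x : 𝔼} (hx : x ∈ Ω) :
    ∫⁻ y, ENNReal.ofReal (groundRatio σ α (x, y)) * truncKernel Ω σ α V (x, y) =
      ∫⁻ w : 𝕊, ENNReal.ofReal (rayGround α V (σ x w.1) (σ x (-w.1))) ∂dS := by
  have hρ := h.measurable_groundRatio α
  rw [h.lintegral_mul_truncKernel hΩ hx (by fun_prop)]
  refine lintegral_congr fun w => ?_
  rw [← lintegral_raySet_ground hα hV (h.nonneg _ _) (h.nonneg _ _)]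
  refine setLIntegral_congr_fun measurableSet_Ioi fun r hr => ?_
  simp only [indicator, h.groundRatio_ray hx hr]

theorem lintegral_prod_truncKernel (h : IsGauge Ω σ) (hΩ : MeasurableSet Ω) {u : 𝔼 → ℝ}
    (hu : Measurable u) {g : 𝔼 × 𝔼 → ℝ≥0∞} (hg : Measurable g) :
    ∫⁻ q : 𝔼 × 𝔼, ENNReal.ofReal (u q.1 ^ 2) * (g q * truncKernel Ω σ α V q) =
      ∫⁻ x in Ω, ENNReal.ofReal (u x ^ 2) * ∫⁻ y, g (x, y) * truncKernel Ω σ α V (x, y) := by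
  have hK := h.measurable_truncKernel hΩ α V
  rw [Measure.volume_eq_prod, lintegral_prod _ (by fun_prop), ← lintegral_indicator hΩ]
  refine lintegral_congr fun x => ?_
  dsimp only
  by_cases hx : x ∈ Ω
  · rw [indicator_of_mem hx, lintegral_const_mul _ (by fun_prop)]
  · rw [indicator_of_notMem hx]
    simp [truncKernel_eq_zero_of_notMem hx]

theorem measurable_add_neg (h : IsGauge Ω σ) :
    Measurable fun q : 𝔼 × 𝔼 => σ q.1 q.2 + σ q.1 (-q.2) :=
  h.measurable.add
    (h.measurable.comp (by fun_prop : Measurable fun q : 𝔼 × 𝔼 => (q.1, -q.2)))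

theorem measurable_dirIntegral (h : IsGauge Ω σ) (β : ℝ) : Measurable (dirIntegral σ β) :=
  ((h.measurable_add_neg.comp (by fun_prop : Measurable fun q : 𝔼 × 𝕊 => (q.1, q.2.1))).pow_const
    β).ennreal_ofReal.lintegral_prod_right'

theorem lintegral_const_mul_add_neg_rpow (h : IsGauge Ω σ) (x : 𝔼) (c β : ℝ) :
    ∫⁻ w : 𝕊, ENNReal.ofReal (c * (σ x w.1 + σ x (-w.1)) ^ β) ∂dS =
      ENNReal.ofReal c * dirIntegral σ β x := by
  have hm : Measurable fun w : 𝕊 => σ x w.1 + σ x (-w.1) :=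
    h.measurable_add_neg.comp (measurable_prodMk_left.comp measurable_subtype_coe)
  rw [dirIntegral, ← lintegral_const_mul _ (hm.pow_const β).ennreal_ofReal]
  exact lintegral_congr fun w => ENNReal.ofReal_mul'
    (Real.rpow_nonneg (add_nonneg (h.nonneg _ _) (h.nonneg _ _)) _)

theorem lintegral_rayGround (h : IsGauge Ω σ) (hα : 0 < α) (hV : 1 ≤ V) (x : 𝔼) :
    ∫⁻ w : 𝕊, ENNReal.ofReal (rayGround α V (σ x w.1) (σ x (-w.1))) ∂dS =
      ENNReal.ofReal (truncInt ((α - 1) / 2) V / 2 ^ α) * dirIntegral σ α x := by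
  rw [← h.lintegral_const_mul_add_neg_rpow]
  refine lintegral_congr fun w => congrArg ENNReal.ofReal ?_
  rw [rayGround_eq hα hV (h.nonneg _ _) (h.nonneg _ _),
    Real.div_rpow (add_nonneg (h.nonneg _ _) (h.nonneg _ _)) two_pos.le]
  ring

theorem measurable_rayMass (h : IsGauge Ω σ) (hα : 0 < α) (V : ℝ) :
    Measurable fun q : 𝔼 × 𝔼 => ENNReal.ofReal (rayMass α V (σ q.1 q.2) (σ q.1 (-q.2))) :=
  (_root_.measurable_rayMass hα V h.measurable
    (h.measurable.comp (by fun_prop : Measurable fun q : 𝔼 × 𝔼 => (q.1, -q.2)))).ennreal_ofReal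

theorem measurable_dirMass (h : IsGauge Ω σ) (hα : 0 < α) (V : ℝ) : Measurable (dirMass σ α V) :=
  ((h.measurable_rayMass hα V).comp
    (by fun_prop : Measurable fun q : 𝔼 × 𝕊 => (q.1, q.2.1))).lintegral_prod_right'

theorem two_mul_dirMass [NeZero n] (h : IsGauge Ω σ) (hα : 0 < α) (hV : 1 ≤ V) (x : 𝔼) :
    2 * dirMass σ α V x =
      ∫⁻ w : 𝕊, ENNReal.ofReal (rayMass α V (σ x w.1) (σ x (-w.1)) +
        rayMass α V (σ x (-w.1)) (σ x w.1)) ∂dS := by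
  have hm : Measurable fun w => ENNReal.ofReal (rayMass α V (σ x w) (σ x (-w))) :=
    (h.measurable_rayMass hα V).comp measurable_prodMk_left
  have hmS : Measurable fun w : 𝕊 => ENNReal.ofReal (rayMass α V (σ x w.1) (σ x (-w.1))) :=
    hm.comp measurable_subtype_coe
  have hneg := lintegral_sphere_neg volume hm
  simp only [neg_neg] at hneg
  simp only [ENNReal.ofReal_add (rayMass_nonneg hV (h.nonneg _ _) (h.nonneg _ _))
    (rayMass_nonneg hV (h.nonneg _ _) (h.nonneg _ _))]
  rw [lintegral_add_left hmS, hneg, two_mul, dirMass]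

theorem truncEnergy_identity [NeZero n] (h : IsGauge Ω σ) (hα : 1 ≤ α) (hV : 1 ≤ V)
    (hΩ : MeasurableSet Ω) {u : 𝔼 → ℝ} (hu : Measurable u) :
    truncEnergy Ω σ α V u +
        ENNReal.ofReal (truncInt ((α - 1) / 2) V / 2 ^ α) *
          (∫⁻ x in Ω, ENNReal.ofReal (u x ^ 2) * dirIntegral σ α x) =
      (∫⁻ x in Ω, ENNReal.ofReal (u x ^ 2) * dirMass σ α V x) + remainderEnergy Ω σ α V u := by
  have hground : ∫⁻ q : 𝔼 × 𝔼, ENNReal.ofReal (u q.1 ^ 2) *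
      (ENNReal.ofReal (groundRatio σ α q) * truncKernel Ω σ α V q) =
      ENNReal.ofReal (truncInt ((α - 1) / 2) V / 2 ^ α) *
        ∫⁻ x in Ω, ENNReal.ofReal (u x ^ 2) * dirIntegral σ α x := by
    have hd := h.measurable_dirIntegral α
    rw [h.lintegral_prod_truncKernel hΩ hu (h.measurable_groundRatio α).ennreal_ofReal,
      ← lintegral_const_mul _ (by fun_prop)]
    refine setLIntegral_congr_fun hΩ fun x hx => ?_
    rw [h.lintegral_groundRatio_mul_truncKernel hα hV hΩ hx,
      h.lintegral_rayGround (by linarith) hV]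
    ring
  have hmass : ∫⁻ q : 𝔼 × 𝔼, ENNReal.ofReal (u q.1 ^ 2) * truncKernel Ω σ α V q =
      ∫⁻ x in Ω, ENNReal.ofReal (u x ^ 2) * dirMass σ α V x := by
    have hprod := h.lintegral_prod_truncKernel (α := α) (V := V) hΩ hu (g := 1) measurable_one
    simp only [Pi.one_apply, one_mul] at hprod
    rw [hprod]
    exact setLIntegral_congr_fun hΩ fun x hx => by
      simp only [h.lintegral_truncKernel hα hV hΩ hx]
  rw [truncEnergy, remainderEnergy, ← hground, ← hmass]
  exact groundState_identity volume (h.measurable_truncKernel hΩ α V) h.truncKernel_swap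
    (h.measurable_groundRatio α) (fun _ hq => h.groundRatio_pos (mem_of_truncKernel_ne_zero hq))
    (fun _ hq => h.groundRatio_swap (mem_of_truncKernel_ne_zero hq)) hu

theorem lintegral_prod_mul_truncKernel_le (h : IsGauge Ω σ) (hΩ : MeasurableSet Ω)
    {g : 𝔼 × 𝔼 → ℝ≥0∞} (hg : Measurable g) :
    ∫⁻ q : 𝔼 × 𝔼, g q * truncKernel Ω σ α V q ≤
      ∫⁻ x in Ω, ∫⁻ y in Ω, g (x, y) * ENNReal.ofReal (‖x - y‖ ^ (-((n : ℝ) + α))) := by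
  have hK := h.measurable_truncKernel hΩ α V
  rw [Measure.volume_eq_prod, lintegral_prod _ (by fun_prop), ← lintegral_indicator hΩ]
  refine lintegral_mono fun x => ?_
  by_cases hx : x ∈ Ω
  · rw [indicator_of_mem hx, ← lintegral_indicator hΩ]
    refine lintegral_mono fun y => ?_
    by_cases hq : (x, y) ∈ truncRegion Ω σ V
    · simp only [truncKernel]
      rw [indicator_of_mem (h.snd_mem_of_mem_truncRegion hq), indicator_of_mem hq]
    · simp [truncKernel, indicator_of_notMem hq]
  · simp [truncKernel_eq_zero_of_notMem hx]

theorem truncEnergy_le_regionalForm (h : IsGauge Ω σ) (hΩ : MeasurableSet Ω) {u : 𝔼 → ℝ}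
    (hu : Measurable u) : truncEnergy Ω σ α V u ≤ regionalForm Ω α u := by
  rw [truncEnergy, regionalForm_eq]
  gcongr
  exact h.lintegral_prod_mul_truncKernel_le hΩ (by fun_prop)

theorem dirIntegral_le (h : IsGauge Ω σ) {β d : ℝ} (hβ : 0 ≤ β) (hd : 0 < d) {x : 𝔼}
    (hx : Metric.ball x d ⊆ Ω) :
    dirIntegral σ β x ≤ ENNReal.ofReal ((d⁻¹ + d⁻¹) ^ β) * dS univ := by
  have hxΩ : x ∈ Ω := hx (Metric.mem_ball_self hd)
  rw [dirIntegral, ← lintegral_const]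
  refine lintegral_mono fun w => ENNReal.ofReal_le_ofReal ?_
  have hw : ‖w.1‖ = 1 := norm_eq_of_mem_sphere w
  exact Real.rpow_le_rpow (add_nonneg (h.nonneg _ _) (h.nonneg _ _))
    (add_le_add (h.apply_le_inv hxΩ hd hx hw) (h.apply_le_inv hxΩ hd hx (by rwa [norm_neg]))) hβ

theorem lintegral_sq_mul_dirIntegral_ne_top (h : IsGauge Ω σ) (hΩ : IsOpen Ω) {u : 𝔼 → ℝ}
    (hu : Measurable u) (hL2 : MemLp u 2) (hc : HasCompactSupport u) (hs : tsupport u ⊆ Ω)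
    {β : ℝ} (hβ : 0 ≤ β) :
    ∫⁻ x in Ω, ENNReal.ofReal (u x ^ 2) * dirIntegral σ β x ≠ ∞ := by
  obtain ⟨d, hd, hsub⟩ := hc.isCompact.exists_thickening_subset_open hΩ hs
  have hbound : ∀ x, ENNReal.ofReal (u x ^ 2) * dirIntegral σ β x ≤
      ENNReal.ofReal (u x ^ 2) * (ENNReal.ofReal ((d⁻¹ + d⁻¹) ^ β) * dS univ) := by
    intro x
    by_cases hx : x ∈ tsupport u
    · gcongr
      exact h.dirIntegral_le hβ hd ((Metric.ball_subset_thickening hx d).trans hsub)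
    · simp [image_eq_zero_of_notMem_tsupport hx]
  refine ((setLIntegral_le_lintegral _ _).trans (lintegral_mono hbound)).trans_lt ?_ |>.ne
  rw [lintegral_mul_const _ (hu.pow_const 2).ennreal_ofReal]
  exact ENNReal.mul_lt_top hL2.integrable_sq.lintegral_lt_top
    (ENNReal.mul_lt_top ENNReal.ofReal_lt_top (measure_lt_top _ _))

end IsGauge

end Slicing

noncomputable section ExitGauge

open Filter Topology

variable {E : Type*} [NormedAddCommGroup E] [NormedSpace ℝ E] {Ω : Set E}

/-- The reciprocal of the exit time of the ray `x + t z`, `t ≥ 0`, from `Ω`. For `x ∉ Ω`, and for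
rays which never leave `Ω`, it is `0`; in the latter case since `sInf ∅ = 0` and `0⁻¹ = 0`. -/
def exitGauge (Ω : Set E) (x z : E) : ℝ :=
  Ω.indicator (fun x => (sInf {t : ℝ | 0 ≤ t ∧ x + t • z ∉ Ω})⁻¹) x

theorem exitGauge_nonneg (Ω : Set E) (x z : E) : 0 ≤ exitGauge Ω x z :=
  indicator_nonneg (fun _ _ => inv_nonneg.2 (Real.sInf_nonneg fun _ ht => ht.1)) x

theorem mul_exitGauge_lt_one_iff (hΩ : IsOpen Ω) {x : E} (hx : x ∈ Ω) (z : E) (t : ℝ) :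
    t * exitGauge Ω x z < 1 ↔ ∀ s ∈ Icc 0 t, x + s • z ∈ Ω := by
  set S := {t : ℝ | 0 ≤ t ∧ x + t • z ∉ Ω}
  have hσ : exitGauge Ω x z = (sInf S)⁻¹ := indicator_of_mem hx _
  have hbdd : BddBelow S := ⟨0, fun t ht => ht.1⟩
  rcases S.eq_empty_or_nonempty with he | hne
  · rw [hσ, he]
    refine iff_of_true (by simp) fun s hs => ?_
    by_contra hmem
    exact eq_empty_iff_forall_notMem.1 he s ⟨hs.1, hmem⟩
  · have hcl : IsClosed S :=
      isClosed_Ici.inter (hΩ.isClosed_compl.preimage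
        (by fun_prop : Continuous fun t : ℝ => x + t • z))
    have hmem : sInf S ∈ S := hcl.csInf_mem hne hbdd
    have hpos : 0 < sInf S := hmem.1.lt_of_ne fun h0 => hmem.2 (by simpa [← h0] using hx)
    rw [hσ, mul_inv_lt_iff₀ hpos, one_mul]
    constructor
    · intro hlt s hs
      by_contra hns
      exact (hs.2.trans_lt hlt).not_ge (csInf_le hbdd ⟨hs.1, hns⟩)
    · intro H
      by_contra! hle
      exact hmem.2 (H _ ⟨hpos.le, hle⟩)

theorem isOpen_setOf_forall_add_smul_mem (hΩ : IsOpen Ω) {K : Set ℝ} (hK : IsCompact K) :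
    IsOpen {q : E × E | ∀ s ∈ K, q.1 + s • q.2 ∈ Ω} := by
  rw [isOpen_iff_eventually]
  intro q hq
  refine hK.eventually_forall_of_forall_eventually
    (P := fun (q : E × E) (s : ℝ) => q.1 + s • q.2 ∈ Ω) fun s hs => ?_
  have hcont : Continuous fun p : (E × E) × ℝ => p.1.1 + p.2 • p.1.2 := by fun_prop
  exact hcont.continuousAt.eventually (hΩ.mem_nhds (hq s hs))

theorem le_exitGauge_iff (hΩ : IsOpen Ω) {c : ℝ} (hc : 0 < c) (x z : E) :
    c ≤ exitGauge Ω x z ↔ x ∈ Ω ∧ ¬ ∀ s ∈ Icc 0 c⁻¹, x + s • z ∈ Ω := by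
  by_cases hx : x ∈ Ω
  · rw [← mul_exitGauge_lt_one_iff hΩ hx, not_lt, ← div_eq_inv_mul, le_div_iff₀ hc, one_mul]
    simp [hx]
  · have hzero : exitGauge Ω x z = 0 := indicator_of_notMem hx _
    simp [hzero, hx, hc]

theorem isGauge_exitGauge [MeasurableSpace E] [BorelSpace E] [SecondCountableTopology E]
    (hΩ : IsOpen Ω) : IsGauge Ω (exitGauge Ω) := by
  refine ⟨exitGauge_nonneg Ω, measurable_of_Ici fun c => ?_,
    fun x hx z t _ => mul_exitGauge_lt_one_iff hΩ hx z t⟩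
  rcases le_or_gt c 0 with hc | hc
  · convert! MeasurableSet.univ
    exact eq_univ_of_forall fun q : E × E => hc.trans (exitGauge_nonneg Ω q.1 q.2)
  · have hpre : (fun q : E × E => exitGauge Ω q.1 q.2) ⁻¹' Ici c =
        {q : E × E | q.1 ∈ Ω} ∩ {q : E × E | ∀ s ∈ Icc 0 c⁻¹, q.1 + s • q.2 ∈ Ω}ᶜ :=
      ext fun q => le_exitGauge_iff hΩ hc q.1 q.2
    rw [hpre]
    exact (measurable_fst hΩ.measurableSet).inter
      (isOpen_setOf_forall_add_smul_mem hΩ isCompact_Icc).measurableSet.compl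

end ExitGauge

section BoundedGauge

variable {E : Type*} [NormedAddCommGroup E] [NormedSpace ℝ E] {Ω : Set E}

theorem exists_abs_le_of_add_smul_mem (hb : Bornology.IsBounded Ω) (x : E) {w : E}
    (hw : ‖w‖ = 1) : ∃ C, ∀ t : ℝ, x + t • w ∈ Ω → |t| ≤ C := by
  obtain ⟨C, hC⟩ := hb.exists_norm_le
  refine ⟨C + ‖x‖, fun t ht => ?_⟩
  calc |t| = ‖(x + t • w) - x‖ := by simp [norm_smul, hw]
    _ ≤ ‖x + t • w‖ + ‖x‖ := norm_sub_le _ _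
    _ ≤ C + ‖x‖ := by gcongr; exact hC _ ht

theorem exists_add_smul_notMem (hb : Bornology.IsBounded Ω) (x : E) {w : E} (hw : ‖w‖ = 1) :
    ∃ t : ℝ, 0 < t ∧ x + t • w ∉ Ω := by
  obtain ⟨C, hC⟩ := exists_abs_le_of_add_smul_mem hb x hw
  refine ⟨|C| + 1, by positivity, fun hmem => ?_⟩
  have hle := (le_abs_self _).trans (hC _ hmem)
  linarith [le_abs_self C]

variable [MeasurableSpace E] {σ : E → E → ℝ} {x w : E}

namespace IsGauge

theorem add_smul_mem (h : IsGauge Ω σ) (hx : x ∈ Ω) {t : ℝ} (ht : 0 ≤ t) (hlt : t * σ x w < 1) :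
    x + t • w ∈ Ω := by
  rcases ht.eq_or_lt with rfl | ht
  · simpa using hx
  · exact (h.lt_iff x hx w t ht).1 hlt t ⟨ht.le, le_rfl⟩

theorem add_smul_mem_of_abs_mul_max_lt (h : IsGauge Ω σ) (hx : x ∈ Ω) {t : ℝ}
    (ht : |t| * max (σ x w) (σ x (-w)) < 1) : x + t • w ∈ Ω := by
  rcases le_total 0 t with h0 | h0
  · rw [abs_of_nonneg h0] at ht
    exact h.add_smul_mem hx h0 (lt_of_le_of_lt (by gcongr; exact le_max_left _ _) ht)
  · rw [abs_of_nonpos h0] at ht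
    have hmem := h.add_smul_mem hx (w := -w) (neg_nonneg.2 h0)
      (lt_of_le_of_lt (mul_le_mul_of_nonneg_left (le_max_right _ _) (neg_nonneg.2 h0)) ht)
    rwa [smul_neg, neg_smul, neg_neg] at hmem

theorem exists_abs_eq_add_smul_mem (h : IsGauge Ω σ) (hx : x ∈ Ω) {t : ℝ} (ht : 0 ≤ t)
    (hlt : t * min (σ x w) (σ x (-w)) < 1) : ∃ s : ℝ, t = |s| ∧ x + s • w ∈ Ω := by
  rcases min_choice (σ x w) (σ x (-w)) with hmin | hmin
  · exact ⟨t, (abs_of_nonneg ht).symm, h.add_smul_mem hx ht (hmin ▸ hlt)⟩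
  · have hmem := h.add_smul_mem hx ht (hmin ▸ hlt)
    rw [smul_neg, ← neg_smul] at hmem
    exact ⟨-t, by rw [abs_neg, abs_of_nonneg ht], hmem⟩

theorem pos (h : IsGauge Ω σ) (hb : Bornology.IsBounded Ω) (hx : x ∈ Ω) (hw : ‖w‖ = 1) :
    0 < σ x w := by
  refine (h.nonneg _ _).lt_of_ne fun h0 => ?_
  obtain ⟨t, ht, hmem⟩ := exists_add_smul_notMem hb x hw
  exact hmem (h.add_smul_mem hx ht.le (by rw [← h0]; simp))

theorem inv_add_inv_le_diam (h : IsGauge Ω σ) (hb : Bornology.IsBounded Ω) (hx : x ∈ Ω)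
    (hw : ‖w‖ = 1) : 1 / σ x w + 1 / σ x (-w) ≤ Metric.diam Ω := by
  have hA := h.pos hb hx hw
  have hB := h.pos hb hx (w := -w) (by rwa [norm_neg])
  have hscaled : ∀ θ ∈ Ioo (0 : ℝ) 1, θ * (1 / σ x w + 1 / σ x (-w)) ≤ Metric.diam Ω := by
    intro θ ⟨hθ0, hθ1⟩
    have hfwd := h.add_smul_mem hx (w := w) (t := θ / σ x w) (by positivity)
      (by rwa [div_mul_cancel₀ _ hA.ne'])
    have hbwd := h.add_smul_mem hx (w := -w) (t := θ / σ x (-w)) (by positivity)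
      (by rwa [div_mul_cancel₀ _ hB.ne'])
    have hdist := Metric.dist_le_diam_of_mem hb hfwd hbwd
    have hchord : x + (θ / σ x w) • w - (x + (θ / σ x (-w)) • -w) =
        (θ / σ x w + θ / σ x (-w)) • w := by
      rw [add_smul, smul_neg]; abel
    rw [dist_eq_norm, hchord, norm_smul, hw, mul_one, Real.norm_of_nonneg (by positivity)] at hdist
    rwa [mul_add, mul_one_div, mul_one_div]
  have hlim : Filter.Tendsto (fun θ : ℝ => θ * (1 / σ x w + 1 / σ x (-w))) (nhdsWithin 1 (Iio 1))
      (nhds (1 * (1 / σ x w + 1 / σ x (-w)))) :=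
    (continuous_mul_const _).continuousWithinAt
  rw [one_mul] at hlim
  exact le_of_tendsto hlim (Filter.mem_of_superset (Ioo_mem_nhdsLT one_pos) hscaled)

end IsGauge

end BoundedGauge

noncomputable section DirectionalHardy

variable {n : ℕ}

local notation "𝔼" => EuclideanSpace ℝ (Fin n)
local notation "𝕊" => Metric.sphere (0 : EuclideanSpace ℝ (Fin n)) 1
local notation "dS" => Measure.toSphere (volume : Measure (EuclideanSpace ℝ (Fin n)))

variable {Ω : Set (EuclideanSpace ℝ (Fin n))}
  {σ : EuclideanSpace ℝ (Fin n) → EuclideanSpace ℝ (Fin n) → ℝ} {α : ℝ}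

theorem two_mul_ofReal (a : ℝ) : 2 * ENNReal.ofReal a = ENNReal.ofReal (2 * a) := by
  rw [ENNReal.ofReal_mul two_pos.le, ENNReal.ofReal_ofNat]

theorem le_of_forall_le_add_ofReal_mul {a b c : ℝ≥0∞} (hc : c ≠ ∞)
    (h : ∀ δ : ℝ, 0 < δ → a ≤ b + ENNReal.ofReal δ * c) : a ≤ b := by
  lift c to NNReal using hc
  refine ENNReal.le_of_forall_pos_le_add fun ε hε _ => ?_
  have hδ : 0 < (ε : ℝ) / (c + 1) := by positivity
  refine (h _ hδ).trans (add_le_add_right ?_ b)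
  rw [← ENNReal.ofReal_coe_nnreal, ← ENNReal.ofReal_mul hδ.le, ← ENNReal.ofReal_coe_nnreal]
  refine ENNReal.ofReal_le_ofReal ?_
  rw [div_mul_eq_mul_div, div_le_iff₀ (by positivity)]
  exact mul_le_mul_of_nonneg_left (by linarith) ε.2

namespace IsGauge

theorem exists_dirIntegral_add_le_dirMass [NeZero n] (hα1 : 1 < α) (hα2 : α < 2) {δ : ℝ}
    (hδ : 0 < δ) :
    ∃ V : ℝ, 1 ≤ V ∧ ∀ {Ω : Set 𝔼} {σ : 𝔼 → 𝔼 → ℝ}, IsGauge Ω σ → Bornology.IsBounded Ω →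
      ∀ x ∈ Ω, 2 * (ENNReal.ofReal (truncInt ((α - 1) / 2) V / 2 ^ α) * dirIntegral σ α x) +
        (ENNReal.ofReal (lineKappa α) * dirIntegral σ α x +
          ENNReal.ofReal (lineLambda α * (1 / Metric.diam Ω)) * dirIntegral σ (α - 1) x) ≤
        2 * dirMass σ α V x + ENNReal.ofReal δ * dirIntegral σ α x := by
  obtain ⟨V, hV, hray⟩ := exists_rayGround_add_le_rayMass hα1 hα2 hδ
  refine ⟨V, hV, fun {Ω σ} h hb x hx => ?_⟩
  have hα0 : 0 < α := by linarith
  have hs : ∀ w : 𝕊, 0 ≤ σ x w.1 + σ x (-w.1) := fun w => add_nonneg (h.nonneg _ _) (h.nonneg _ _)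
  have hmeas : ∀ c β : ℝ, Measurable fun w : 𝕊 =>
      ENNReal.ofReal (c * (σ x w.1 + σ x (-w.1)) ^ β) := fun c β =>
    (((h.measurable_add_neg.comp (measurable_prodMk_left.comp
      measurable_subtype_coe)).pow_const β).const_mul c).ennreal_ofReal
  have hk := lineKappa_nonneg hα1.le hα2
  have hl : 0 ≤ lineLambda α * (1 / Metric.diam Ω) :=
    mul_nonneg (lineLambda_nonneg hα1) (one_div_nonneg.2 Metric.diam_nonneg)
  simp only [← h.lintegral_const_mul_add_neg_rpow, h.two_mul_dirMass hα0 hV]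
  rw [← lintegral_add_left (hmeas _ _), ← lintegral_const_mul _ (hmeas _ _),
    ← lintegral_add_left ((hmeas _ _).const_mul 2), ← lintegral_add_right _ (hmeas _ _)]
  refine lintegral_mono fun w => ?_
  have hw : ‖w.1‖ = 1 := norm_eq_of_mem_sphere w
  have hp : ∀ β : ℝ, 0 ≤ (σ x w.1 + σ x (-w.1)) ^ β := fun β => Real.rpow_nonneg (hs w) β
  have hbound := hray (Metric.diam Ω) _ _ (h.pos hb hx hw) (h.pos hb hx (by rwa [norm_neg]))
    (h.inv_add_inv_le_diam hb hx hw)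
  rw [rayGround_eq hα0 hV (h.nonneg _ _) (h.nonneg _ _), Real.div_rpow (hs w) two_pos.le,
    div_mul_eq_mul_div₀, mul_comm _ (truncInt _ _), mul_div_right_comm] at hbound
  have hT : 0 ≤ truncInt ((α - 1) / 2) V / 2 ^ α :=
    div_nonneg (truncInt_nonneg hV) (by positivity)
  rw [two_mul_ofReal, ← ENNReal.ofReal_add (mul_nonneg hk (hp _)) (mul_nonneg hl (hp _)),
    ← ENNReal.ofReal_add (mul_nonneg two_pos.le (mul_nonneg hT (hp _)))
      (add_nonneg (mul_nonneg hk (hp _)) (mul_nonneg hl (hp _))),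
    ← ENNReal.ofReal_add (add_nonneg (rayMass_nonneg hV (h.nonneg _ _) (h.nonneg _ _))
      (rayMass_nonneg hV (h.nonneg _ _) (h.nonneg _ _))) (mul_nonneg hδ.le (hp _))]
  exact ENNReal.ofReal_le_ofReal hbound

theorem exists_lintegral_dirIntegral_add_le [NeZero n] (h : IsGauge Ω σ) (hα1 : 1 < α)
    (hα2 : α < 2) (hΩ : MeasurableSet Ω) (hb : Bornology.IsBounded Ω) {u : 𝔼 → ℝ}
    (hu : Measurable u) {δ : ℝ} (hδ : 0 < δ) :
    ∃ V : ℝ, 1 ≤ V ∧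
      2 * (ENNReal.ofReal (truncInt ((α - 1) / 2) V / 2 ^ α) *
          ∫⁻ x in Ω, ENNReal.ofReal (u x ^ 2) * dirIntegral σ α x) +
        (ENNReal.ofReal (lineKappa α) *
            (∫⁻ x in Ω, ENNReal.ofReal (u x ^ 2) * dirIntegral σ α x) +
          ENNReal.ofReal (lineLambda α * (1 / Metric.diam Ω)) *
            ∫⁻ x in Ω, ENNReal.ofReal (u x ^ 2) * dirIntegral σ (α - 1) x) ≤
        2 * (∫⁻ x in Ω, ENNReal.ofReal (u x ^ 2) * dirMass σ α V x) +
          ENNReal.ofReal δ * ∫⁻ x in Ω, ENNReal.ofReal (u x ^ 2) * dirIntegral σ α x := by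
  obtain ⟨V, hV, hpoint⟩ := exists_dirIntegral_add_le_dirMass (n := n) hα1 hα2 hδ
  refine ⟨V, hV, ?_⟩
  have hI := h.measurable_dirIntegral α
  have hI1 := h.measurable_dirIntegral (α - 1)
  have hM := h.measurable_dirMass (by linarith : 0 < α) V
  set c := ENNReal.ofReal (truncInt ((α - 1) / 2) V / 2 ^ α)
  iterate 6 rw [← lintegral_const_mul _ (by fun_prop)]
  iterate 3 rw [← lintegral_add_left (by fun_prop)]
  refine setLIntegral_mono' hΩ fun x hx => ?_
  calc _ = ENNReal.ofReal (u x ^ 2) * (2 * (c * dirIntegral σ α x) +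
      (ENNReal.ofReal (lineKappa α) * dirIntegral σ α x +
        ENNReal.ofReal (lineLambda α * (1 / Metric.diam Ω)) * dirIntegral σ (α - 1) x)) := by ring
    _ ≤ _ := mul_le_mul_right (hpoint h hb x hx) _
    _ = _ := by ring

theorem lintegral_dirMass_le [NeZero n] (h : IsGauge Ω σ) (hα : 1 ≤ α) {V : ℝ} (hV : 1 ≤ V)
    (hΩ : MeasurableSet Ω) {u : 𝔼 → ℝ} (hu : Measurable u) :
    ∫⁻ x in Ω, ENNReal.ofReal (u x ^ 2) * dirMass σ α V x ≤
      regionalForm Ω α u + ENNReal.ofReal (truncInt ((α - 1) / 2) V / 2 ^ α) *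
        ∫⁻ x in Ω, ENNReal.ofReal (u x ^ 2) * dirIntegral σ α x :=
  (le_self_add.trans_eq (h.truncEnergy_identity hα hV hΩ hu).symm).trans
    (add_le_add_left (h.truncEnergy_le_regionalForm hΩ hu) _)

theorem hardy_dirIntegral [NeZero n] (h : IsGauge Ω σ) (hα1 : 1 < α) (hα2 : α < 2)
    (hΩ : IsOpen Ω) (hb : Bornology.IsBounded Ω) {u : 𝔼 → ℝ} (hu : Measurable u)
    (hL2 : MemLp u 2) (hc : HasCompactSupport u) (hs : tsupport u ⊆ Ω) :
    ENNReal.ofReal (lineKappa α) * (∫⁻ x in Ω, ENNReal.ofReal (u x ^ 2) * dirIntegral σ α x) +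
        ENNReal.ofReal (lineLambda α * (1 / Metric.diam Ω)) *
          (∫⁻ x in Ω, ENNReal.ofReal (u x ^ 2) * dirIntegral σ (α - 1) x) ≤
      2 * regionalForm Ω α u := by
  have hfin := h.lintegral_sq_mul_dirIntegral_ne_top hΩ hu hL2 hc hs (by linarith : 0 ≤ α)
  refine le_of_forall_le_add_ofReal_mul hfin fun δ hδ => ?_
  obtain ⟨V, hV, hlow⟩ :=
    h.exists_lintegral_dirIntegral_add_le hα1 hα2 hΩ.measurableSet hb hu hδ
  have hup := h.lintegral_dirMass_le hα1.le hV hΩ.measurableSet hu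
  set P := ∫⁻ x in Ω, ENNReal.ofReal (u x ^ 2) * dirIntegral σ α x
  set c := ENNReal.ofReal (truncInt ((α - 1) / 2) V / 2 ^ α)
  refine (ENNReal.add_le_add_iff_left (ENNReal.mul_ne_top ENNReal.ofNat_ne_top
    (ENNReal.mul_ne_top ENNReal.ofReal_ne_top hfin) : 2 * (c * P) ≠ ∞)).1 (hlow.trans ?_)
  calc _ ≤ 2 * (regionalForm Ω α u + c * P) + ENNReal.ofReal δ * P := by gcongr
    _ = _ := by ring

end IsGauge

end DirectionalHardy

section LossSloane

variable {n : ℕ}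

local notation "𝔼" => EuclideanSpace ℝ (Fin n)
local notation "𝕊" => Metric.sphere (0 : EuclideanSpace ℝ (Fin n)) 1
local notation "dS" => Measure.toSphere (volume : Measure (EuclideanSpace ℝ (Fin n)))

variable {Ω : Set (EuclideanSpace ℝ (Fin n))}
  {σ : EuclideanSpace ℝ (Fin n) → EuclideanSpace ℝ (Fin n) → ℝ} {α : ℝ}

theorem dirDist_nonneg (Ω : Set 𝔼) (w x : 𝔼) : 0 ≤ dirDist Ω w x :=
  Real.sInf_nonneg fun _ ⟨_, hr, _⟩ => hr ▸ abs_nonneg _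

theorem dirReach_nonneg (Ω : Set 𝔼) (w x : 𝔼) : 0 ≤ dirReach Ω w x :=
  Real.sSup_nonneg fun _ ⟨_, hr, _⟩ => hr ▸ abs_nonneg _

namespace IsGauge

theorem one_div_dirDist_le_max (h : IsGauge Ω σ) (hb : Bornology.IsBounded Ω) {x w : 𝔼}
    (hx : x ∈ Ω) (hw : ‖w‖ = 1) : 1 / dirDist Ω w x ≤ max (σ x w) (σ x (-w)) := by
  have hM : 0 < max (σ x w) (σ x (-w)) := lt_max_of_lt_left (h.pos hb hx hw)
  rw [one_div]
  refine inv_le_of_inv_le₀ hM (le_csInf ?_ ?_)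
  · obtain ⟨t, _, ht⟩ := exists_add_smul_notMem hb x hw
    exact ⟨|t|, t, rfl, ht⟩
  · rintro _ ⟨t, rfl, ht⟩
    by_contra! hlt
    exact ht (h.add_smul_mem_of_abs_mul_max_lt hx ((lt_inv_mul_iff₀' hM).1 (by simpa using hlt)))

theorem one_div_dirReach_le_min (h : IsGauge Ω σ) (hb : Bornology.IsBounded Ω) {x w : 𝔼}
    (hx : x ∈ Ω) (hw : ‖w‖ = 1) : 1 / dirReach Ω w x ≤ min (σ x w) (σ x (-w)) := by
  have hm : 0 < min (σ x w) (σ x (-w)) :=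
    lt_min (h.pos hb hx hw) (h.pos hb hx (by rwa [norm_neg]))
  obtain ⟨C, hC⟩ := exists_abs_le_of_add_smul_mem hb x hw
  have hbdd : BddAbove {r : ℝ | ∃ t : ℝ, r = |t| ∧ x + t • w ∈ Ω} :=
    ⟨C, by rintro _ ⟨t, rfl, ht⟩; exact hC t ht⟩
  rw [one_div]
  refine inv_le_of_inv_le₀ hm (le_of_forall_lt fun c hc => ?_)
  obtain ⟨t, hct, ht⟩ := exists_between (max_lt hc (inv_pos.2 hm))
  obtain ⟨hct, ht0⟩ := max_lt_iff.1 hct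
  exact hct.trans_le (le_csSup hbdd
    (h.exists_abs_eq_add_smul_mem hx ht0.le ((lt_inv_mul_iff₀' hm).1 (by simpa using ht))))

theorem one_div_dirDist_add_le (h : IsGauge Ω σ) (hb : Bornology.IsBounded Ω) {x w : 𝔼}
    (hx : x ∈ Ω) (hw : ‖w‖ = 1) :
    1 / dirDist Ω w x + 1 / dirReach Ω w x ≤ σ x w + σ x (-w) :=
  (add_le_add (h.one_div_dirDist_le_max hb hx hw) (h.one_div_dirReach_le_min hb hx hw)).trans_eq
    (max_add_min _ _)

end IsGauge

theorem lossSloaneM_rpow [NeZero n] {β : ℝ} (hβ : 0 < β) (x : 𝔼) :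
    lossSloaneM Ω β x ^ β = ENNReal.ofReal (sphereMoment n β) /
      ∫⁻ w : 𝕊, ENNReal.ofReal ((1 / dirDist Ω w.1 x + 1 / dirReach Ω w.1 x) ^ β) ∂dS := by
  rw [lossSloaneM, ← ENNReal.rpow_mul, one_div_mul_cancel hβ.ne', ENNReal.rpow_one,
    lintegral_sphere_abs_rpow hβ]

theorem IsGauge.weightedInt_lossSloaneM_le [NeZero n] (h : IsGauge Ω σ) {β : ℝ} (hβ : 0 < β)
    (hΩ : MeasurableSet Ω) (hb : Bornology.IsBounded Ω) (u : 𝔼 → ℝ) :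
    ENNReal.ofReal (sphereMoment n β) * weightedInt Ω (lossSloaneM Ω β) β u ≤
      ∫⁻ x in Ω, ENNReal.ofReal (u x ^ 2) * dirIntegral σ β x := by
  have hN0 : ENNReal.ofReal (sphereMoment n β) ≠ 0 := by simpa using sphereMoment_pos n hβ
  rw [weightedInt, ← lintegral_const_mul' _ _ ENNReal.ofReal_ne_top]
  refine setLIntegral_mono' hΩ fun x hx => ?_
  rw [lossSloaneM_rpow hβ, div_eq_mul_inv, ENNReal.inv_div (Or.inr ENNReal.ofReal_ne_top)
    (Or.inr hN0), mul_left_comm, ENNReal.mul_div_cancel hN0 ENNReal.ofReal_ne_top]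
  gcongr
  refine lintegral_mono fun w => ENNReal.ofReal_le_ofReal ?_
  exact Real.rpow_le_rpow (add_nonneg (one_div_nonneg.2 (dirDist_nonneg _ _ _))
    (one_div_nonneg.2 (dirReach_nonneg _ _ _)))
    (h.one_div_dirDist_add_le hb hx (norm_eq_of_mem_sphere w)) hβ.le

theorem two_mul_hardyKappa (n : ℕ) (α : ℝ) :
    2 * hardyKappa n α = lineKappa α * sphereMoment n α := by
  unfold hardyKappa lineKappa sphereMoment
  ring

theorem two_mul_hardyLambda (n : ℕ) (α : ℝ) :
    2 * hardyLambda n α = lineLambda α * sphereMoment n (α - 1) := by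
  unfold hardyLambda lineLambda sphereMoment
  rw [add_sub_cancel, add_sub_assoc]
  field_simp

theorem hardy_lossSloane [NeZero n] (hα1 : 1 < α) (hα2 : α < 2) (hΩ : IsOpen Ω)
    (hb : Bornology.IsBounded Ω) {u : 𝔼 → ℝ} (hu : Measurable u) (hL2 : MemLp u 2)
    (hc : HasCompactSupport u) (hs : tsupport u ⊆ Ω) :
    ENNReal.ofReal (hardyKappa n α) * weightedInt Ω (lossSloaneM Ω α) α u +
      ENNReal.ofReal (hardyLambda n α * (1 / Metric.diam Ω)) *
        weightedInt Ω (lossSloaneM Ω (α - 1)) (α - 1) u ≤ regionalForm Ω α u := by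
  have h : IsGauge Ω (exitGauge Ω) := isGauge_exitGauge hΩ
  have hmain := h.weightedInt_lossSloaneM_le (by linarith : 0 < α) hΩ.measurableSet hb u
  have hlower := h.weightedInt_lossSloaneM_le (by linarith : 0 < α - 1) hΩ.measurableSet hb u
  rw [← ENNReal.mul_le_mul_iff_right two_ne_zero ENNReal.ofNat_ne_top, mul_add, ← mul_assoc,
    ← mul_assoc, two_mul_ofReal, two_mul_ofReal, ← mul_assoc, two_mul_hardyKappa,
    two_mul_hardyLambda, mul_right_comm,
    ENNReal.ofReal_mul (lineKappa_nonneg hα1.le hα2), ENNReal.ofReal_mul (mul_nonneg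
      (lineLambda_nonneg hα1) (one_div_nonneg.2 Metric.diam_nonneg)), mul_assoc, mul_assoc]
  exact le_trans (by gcongr) (h.hardy_dirIntegral hα1 hα2 hΩ hb hu hL2 hc hs)

end LossSloane

section ConvexGeometry

variable {F : Type*} [NormedAddCommGroup F] [InnerProductSpace ℝ F] [CompleteSpace F]

theorem exists_norm_eq_one_inner_pos_of_notMem {Ω : Set F} (hΩ : IsOpen Ω) (hne : Ω.Nonempty)
    (hc : Convex ℝ Ω) {y : F} (hy : y ∉ Ω) :
    ∃ e : F, ‖e‖ = 1 ∧ ∀ a ∈ Ω, 0 < inner ℝ e (a - y) := by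
  obtain ⟨f, hf⟩ := geometric_hahn_banach_open_point hc hΩ hy
  set g := (InnerProductSpace.toDual ℝ F).symm f
  have hg : ∀ a ∈ Ω, 0 < inner ℝ g (y - a) := fun a ha => by
    rw [InnerProductSpace.toDual_symm_apply, map_sub]
    exact sub_pos.2 (hf a ha)
  have hg0 : 0 < ‖g‖ := by
    obtain ⟨a, ha⟩ := hne
    exact norm_pos_iff.2 fun h0 => by simpa [h0] using hg a ha
  refine ⟨-(‖g‖⁻¹ • g), by rw [norm_neg, norm_smul, norm_inv, norm_norm,
    inv_mul_cancel₀ hg0.ne'], fun a ha => ?_⟩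
  rw [inner_neg_left, ← inner_neg_right, neg_sub, real_inner_smul_left]
  exact mul_pos (inv_pos.2 hg0) (hg a ha)

end ConvexGeometry

section ConvexHardy

variable {n : ℕ}

local notation "𝔼" => EuclideanSpace ℝ (Fin n)

variable {Ω : Set (EuclideanSpace ℝ (Fin n))} {α : ℝ}

theorem compl_nonempty_of_isBounded [NeZero n] (hb : Bornology.IsBounded Ω) : Ωᶜ.Nonempty := by
  rw [nonempty_compl]
  rintro rfl
  exact NormedSpace.unbounded_univ ℝ 𝔼 hb

theorem exists_distCompl_eq_dist [NeZero n] (hΩ : IsOpen Ω) (hb : Bornology.IsBounded Ω) {x : 𝔼}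
    (hx : x ∈ Ω) : ∃ y ∉ Ω, 0 < dist x y ∧ distCompl Ω x = ENNReal.ofReal (dist x y) ∧
      Metric.ball x (dist x y) ⊆ Ω := by
  have hne := compl_nonempty_of_isBounded hb
  obtain ⟨y, hy, he⟩ := hΩ.isClosed_compl.exists_infDist_eq_dist hne x
  refine ⟨y, hy, dist_pos.2 fun h => hy (h ▸ hx), ?_, ?_⟩
  · rw [← he, Metric.infDist, ENNReal.ofReal_toReal (Metric.infEDist_ne_top hne), distCompl]
  · rw [← he]
    exact Metric.ball_infDist_subset_compl.trans_eq (compl_compl Ω)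

/-- If `Ω` lies in the half-space `⟪e, · - y⟫ > 0`, then the line through `x` in the direction `w`
leaves `Ω` no later than it crosses the bounding hyperplane. -/
theorem inner_div_le_one_div_dirDist {x y e w : 𝔼} (he : ‖e‖ = 1) (hw : ‖w‖ = 1)
    (hpos : ∀ a ∈ Ω, 0 < inner ℝ e (a - y)) (hr : 0 < dist x y)
    (hball : Metric.ball x (dist x y) ⊆ Ω) :
    |inner ℝ e w| / dist x y ≤ 1 / dirDist Ω w x := by
  rcases eq_or_ne (inner ℝ e w) 0 with h0 | h0
  · rw [h0, abs_zero, zero_div]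
    exact one_div_nonneg.2 (dirDist_nonneg _ _ _)
  set t := inner ℝ e (y - x) / inner ℝ e w with ht
  have hmem : x + t • w ∉ Ω := fun hm => by
    have hinner := hpos _ hm
    rw [show x + t • w - y = t • w - (y - x) by abel, inner_sub_right, real_inner_smul_right, ht,
      div_mul_cancel₀ _ h0, sub_self] at hinner
    exact lt_irrefl _ hinner
  have hle : dirDist Ω w x ≤ |t| := csInf_le ⟨0, fun _ ⟨_, hs, _⟩ => hs ▸ abs_nonneg _⟩
    ⟨t, rfl, hmem⟩
  have hge : dist x y ≤ dirDist Ω w x := by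
    refine le_csInf ⟨|t|, t, rfl, hmem⟩ ?_
    rintro _ ⟨s, rfl, hs⟩
    by_contra! hlt
    refine hs (hball ?_)
    rwa [Metric.mem_ball, dist_self_add_left, norm_smul, hw, mul_one, Real.norm_eq_abs]
  have htr : |t| * |inner ℝ e w| ≤ dist x y := by
    rw [← abs_mul, ht, div_mul_cancel₀ _ h0, dist_comm, dist_eq_norm]
    simpa [he] using abs_real_inner_le_norm e (y - x)
  rw [div_le_div_iff₀ hr (hr.trans_le hge), one_mul, mul_comm]
  exact (mul_le_mul_of_nonneg_right hle (abs_nonneg _)).trans htr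

theorem lossSloaneM_rpow_le_distCompl_rpow [NeZero n] {β : ℝ} (hβ : 0 < β) (hΩ : IsOpen Ω)
    (hc : Convex ℝ Ω) (hb : Bornology.IsBounded Ω) {x : 𝔼} (hx : x ∈ Ω) :
    lossSloaneM Ω β x ^ β ≤ distCompl Ω x ^ β := by
  obtain ⟨y, hy, hr, hd, hball⟩ := exists_distCompl_eq_dist hΩ hb hx
  obtain ⟨e, he, hpos⟩ := exists_norm_eq_one_inner_pos_of_notMem hΩ ⟨x, hx⟩ hc hy
  rw [lossSloaneM_rpow hβ, hd, ENNReal.ofReal_rpow_of_pos hr,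
    ← lintegral_sphere_abs_rpow hβ (0 : Fin n), ← lintegral_sphere_inner he]
  refine ENNReal.div_le_of_le_mul' ?_
  rw [← lintegral_mul_const' _ _ ENNReal.ofReal_ne_top]
  refine lintegral_mono fun w => ?_
  have hinner := inner_div_le_one_div_dirDist he (norm_eq_of_mem_sphere w) hpos hr hball
  have hreach := one_div_nonneg.2 (dirReach_nonneg Ω w.1 x)
  have hdist := one_div_nonneg.2 (dirDist_nonneg Ω w.1 x)
  rw [← ENNReal.ofReal_mul (by positivity), ← Real.mul_rpow (by positivity) dist_nonneg]
  refine ENNReal.ofReal_le_ofReal (Real.rpow_le_rpow (abs_nonneg _) ?_ hβ.le)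
  rw [div_le_iff₀ hr] at hinner
  exact hinner.trans (mul_le_mul_of_nonneg_right (by linarith) dist_nonneg)

theorem weightedInt_distCompl_le_lossSloaneM [NeZero n] {β : ℝ} (hβ : 0 < β) (hΩ : IsOpen Ω)
    (hc : Convex ℝ Ω) (hb : Bornology.IsBounded Ω) (u : 𝔼 → ℝ) :
    weightedInt Ω (distCompl Ω) β u ≤ weightedInt Ω (lossSloaneM Ω β) β u :=
  setLIntegral_mono' hΩ.measurableSet fun _ hx =>
    ENNReal.div_le_div_left (lossSloaneM_rpow_le_distCompl_rpow hβ hΩ hc hb hx) _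

theorem hardy_distCompl [NeZero n] (hα1 : 1 < α) (hα2 : α < 2) (hΩ : IsOpen Ω)
    (hc : Convex ℝ Ω) (hb : Bornology.IsBounded Ω) {u : 𝔼 → ℝ} (hu : Measurable u)
    (hL2 : MemLp u 2) (hcs : HasCompactSupport u) (hs : tsupport u ⊆ Ω) :
    ENNReal.ofReal (hardyKappa n α) * weightedInt Ω (distCompl Ω) α u +
      ENNReal.ofReal (hardyLambda n α * (1 / Metric.diam Ω)) *
        weightedInt Ω (distCompl Ω) (α - 1) u ≤ regionalForm Ω α u := by
  have hmain := weightedInt_distCompl_le_lossSloaneM (by linarith : 0 < α) hΩ hc hb u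
  have hlower := weightedInt_distCompl_le_lossSloaneM (by linarith : 0 < α - 1) hΩ hc hb u
  refine le_trans ?_ (hardy_lossSloane hα1 hα2 hΩ hb hu hL2 hcs hs)
  gcongr

end ConvexHardy

section OneSidedGauge

open Filter

variable {n : ℕ} {Ω : Set (EuclideanSpace ℝ (Fin n))}
  {σ : EuclideanSpace ℝ (Fin n) → EuclideanSpace ℝ (Fin n) → ℝ} {α : ℝ}

local notation "𝔼" => EuclideanSpace ℝ (Fin n)

namespace IsGauge

theorem eventually_dirMass_le [NeZero n] (h : IsGauge Ω σ) (hα1 : 1 ≤ α) (hα2 : α < 2)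
    (hσ : ∀ x z, σ x z = 0 ∨ σ x (-z) = 0) {δ : ℝ} (hδ : 0 < δ) :
    ∀ᶠ V : ℝ in atTop, ∀ x, dirMass σ α V x ≤
      ENNReal.ofReal (truncInt ((α - 1) / 2) V / 2 ^ α + (lineKappa α / 2 + δ)) *
        dirIntegral σ α x := by
  filter_upwards [eventually_ge_atTop 1,
    eventually_rayMass_le_rayGround_add hα1 hα2 (mul_pos two_pos hδ)] with V hV hray x
  have hα0 : 0 < α := by linarith
  rw [← ENNReal.mul_le_mul_iff_right two_ne_zero ENNReal.ofNat_ne_top,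
    h.two_mul_dirMass hα0 hV, ← mul_assoc, two_mul_ofReal, ← h.lintegral_const_mul_add_neg_rpow]
  refine lintegral_mono fun w => ENNReal.ofReal_le_ofReal ?_
  set A := σ x w.1
  set B := σ x (-w.1)
  have hA : 0 ≤ A := h.nonneg _ _
  have hB : 0 ≤ B := h.nonneg _ _
  calc rayMass α V A B + rayMass α V B A
      = rayMass α V (A + B) 0 + rayMass α V 0 (A + B) := by
        rcases hσ x w.1 with h0 | h0
        · rw [show A = 0 from h0, zero_add, add_comm]
        · rw [show B = 0 from h0, add_zero]
    _ ≤ 2 * rayGround α V (A + B) 0 + (lineKappa α + 2 * δ) * (A + B) ^ α :=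
        hray _ (add_nonneg hA hB)
    _ = _ := by
        rw [rayGround_eq hα0 hV (add_nonneg hA hB) le_rfl, add_zero,
          Real.div_rpow (add_nonneg hA hB) two_pos.le]
        ring

theorem eventually_truncEnergy_le [NeZero n] (h : IsGauge Ω σ) (hα1 : 1 ≤ α) (hα2 : α < 2)
    (hΩ : MeasurableSet Ω) (hσ : ∀ x z, σ x z = 0 ∨ σ x (-z) = 0) {u : 𝔼 → ℝ} (hu : Measurable u)
    (hfin : ∫⁻ x in Ω, ENNReal.ofReal (u x ^ 2) * dirIntegral σ α x ≠ ∞) {δ : ℝ} (hδ : 0 < δ) :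
    ∀ᶠ V : ℝ in atTop, truncEnergy Ω σ α V u ≤ ENNReal.ofReal (lineKappa α / 2 + δ) *
      (∫⁻ x in Ω, ENNReal.ofReal (u x ^ 2) * dirIntegral σ α x) + remainderEnergy Ω σ α V u := by
  filter_upwards [eventually_ge_atTop 1, h.eventually_dirMass_le hα1 hα2 hσ hδ] with V hV hmass
  have hT : 0 ≤ truncInt ((α - 1) / 2) V / 2 ^ α :=
    div_nonneg (truncInt_nonneg hV) (by positivity)
  have hκ : 0 ≤ lineKappa α / 2 + δ := by
    linarith [lineKappa_nonneg hα1 hα2]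
  have hd := h.measurable_dirIntegral α
  have hint : ∫⁻ x in Ω, ENNReal.ofReal (u x ^ 2) * dirMass σ α V x ≤
      ENNReal.ofReal (truncInt ((α - 1) / 2) V / 2 ^ α + (lineKappa α / 2 + δ)) *
        ∫⁻ x in Ω, ENNReal.ofReal (u x ^ 2) * dirIntegral σ α x := by
    rw [← lintegral_const_mul _ (by fun_prop)]
    refine lintegral_mono fun x => ?_
    rw [mul_left_comm]
    gcongr
    exact hmass x
  rw [ENNReal.ofReal_add hT hκ, add_mul] at hint
  refine (ENNReal.add_le_add_iff_right (ENNReal.mul_ne_top ENNReal.ofReal_ne_top hfin)).1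
    ((h.truncEnergy_identity hα1 hV hΩ hu).le.trans
      ((add_le_add_left hint _).trans (le_of_eq ?_)))
  ring

theorem eventually_mem_truncRegion (h : IsGauge Ω σ) (hconv : Convex ℝ Ω) {x y : 𝔼} (hx : x ∈ Ω)
    (hy : y ∈ Ω) (hpos : 0 < σ x (y - x) + σ x (x - y)) :
    ∀ᶠ V : ℝ in atTop, (x, y) ∈ truncRegion Ω σ V := by
  have hlt : σ x (y - x) < 1 := by
    rw [← one_mul (σ x (y - x)), h.lt_iff x hx _ 1 one_pos]
    exact fun s hs => hconv.add_smul_sub_mem hx hy hs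
  filter_upwards [eventually_ge_atTop ((2 + σ x (x - y) - σ x (y - x)) /
    (σ x (y - x) + σ x (x - y)))] with V hV
  exact ⟨hx, hlt, (div_le_iff₀ hpos).1 hV⟩

theorem lintegral_le_liminf_lintegral_truncKernel (h : IsGauge Ω σ) (hΩ : MeasurableSet Ω)
    (hconv : Convex ℝ Ω) {x : 𝔼} (hx : x ∈ Ω) (hpos : ∀ᵐ y, 0 < σ x (y - x) + σ x (x - y))
    {g : 𝔼 → ℝ≥0∞} (hg : Measurable g) :
    ∫⁻ y in Ω, g y * ENNReal.ofReal (‖x - y‖ ^ (-((n : ℝ) + α))) ≤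
      liminf (fun V => ∫⁻ y, g y * truncKernel Ω σ α V (x, y)) atTop := by
  have hK := fun V => (h.measurable_truncKernel hΩ α V).comp (measurable_prodMk_left (x := x))
  refine le_trans ?_ (lintegral_liminf_le fun V => hg.mul (hK V))
  rw [← lintegral_indicator hΩ]
  refine lintegral_mono_ae ?_
  filter_upwards [hpos] with y hy
  refine indicator_apply_le' (fun hyΩ => le_liminf_of_le (by isBoundedDefault) ?_) fun _ => zero_le
  filter_upwards [h.eventually_mem_truncRegion hconv hx hyΩ hy] with V hq
  simp only [truncKernel]
  rw [indicator_of_mem hq]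

theorem regionalForm_le_of_eventually_truncEnergy_le (h : IsGauge Ω σ) (hΩ : MeasurableSet Ω)
    (hconv : Convex ℝ Ω) (hpos : ∀ x ∈ Ω, ∀ᵐ y, 0 < σ x (y - x) + σ x (x - y)) {u : 𝔼 → ℝ}
    (hu : Measurable u) {C : ℝ≥0∞} (hC : ∀ᶠ V : ℝ in atTop, truncEnergy Ω σ α V u ≤ C) :
    regionalForm Ω α u ≤ C := by
  set G : ℝ → 𝔼 × 𝔼 → ℝ≥0∞ := fun V q =>
    ENNReal.ofReal ((u q.1 - u q.2) ^ 2) * truncKernel Ω σ α V q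
  have hG : ∀ V, Measurable (G V) := fun V => by
    have := h.measurable_truncKernel hΩ α V
    fun_prop
  have hliminf : ∫⁻ x in Ω, ∫⁻ y in Ω, ENNReal.ofReal ((u x - u y) ^ 2) *
      ENNReal.ofReal (‖x - y‖ ^ (-((n : ℝ) + α))) ≤ liminf (fun V => ∫⁻ q, G V q) atTop := by
    simp only [Measure.volume_eq_prod, lintegral_prod _ (hG _).aemeasurable]
    refine (setLIntegral_mono' hΩ fun x hx => h.lintegral_le_liminf_lintegral_truncKernel hΩ hconv
      hx (hpos x hx) (by fun_prop)).trans ((setLIntegral_le_lintegral _ _).trans ?_)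
    exact lintegral_liminf_le fun V => (hG V).lintegral_prod_right'
  have hbound : ∀ᶠ V in atTop, ∫⁻ q, G V q ≤ 2 * C := hC.mono fun V hV =>
    calc ∫⁻ q, G V q = 2 * truncEnergy Ω σ α V u := by
          rw [truncEnergy, ← mul_assoc, one_div, ENNReal.mul_inv_cancel (by simp) (by simp),
            one_mul]
      _ ≤ 2 * C := by gcongr
  calc regionalForm Ω α u ≤ (1 / 2) * liminf (fun V => ∫⁻ q, G V q) atTop := by
        rw [regionalForm_eq]
        gcongr
    _ ≤ (1 / 2) * (2 * C) := by
        gcongr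
        exact liminf_le_of_frequently_le' hbound.frequently
    _ = C := by rw [← mul_assoc, one_div, ENNReal.inv_mul_cancel (by simp) (by simp), one_mul]

end IsGauge

end OneSidedGauge

noncomputable section HalfSpace

variable {F : Type*} [NormedAddCommGroup F] [InnerProductSpace ℝ F]

/-- The open half-space with inner normal `e` and with `p` on its boundary. -/
def halfSpace (e p : F) : Set F := {x | 0 < inner ℝ e (x - p)}

/-- The reciprocal exit time from `halfSpace e p`. -/
def halfGauge (e p x z : F) : ℝ := max 0 (-inner ℝ e z / inner ℝ e (x - p))

variable {e p x : F} {α : ℝ}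

theorem isOpen_halfSpace (e p : F) : IsOpen (halfSpace e p) :=
  isOpen_lt continuous_const (by fun_prop)

theorem convex_halfSpace (e p : F) : Convex ℝ (halfSpace e p) := by
  have hset : halfSpace e p = {x | inner ℝ e p < inner ℝ e x} := by
    ext x
    rw [halfSpace, mem_ofPred_eq, mem_ofPred_eq, inner_sub_right, sub_pos]
  rw [hset]
  exact convex_halfSpace_gt (innerSL ℝ e).isLinear _

theorem add_smul_mem_halfSpace_iff {z : F} {s : ℝ} :
    x + s • z ∈ halfSpace e p ↔ 0 < inner ℝ e (x - p) + s * inner ℝ e z := by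
  rw [halfSpace, mem_ofPred_eq, add_sub_right_comm, inner_add_right, real_inner_smul_right]

theorem isGauge_halfGauge [MeasurableSpace F] [BorelSpace F] [SecondCountableTopology F]
    (e p : F) : IsGauge (halfSpace e p) (halfGauge e p) where
  nonneg _ _ := le_max_left _ _
  measurable := by
    unfold halfGauge
    fun_prop
  lt_iff x hx z t ht := by
    simp only [add_smul_mem_halfSpace_iff]
    rw [halfGauge, mul_max_of_nonneg _ _ ht.le, mul_zero, mul_div_assoc', max_lt_iff,
      div_lt_one hx]
    refine ⟨fun hlt s hs => ?_, fun hseg => ⟨one_pos, ?_⟩⟩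
    · rcases le_total 0 (inner ℝ e z) with hz | hz
      · exact add_pos_of_pos_of_nonneg hx (mul_nonneg hs.1 hz)
      · linarith [mul_le_mul_of_nonpos_right hs.2 hz]
    · linarith [hseg t ⟨ht.le, le_rfl⟩]

theorem halfGauge_neg (e p x z : F) :
    halfGauge e p x (-z) = max 0 (inner ℝ e z / inner ℝ e (x - p)) := by
  rw [halfGauge, inner_neg_right, neg_neg]

theorem halfGauge_eq_zero_or (e p x z : F) :
    halfGauge e p x z = 0 ∨ halfGauge e p x (-z) = 0 := by
  rw [halfGauge_neg, halfGauge, neg_div, max_eq_left_iff, max_eq_left_iff, neg_nonpos]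
  exact le_total _ _

theorem halfGauge_add_neg (hx : x ∈ halfSpace e p) (z : F) :
    halfGauge e p x z + halfGauge e p x (-z) = |inner ℝ e z| / inner ℝ e (x - p) := by
  rw [halfGauge_neg, halfGauge, neg_div, max_comm, max_comm 0, ← posPart_def, ← posPart_def,
    posPart_neg, add_comm, posPart_add_negPart, abs_div,
    abs_of_pos (show 0 < inner ℝ e (x - p) from hx)]

theorem groundRatio_halfGauge (hx : x ∈ halfSpace e p) (y : F) :
    groundRatio (halfGauge e p) α (x, y) =
      (inner ℝ e (y - p) / inner ℝ e (x - p)) ^ ((α - 1) / 2) := by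
  have hx' : 0 < inner ℝ e (x - p) := hx
  have hy : inner ℝ e (y - p) = inner ℝ e (x - p) + inner ℝ e (y - x) := by
    rw [← inner_add_right, add_comm, sub_add_sub_cancel]
  have hyx : inner ℝ e (y - p) / inner ℝ e (x - p) =
      1 + inner ℝ e (y - x) / inner ℝ e (x - p) := by
    rw [hy, add_div, div_self hx'.ne']
  simp only [groundRatio]
  rw [← neg_sub y x, halfGauge_neg, halfGauge, neg_div, hyx]
  rcases le_total 0 (inner ℝ e (y - x) / inner ℝ e (x - p)) with h0 | h0
  · rw [max_eq_left (neg_nonpos.2 h0), max_eq_right h0, sub_zero, one_mul]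
  · rw [max_eq_right (neg_nonneg.2 h0), max_eq_left h0, add_zero, mul_one, sub_neg_eq_add]

theorem groundRemainder_halfGauge {y : F} (hx : x ∈ halfSpace e p) (hy : y ∈ halfSpace e p)
    {u f : F → ℝ} (huf : ∀ x ∈ halfSpace e p, u x = inner ℝ e (x - p) ^ ((α - 1) / 2) * f x) :
    groundRemainder (groundRatio (halfGauge e p) α) u (x, y) =
      ENNReal.ofReal ((inner ℝ e (x - p) * inner ℝ e (y - p)) ^ ((α - 1) / 2) *
        (f x - f y) ^ 2) := by
  have hx' : 0 < inner ℝ e (x - p) := hx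
  have hy' : 0 < inner ℝ e (y - p) := hy
  have : 0 < inner ℝ e (x - p) ^ ((α - 1) / 2) := Real.rpow_pos_of_pos hx' _
  have : 0 < inner ℝ e (y - p) ^ ((α - 1) / 2) := Real.rpow_pos_of_pos hy' _
  rw [groundRemainder, groundRatio_halfGauge hx, huf x hx, huf y hy,
    Real.div_rpow hy'.le hx'.le, Real.mul_rpow hx'.le hy'.le]
  congr 1
  field_simp

theorem ae_inner_sub_ne_zero [MeasurableSpace F] [BorelSpace F] [FiniteDimensional ℝ F]
    (μ : Measure F) [μ.IsAddHaarMeasure] (he : e ≠ 0) (x : F) :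
    ∀ᵐ y ∂μ, inner ℝ e (y - x) ≠ 0 := by
  have hker : (innerSL ℝ e).ker ≠ ⊤ := fun htop => he <| by
    have hmem : e ∈ (innerSL ℝ e).ker := htop ▸ Submodule.mem_top
    simpa using hmem
  have hnull := Measure.addHaar_submodule μ _ hker
  rw [← measure_preimage_add_right μ (-x)] at hnull
  simpa [ae_iff, preimage, sub_eq_add_neg] using hnull

variable {n : ℕ}

local notation "𝔼" => EuclideanSpace ℝ (Fin n)

/-- The energy `∫∫ (g(x) g(y)) (f(x) - f(y))² |x - y|^(-(n + α)) dx dy` of `f` on the half-space,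
weighted by the ground state `g(x) = dist(x, ∂H)^((α - 1) / 2)`. -/
def groundEnergy (e p : 𝔼) (α : ℝ) (f : 𝔼 → ℝ) : ℝ≥0∞ :=
  ∫⁻ x in halfSpace e p, ∫⁻ y in halfSpace e p,
    ENNReal.ofReal ((inner ℝ e (x - p) * inner ℝ e (y - p)) ^ ((α - 1) / 2) * (f x - f y) ^ 2) *
      ENNReal.ofReal (‖x - y‖ ^ (-((n : ℝ) + α)))

theorem dirIntegral_halfGauge [NeZero n] {e p x : 𝔼} (he : ‖e‖ = 1) {β : ℝ} (hβ : 0 < β)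
    (hx : x ∈ halfSpace e p) :
    dirIntegral (halfGauge e p) β x =
      ENNReal.ofReal (sphereMoment n β) * ENNReal.ofReal (inner ℝ e (x - p) ^ (-β)) := by
  have hx' : 0 < inner ℝ e (x - p) := hx
  rw [← lintegral_sphere_abs_rpow hβ (0 : Fin n), ← lintegral_sphere_inner he 0 β,
    ← lintegral_mul_const' _ _ ENNReal.ofReal_ne_top, dirIntegral]
  refine lintegral_congr fun w => ?_
  rw [halfGauge_add_neg hx, ← ENNReal.ofReal_mul (by positivity),
    Real.div_rpow (abs_nonneg _) hx'.le, Real.rpow_neg hx'.le, div_eq_mul_inv]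

theorem remainderEnergy_halfGauge_le {e p : 𝔼} {V : ℝ} {u f : 𝔼 → ℝ} (hu : Measurable u)
    (huf : ∀ x ∈ halfSpace e p, u x = inner ℝ e (x - p) ^ ((α - 1) / 2) * f x) :
    remainderEnergy (halfSpace e p) (halfGauge e p) α V u ≤ (1 / 2) * groundEnergy e p α f := by
  have h := isGauge_halfGauge e p
  have hΩ := (isOpen_halfSpace e p).measurableSet
  have hρ := h.measurable_groundRatio α
  rw [remainderEnergy, groundEnergy]
  gcongr
  refine (h.lintegral_prod_mul_truncKernel_le hΩ
    (by unfold groundRemainder; fun_prop)).trans (le_of_eq ?_)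
  exact setLIntegral_congr_fun hΩ fun x hx => setLIntegral_congr_fun hΩ fun y hy => by
    simp only [groundRemainder_halfGauge hx hy huf]

theorem regionalForm_halfSpace_le [NeZero n] {e p : 𝔼} (hα1 : 1 ≤ α) (hα2 : α < 2) (he : e ≠ 0)
    {u f : 𝔼 → ℝ} (hu : Measurable u)
    (huf : ∀ x ∈ halfSpace e p, u x = inner ℝ e (x - p) ^ ((α - 1) / 2) * f x)
    (hfin : ∫⁻ x in halfSpace e p,
      ENNReal.ofReal (u x ^ 2) * dirIntegral (halfGauge e p) α x ≠ ∞) :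
    regionalForm (halfSpace e p) α u ≤
      ENNReal.ofReal (lineKappa α / 2) * (∫⁻ x in halfSpace e p,
        ENNReal.ofReal (u x ^ 2) * dirIntegral (halfGauge e p) α x) +
          (1 / 2) * groundEnergy e p α f := by
  have h := isGauge_halfGauge e p
  have hΩ := (isOpen_halfSpace e p).measurableSet
  have hpos : ∀ x ∈ halfSpace e p, ∀ᵐ y : 𝔼,
      0 < halfGauge e p x (y - x) + halfGauge e p x (x - y) := fun x hx => by
    filter_upwards [ae_inner_sub_ne_zero volume he x] with y hy
    rw [← neg_sub y x, halfGauge_add_neg hx]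
    exact div_pos (abs_pos.2 hy) hx
  refine le_of_forall_le_add_ofReal_mul hfin fun δ hδ => ?_
  refine h.regionalForm_le_of_eventually_truncEnergy_le hΩ (convex_halfSpace e p) hpos hu ?_
  filter_upwards [h.eventually_truncEnergy_le hα1 hα2 hΩ (halfGauge_eq_zero_or e p) hu hfin hδ]
    with V hV
  rw [ENNReal.ofReal_add (div_nonneg (lineKappa_nonneg hα1 hα2) two_pos.le) hδ.le, add_mul] at hV
  exact hV.trans ((add_le_add_right (remainderEnergy_halfGauge_le hu huf) _).trans_eq
    (add_right_comm _ _ _))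

end HalfSpace

section RpowIntegral

theorem lintegral_Ioc_ofReal_rpow {a s : ℝ} (ha : 0 ≤ a) (hs : -1 < s) :
    ∫⁻ r in Ioc 0 a, ENNReal.ofReal (r ^ s) = ENNReal.ofReal (a ^ (s + 1) / (s + 1)) := by
  have hint : IntegrableOn (fun r : ℝ => r ^ s) (Ioc 0 a) :=
    (intervalIntegral.intervalIntegrable_rpow' hs).1
  have hnn : 0 ≤ᵐ[volume.restrict (Ioc 0 a)] fun r : ℝ => r ^ s :=
    ae_restrict_of_forall_mem measurableSet_Ioc fun r hr => Real.rpow_nonneg hr.1.le s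
  rw [← ofReal_integral_eq_lintegral_ofReal hint hnn, ← intervalIntegral.integral_of_le ha,
    integral_rpow (Or.inl hs), Real.zero_rpow (by linarith), sub_zero]

theorem lintegral_Ioi_ofReal_rpow {a s : ℝ} (ha : 0 < a) (hs : s < -1) :
    ∫⁻ r in Ioi a, ENNReal.ofReal (r ^ s) = ENNReal.ofReal (-a ^ (s + 1) / (s + 1)) := by
  have hnn : 0 ≤ᵐ[volume.restrict (Ioi a)] fun r : ℝ => r ^ s :=
    ae_restrict_of_forall_mem measurableSet_Ioi fun r hr => Real.rpow_nonneg (ha.trans hr).le s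
  rw [← ofReal_integral_eq_lintegral_ofReal (integrableOn_Ioi_rpow_of_lt hs ha) hnn,
    integral_Ioi_rpow_of_lt hs ha]

end RpowIntegral

noncomputable section RadialBound

/-- A radial majorant for the ground state energy density of a function with logarithmic
oscillation `k`, at a point of height `h` and distance `r` from it. -/
def radialBound (α k h r : ℝ) : ℝ :=
  if r ≤ h / 2 then 2 * k ^ 2 * h ^ (α - 3) * r ^ (2 : ℝ) else k ^ (α - 1) * r ^ (α - 1)

/-- The factor by which the ground state energy of a function with logarithmic oscillation `k`
exceeds the integral of the reciprocal height. -/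
def oscConst (α k : ℝ) : ℝ := 2 * k ^ 2 / (2 - α) + 2 * k ^ (α - 1)

variable {α k h r : ℝ}

theorem radialBound_nonneg (hk : 0 ≤ k) (hh : 0 ≤ h) (hr : 0 ≤ r) :
    0 ≤ radialBound α k h r := by
  unfold radialBound
  split_ifs <;> positivity

theorem oscConst_nonneg (hα : α < 2) (hk : 0 ≤ k) : 0 ≤ oscConst α k := by
  have : 0 < 2 - α := sub_pos.2 hα
  unfold oscConst
  positivity

theorem measurable_radialBound (α k : ℝ) :
    Measurable fun q : ℝ × ℝ => radialBound α k q.1 q.2 := by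
  unfold radialBound
  exact Measurable.ite (measurableSet_le (by fun_prop) (by fun_prop)) (by fun_prop) (by fun_prop)

theorem lintegral_radialBound_near (hα : α < 2) (hh : 0 ≤ h) :
    ∫⁻ r in Ioc 0 (h / 2), ENNReal.ofReal (radialBound α k h r * r ^ (-1 - α)) =
      ENNReal.ofReal (2 * k ^ 2 * h ^ (α - 3) * ((h / 2) ^ (2 - α) / (2 - α))) := by
  have hC : 0 ≤ 2 * k ^ 2 * h ^ (α - 3) := by positivity
  have hexp : (2 : ℝ) - α = 1 - α + 1 := by ring
  rw [ENNReal.ofReal_mul hC, hexp, ← lintegral_Ioc_ofReal_rpow (by positivity) (by linarith),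
    ← lintegral_const_mul' _ _ ENNReal.ofReal_ne_top]
  refine setLIntegral_congr_fun measurableSet_Ioc fun r hr => ?_
  rw [← ENNReal.ofReal_mul hC, radialBound, if_pos hr.2, mul_assoc, ← Real.rpow_add hr.1,
    show 2 + (-1 - α) = 1 - α by ring]

theorem lintegral_radialBound_far (hk : 0 ≤ k) (hh : 0 < h) :
    ∫⁻ r in Ioi (h / 2), ENNReal.ofReal (radialBound α k h r * r ^ (-1 - α)) =
      ENNReal.ofReal (k ^ (α - 1) * (2 / h)) := by
  have hC : 0 ≤ k ^ (α - 1) := by positivity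
  have htail : 2 / h = -(h / 2) ^ (-2 + 1 : ℝ) / (-2 + 1) := by
    rw [show (-2 + 1 : ℝ) = -1 by norm_num, Real.rpow_neg_one, inv_div, neg_div_neg_eq, div_one]
  rw [ENNReal.ofReal_mul hC, htail, ← lintegral_Ioi_ofReal_rpow (by positivity) (by norm_num),
    ← lintegral_const_mul' _ _ ENNReal.ofReal_ne_top]
  refine setLIntegral_congr_fun measurableSet_Ioi fun r (hr : h / 2 < r) => ?_
  rw [← ENNReal.ofReal_mul hC, radialBound, if_neg hr.not_ge, mul_assoc,
    ← Real.rpow_add (by linarith), show α - 1 + (-1 - α) = -2 by ring]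

theorem lintegral_radialBound_le (hα : α < 2) (hk : 0 ≤ k) (hh : 0 < h) :
    ∫⁻ r in Ioi (0 : ℝ), ENNReal.ofReal (radialBound α k h r * r ^ (-1 - α)) ≤
      ENNReal.ofReal (oscConst α k / h) := by
  have h2α : 0 < 2 - α := sub_pos.2 hα
  have hhalf : (h / 2) ^ (2 - α) ≤ h ^ (2 - α) :=
    Real.rpow_le_rpow (by positivity) (by linarith) h2α.le
  have hinv : h ^ (α - 3) * h ^ (2 - α) = h⁻¹ := by
    rw [← Real.rpow_add hh, show α - 3 + (2 - α) = -1 by ring, Real.rpow_neg_one]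
  rw [← Ioc_union_Ioi_eq_Ioi (by positivity : 0 ≤ h / 2)]
  refine (lintegral_union_le _ _ _).trans ?_
  rw [lintegral_radialBound_near hα hh.le, lintegral_radialBound_far hk hh,
    ← ENNReal.ofReal_add (by positivity) (by positivity)]
  refine ENNReal.ofReal_le_ofReal ?_
  calc 2 * k ^ 2 * h ^ (α - 3) * ((h / 2) ^ (2 - α) / (2 - α)) + k ^ (α - 1) * (2 / h)
      ≤ 2 * k ^ 2 * h ^ (α - 3) * (h ^ (2 - α) / (2 - α)) + k ^ (α - 1) * (2 / h) := by gcongr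
    _ = 2 * k ^ 2 * (h ^ (α - 3) * h ^ (2 - α)) / (2 - α) + k ^ (α - 1) * (2 / h) := by ring
    _ = oscConst α k / h := by rw [hinv, oscConst]; ring

variable {s t d : ℝ}

theorem rpow_mul_sq_le_near (hα1 : 1 ≤ α) (hα3 : α ≤ 3) (hs : 0 < s) (hst : s / 2 ≤ t)
    (hd : d ^ 2 * (s * t) ≤ k ^ 2 * r ^ 2) :
    (s * t) ^ ((α - 1) / 2) * d ^ 2 ≤ 2 * k ^ 2 * s ^ (α - 3) * r ^ (2 : ℝ) := by
  have ht : 0 < t := by linarith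
  have hsplit : (s * t) ^ ((α - 1) / 2) = (s * t) ^ ((α - 3) / 2) * (s * t) := by
    rw [← Real.rpow_add_one (by positivity)]
    congr 1; ring
  have htwo : (2 : ℝ) ^ (-((α - 3) / 2)) ≤ 2 := by
    simpa using Real.rpow_le_rpow_of_exponent_le one_le_two (by linarith : -((α - 3) / 2) ≤ 1)
  have hneg : (s * t) ^ ((α - 3) / 2) ≤ s ^ (α - 3) * 2 := by
    calc (s * t) ^ ((α - 3) / 2) ≤ (s * (s / 2)) ^ ((α - 3) / 2) :=
          Real.rpow_le_rpow_of_nonpos (by positivity) (by gcongr) (by linarith)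
      _ = s ^ (α - 3) * 2 ^ (-((α - 3) / 2)) := by
          rw [show s * (s / 2) = s ^ (2 : ℝ) * 2⁻¹ by rw [Real.rpow_two]; ring,
            Real.mul_rpow (by positivity) (by positivity), ← Real.rpow_mul hs.le,
            Real.inv_rpow (by positivity), ← Real.rpow_neg (by positivity)]
          congr 2; ring
      _ ≤ s ^ (α - 3) * 2 := by gcongr
  calc (s * t) ^ ((α - 1) / 2) * d ^ 2
      = (s * t) ^ ((α - 3) / 2) * (d ^ 2 * (s * t)) := by rw [hsplit]; ring
    _ ≤ s ^ (α - 3) * 2 * (k ^ 2 * r ^ 2) := by gcongr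
    _ = 2 * k ^ 2 * s ^ (α - 3) * r ^ (2 : ℝ) := by rw [Real.rpow_two]; ring

theorem rpow_mul_sq_le_far (hα1 : 1 ≤ α) (hα3 : α ≤ 3) (hk : 0 ≤ k) (hr : 0 ≤ r)
    (hst : 0 ≤ s * t) (hd1 : d ^ 2 ≤ 1) (hd2 : d ^ 2 * (s * t) ≤ k ^ 2 * r ^ 2) :
    (s * t) ^ ((α - 1) / 2) * d ^ 2 ≤ k ^ (α - 1) * r ^ (α - 1) := by
  have hd : d ^ 2 ≤ (d ^ 2) ^ ((α - 1) / 2) :=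
    Real.self_le_rpow_of_le_one (sq_nonneg _) hd1 (by linarith)
  calc (s * t) ^ ((α - 1) / 2) * d ^ 2
      ≤ (s * t) ^ ((α - 1) / 2) * (d ^ 2) ^ ((α - 1) / 2) := by gcongr
    _ = (d ^ 2 * (s * t)) ^ ((α - 1) / 2) := by rw [Real.mul_rpow (sq_nonneg _) hst, mul_comm]
    _ ≤ (k ^ 2 * r ^ 2) ^ ((α - 1) / 2) :=
        Real.rpow_le_rpow (by positivity) hd2 (by linarith)
    _ = k ^ (α - 1) * r ^ (α - 1) := by
        rw [← mul_pow, ← Real.rpow_natCast_mul (by positivity), Real.mul_rpow hk hr]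
        congr 2 <;> (push_cast; ring)

theorem rpow_mul_sq_le_radialBound (hα1 : 1 ≤ α) (hα3 : α ≤ 3) (hk : 0 ≤ k) (hs : 0 < s)
    (ht : 0 ≤ t) (hr : 0 ≤ r) (hst : |s - t| ≤ r) (hd1 : d ^ 2 ≤ 1)
    (hd2 : d ^ 2 * (s * t) ≤ k ^ 2 * r ^ 2) :
    (s * t) ^ ((α - 1) / 2) * d ^ 2 ≤ radialBound α k s r := by
  unfold radialBound
  split_ifs with hrs
  · exact rpow_mul_sq_le_near hα1 hα3 hs (by linarith [(abs_le.1 hst).2]) hd2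
  · exact rpow_mul_sq_le_far hα1 hα3 hk hr (by positivity) hd1 hd2

end RadialBound

section GroundEnergyBound

theorem lintegral_lintegral_le_two_mul_of_symm {X : Type*} [MeasurableSpace X] {μ : Measure X}
    [SFinite μ] {H S : Set X} (hH : MeasurableSet H) (hS : MeasurableSet S) {g G : X → X → ℝ≥0∞}
    (hG : Measurable fun q : X × X => G q.1 q.2) (hsymm : ∀ x y, g x y = g y x)
    (hle : ∀ x ∈ H ∩ S, ∀ y ∈ H, g x y ≤ G x y)
    (hzero : ∀ x ∈ H \ S, ∀ y ∈ H \ S, g x y = 0) :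
    ∫⁻ x in H, ∫⁻ y in H, g x y ∂μ ∂μ ≤ 2 * ∫⁻ x in S, ∫⁻ y, G x y ∂μ ∂μ := by
  set K : X × X → ℝ≥0∞ := (Prod.fst ⁻¹' S).indicator fun q => G q.1 q.2
  have hK : Measurable K := hG.indicator (measurable_fst hS)
  have hKint : ∫⁻ x, ∫⁻ y, K (x, y) ∂μ ∂μ = ∫⁻ x in S, ∫⁻ y, G x y ∂μ ∂μ := by
    rw [← lintegral_indicator hS]
    refine lintegral_congr fun x => ?_
    by_cases hx : x ∈ S <;> simp [K, hx]
  have hpt : ∀ x ∈ H, ∀ y ∈ H, g x y ≤ K (x, y) + K (y, x) := by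
    intro x hx y hy
    by_cases hxS : x ∈ S
    · exact ((hle x ⟨hx, hxS⟩ y hy).trans (by simp [K, hxS])).trans le_self_add
    by_cases hyS : y ∈ S
    · rw [hsymm]
      exact ((hle y ⟨hy, hyS⟩ x hx).trans (by simp [K, hyS])).trans le_add_self
    · exact (hzero x ⟨hx, hxS⟩ y ⟨hy, hyS⟩).trans_le zero_le
  calc ∫⁻ x in H, ∫⁻ y in H, g x y ∂μ ∂μ
      ≤ ∫⁻ x in H, ∫⁻ y in H, (K (x, y) + K (y, x)) ∂μ ∂μ :=
        setLIntegral_mono' hH fun x hx => setLIntegral_mono' hH fun y hy => hpt x hx y hy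
    _ ≤ ∫⁻ x, ∫⁻ y, (K (x, y) + K (y, x)) ∂μ ∂μ :=
        (setLIntegral_le_lintegral _ _).trans
          (lintegral_mono fun _ => setLIntegral_le_lintegral _ _)
    _ = ∫⁻ x, ((∫⁻ y, K (x, y) ∂μ) + ∫⁻ y, K (y, x) ∂μ) ∂μ :=
        lintegral_congr fun x => lintegral_add_left (hK.comp measurable_prodMk_left) _
    _ = (∫⁻ x, ∫⁻ y, K (x, y) ∂μ ∂μ) + ∫⁻ x, ∫⁻ y, K (y, x) ∂μ ∂μ :=
        lintegral_add_left hK.lintegral_prod_right' _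
    _ = 2 * ∫⁻ x in S, ∫⁻ y, G x y ∂μ ∂μ := by
        rw [lintegral_lintegral_swap (f := fun x y => K (y, x))
          (hK.comp measurable_swap).aemeasurable, hKint, two_mul]

variable {n : ℕ}

local notation "𝔼" => EuclideanSpace ℝ (Fin n)
local notation "dS" => Measure.toSphere (volume : Measure (EuclideanSpace ℝ (Fin n)))

theorem lintegral_radialBound_norm_le [NeZero n] {α k h : ℝ} (hα : α < 2) (hk : 0 ≤ k)
    (hh : 0 < h) (x : 𝔼) :
    ∫⁻ y : 𝔼, ENNReal.ofReal (radialBound α k h ‖x - y‖) *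
        ENNReal.ofReal (‖x - y‖ ^ (-((n : ℝ) + α))) ≤
      ENNReal.ofReal (oscConst α k / h) * dS univ := by
  have hm : Measurable fun r => radialBound α k h r :=
    (measurable_radialBound α k).comp (by fun_prop : Measurable fun r : ℝ => (h, r))
  rw [lintegral_sub_left_eq_self (fun y : 𝔼 => ENNReal.ofReal (radialBound α k h ‖y‖) *
        ENNReal.ofReal (‖y‖ ^ (-((n : ℝ) + α)))) x,
    lintegral_eq_lintegral_sphere volume (by fun_prop), ← lintegral_const]
  refine lintegral_mono fun w =>
    (setLIntegral_congr_fun measurableSet_Ioi fun r (hr : 0 < r) => ?_).trans_le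
      (lintegral_radialBound_le hα hk hh)
  have hnorm : ‖r • w.1‖ = r := by
    rw [norm_smul, Real.norm_of_nonneg hr.le, norm_eq_of_mem_sphere, mul_one]
  simp only [hnorm, finrank_euclideanSpace, Fintype.card_fin]
  rw [← ENNReal.ofReal_mul (radialBound_nonneg hk hh.le hr.le),
    ← ENNReal.ofReal_mul (by positivity), mul_left_comm, ← Real.rpow_natCast, ← Real.rpow_add hr,
    Nat.cast_sub NeZero.one_le, Nat.cast_one, show (n : ℝ) - 1 + -((n : ℝ) + α) = -1 - α by ring]

theorem abs_inner_sub_inner_sub_le {F : Type*} [NormedAddCommGroup F] [InnerProductSpace ℝ F]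
    {e : F} (he : ‖e‖ ≤ 1) (p x y : F) :
    |inner ℝ e (x - p) - inner ℝ e (y - p)| ≤ ‖x - y‖ := by
  rw [← inner_sub_right, sub_sub_sub_cancel_right]
  exact (abs_real_inner_le_norm e (x - y)).trans (mul_le_of_le_one_left (norm_nonneg _) he)

theorem groundEnergy_le [NeZero n] {e p : 𝔼} {α k : ℝ} (hα1 : 1 ≤ α) (hα2 : α < 2) (he : ‖e‖ ≤ 1)
    (hk : 0 ≤ k) {f : 𝔼 → ℝ} {S : Set 𝔼} (hS : MeasurableSet S) (hSH : S ⊆ halfSpace e p)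
    (hf0 : ∀ x ∉ S, f x = 0) (hf1 : ∀ x y, (f x - f y) ^ 2 ≤ 1)
    (hf2 : ∀ x ∈ halfSpace e p, ∀ y ∈ halfSpace e p,
      (f x - f y) ^ 2 * (inner ℝ e (x - p) * inner ℝ e (y - p)) ≤ k ^ 2 * ‖x - y‖ ^ 2) :
    groundEnergy e p α f ≤ 2 * (ENNReal.ofReal (oscConst α k) * dS univ *
      ∫⁻ x in S, ENNReal.ofReal (inner ℝ e (x - p))⁻¹) := by
  have hbound : Measurable fun q : 𝔼 × 𝔼 =>
      radialBound α k (inner ℝ e (q.1 - p)) ‖q.1 - q.2‖ :=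
    (measurable_radialBound α k).comp
      (by fun_prop : Measurable fun q : 𝔼 × 𝔼 => (inner ℝ e (q.1 - p), ‖q.1 - q.2‖))
  refine (lintegral_lintegral_le_two_mul_of_symm (isOpen_halfSpace e p).measurableSet hS
    (G := fun x y => ENNReal.ofReal (radialBound α k (inner ℝ e (x - p)) ‖x - y‖) *
      ENNReal.ofReal (‖x - y‖ ^ (-((n : ℝ) + α)))) (by fun_prop)
    (fun x y => ?_) (fun x hx y hy => ?_) fun x hx y hy => ?_).trans ?_
  · rw [norm_sub_rev, sub_sq_comm, mul_comm (inner ℝ e (x - p))]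
  · gcongr
    exact rpow_mul_sq_le_radialBound hα1 (by linarith) hk hx.1 (le_of_lt hy) (norm_nonneg _)
      (abs_inner_sub_inner_sub_le he p x y) (hf1 x y) (hf2 x hx.1 y hy)
  · simp [hf0 x hx.2, hf0 y hy.2]
  · refine mul_le_mul_right ?_ 2
    rw [← lintegral_const_mul _ (by fun_prop)]
    refine setLIntegral_mono' hS fun x hx => ?_
    refine (lintegral_radialBound_norm_le hα2 hk (hSH hx) x).trans_eq ?_
    rw [div_eq_mul_inv, ENNReal.ofReal_mul (oscConst_nonneg hα2 hk), mul_right_comm]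

end GroundEnergyBound

section LogOscillation

theorem sq_log_sub_log_mul_le {s t : ℝ} (hs : 0 < s) (ht : 0 < t) :
    (Real.log s - Real.log t) ^ 2 * (s * t) ≤ (s - t) ^ 2 := by
  obtain ⟨A, rfl⟩ : ∃ A, Real.exp A = s := ⟨_, Real.exp_log hs⟩
  obtain ⟨B, rfl⟩ : ∃ B, Real.exp B = t := ⟨_, Real.exp_log ht⟩
  have hdiff : Real.exp A - Real.exp B =
      Real.exp ((A + B) / 2) * (2 * Real.sinh ((A - B) / 2)) := by
    rw [Real.sinh_eq, mul_div_cancel₀ _ two_ne_zero, mul_sub, ← Real.exp_add, ← Real.exp_add]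
    congr 2 <;> ring
  have hprod : Real.exp A * Real.exp B = Real.exp ((A + B) / 2) ^ 2 := by
    rw [← Real.exp_add, sq, ← Real.exp_add]
    congr 1; ring
  have hsinh : ((A - B) / 2) ^ 2 ≤ Real.sinh ((A - B) / 2) ^ 2 := by
    rw [sq_le_sq, Real.abs_sinh]
    exact Real.self_le_sinh_iff.2 (abs_nonneg _)
  rw [Real.log_exp, Real.log_exp, hdiff, hprod, mul_pow, mul_pow, mul_comm]
  gcongr
  linarith

theorem abs_log_max_sub_log_max_le {s t a : ℝ} (hs : 0 < s) (ht : 0 < t) (ha : 0 < a) :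
    |Real.log (max s a) - Real.log (max t a)| ≤ |Real.log s - Real.log t| := by
  have hlog : ∀ {x : ℝ}, 0 < x → Real.log (max x a) = max (Real.log x) (Real.log a) := fun hx =>
    Real.strictMonoOn_log.monotoneOn.map_max hx ha
  rw [hlog hs, hlog ht]
  exact abs_max_sub_max_le_abs _ _ _

end LogOscillation

noncomputable section LogCutoff

/-- The distance between `h` and `m` on the logarithmic scale; `h` is first raised to
`m * exp (-L)`, so that the value is `L`, and not junk, for small or negative `h`. -/
def logDist (m L h : ℝ) : ℝ := |Real.log (max h (m * Real.exp (-L))) - Real.log m|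

/-- The cutoff at height `h` and distance `N`: logarithmic around `m` in `h`, linear in `N`. -/
def logCutoff (m L R h N : ℝ) : ℝ := max 0 (1 - logDist m L h / L - N / R)

variable {m L R h N : ℝ}

theorem log_mul_exp (hm : 0 < m) (s : ℝ) : Real.log (m * Real.exp s) = Real.log m + s := by
  rw [Real.log_mul hm.ne' (Real.exp_pos s).ne', Real.log_exp]

theorem logDist_nonneg (m L h : ℝ) : 0 ≤ logDist m L h := abs_nonneg _

theorem logDist_of_le (hm : 0 < m) (hL : 0 ≤ L) (hh : h ≤ m * Real.exp (-L)) :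
    logDist m L h = L := by
  rw [logDist, max_eq_right hh, log_mul_exp hm, add_sub_cancel_left, abs_neg, abs_of_nonneg hL]

theorem le_logDist (hm : 0 < m) (hh : m * Real.exp L ≤ h) : L ≤ logDist m L h := by
  have hlog : Real.log m + L ≤ Real.log (max h (m * Real.exp (-L))) := by
    rw [← log_mul_exp hm]
    exact Real.log_le_log (by positivity) (hh.trans (le_max_left _ _))
  exact (le_sub_iff_add_le'.2 hlog).trans (le_abs_self _)

theorem logDist_le_half (hm : 0 < m) (hL : 0 ≤ L) (h1 : m * Real.exp (-(L / 2)) ≤ h)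
    (h2 : h ≤ m * Real.exp (L / 2)) : logDist m L h ≤ L / 2 := by
  have hh : 0 < h := lt_of_lt_of_le (by positivity) h1
  have hcap : m * Real.exp (-L) ≤ h := by
    refine le_trans ?_ h1
    gcongr
    linarith
  have hlow := Real.log_le_log (by positivity) h1
  have hupp := Real.log_le_log hh h2
  rw [log_mul_exp hm] at hlow hupp
  rw [logDist, max_eq_left hcap, abs_le]
  constructor <;> linarith

theorem logDist_sub_le {s t : ℝ} (hm : 0 < m) (hs : 0 < s) (ht : 0 < t) :
    logDist m L t - logDist m L s ≤ |Real.log s - Real.log t| := by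
  calc logDist m L t - logDist m L s
      ≤ |Real.log (max t (m * Real.exp (-L))) - Real.log (max s (m * Real.exp (-L)))| := by
        simpa only [logDist, sub_sub_sub_cancel_right] using abs_sub_abs_le_abs_sub
          (Real.log (max t (m * Real.exp (-L))) - Real.log m)
          (Real.log (max s (m * Real.exp (-L))) - Real.log m)
    _ ≤ |Real.log s - Real.log t| := by
        rw [abs_sub_comm (Real.log s)]
        exact abs_log_max_sub_log_max_le ht hs (by positivity)

theorem continuous_logDist (hm : 0 < m) : Continuous (logDist m L) := by
  have hpos : ∀ h, max h (m * Real.exp (-L)) ≠ 0 := fun h =>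
    (lt_max_of_lt_right (by positivity)).ne'
  exact ((Continuous.log (by fun_prop) hpos).sub continuous_const).abs

theorem continuous_logCutoff (hm : 0 < m) :
    Continuous fun q : ℝ × ℝ => logCutoff m L R q.1 q.2 := by
  unfold logCutoff
  have := continuous_logDist (L := L) hm
  fun_prop

theorem logCutoff_nonneg (m L R h N : ℝ) : 0 ≤ logCutoff m L R h N := le_max_left _ _

theorem logCutoff_le_one (hL : 0 ≤ L) (hR : 0 ≤ R) (hN : 0 ≤ N) : logCutoff m L R h N ≤ 1 := by
  refine max_le zero_le_one ?_
  have hdist : 0 ≤ logDist m L h / L := div_nonneg (logDist_nonneg m L h) hL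
  have hdiv : 0 ≤ N / R := by positivity
  linarith

theorem quarter_le_logCutoff (hm : 0 < m) (hL : 0 < L) (hR : 0 < R)
    (h1 : m * Real.exp (-(L / 2)) ≤ h) (h2 : h ≤ m * Real.exp (L / 2)) (hN : N ≤ R / 4) :
    1 / 4 ≤ logCutoff m L R h N := by
  have hdist : logDist m L h / L ≤ 1 / 2 := by
    rw [div_le_iff₀ hL]
    linarith [logDist_le_half hm hL.le h1 h2]
  have hdiv : N / R ≤ 1 / 4 := by
    rw [div_le_iff₀ hR]
    linarith
  exact le_max_of_le_right (by linarith)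

theorem mem_of_logCutoff_pos (hm : 0 < m) (hL : 0 < L) (hR : 0 < R) (hN : 0 ≤ N)
    (hpos : 0 < logCutoff m L R h N) :
    m * Real.exp (-L) < h ∧ h < m * Real.exp L ∧ N < R := by
  have hcut : 0 < 1 - logDist m L h / L - N / R := (lt_max_iff.1 hpos).resolve_left (lt_irrefl _)
  have hN' : 0 ≤ N / R := by positivity
  have hdist : logDist m L h < L := (div_lt_one hL).1 (by linarith)
  refine ⟨?_, ?_, (div_lt_one hR).1 ?_⟩
  · by_contra! hle
    exact hdist.ne (logDist_of_le hm hL.le hle)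
  · by_contra! hle
    exact hdist.not_ge (le_logDist hm hle)
  · linarith [div_nonneg (logDist_nonneg m L h) hL.le]

variable {s t M r : ℝ}

theorem logCutoff_sub_le (hm : 0 < m) (hL : 0 < L) (hR : 0 < R) (hs : 0 < s) (ht : 0 < t) :
    logCutoff m L R s M - logCutoff m L R t N ≤
      |Real.log s - Real.log t| / L + |M - N| / R := by
  have hdist := div_le_div_of_nonneg_right (logDist_sub_le (L := L) hm hs ht) hL.le
  have hdiv := div_le_div_of_nonneg_right (neg_abs_le (M - N)) hR.le
  rw [sub_div] at hdist hdiv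
  rw [neg_div] at hdiv
  refine (max_sub_max_le_max _ _ _ _).trans (max_le ?_ ?_)
  · rw [sub_zero]
    positivity
  · linarith

theorem logCutoff_sub_le_of_le (hm : 0 < m) (hL : 0 < L) (hR : 0 ≤ R) (hs : 0 < s) (hM : 0 ≤ M)
    (ht : m * Real.exp L ≤ t) :
    logCutoff m L R s M - logCutoff m L R t N ≤ |Real.log s - Real.log t| / L := by
  have hdist := div_le_div_of_nonneg_right
    (logDist_sub_le (L := L) hm hs (lt_of_lt_of_le (by positivity) ht)) hL.le
  have hone : 1 ≤ logDist m L t / L := (one_le_div hL).2 (le_logDist hm ht)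
  have hM' : 0 ≤ M / R := by positivity
  rw [sub_div] at hdist
  refine (sub_le_self _ (logCutoff_nonneg m L R t N)).trans (max_le (by positivity) ?_)
  linarith

theorem abs_log_sub_log_mul_sqrt_le (hs : 0 < s) (ht : 0 < t) :
    |Real.log s - Real.log t| * √(s * t) ≤ |s - t| := by
  rw [← abs_of_nonneg (Real.sqrt_nonneg (s * t)), ← abs_mul, ← sq_le_sq, mul_pow,
    Real.sq_sqrt (by positivity)]
  exact sq_log_sub_log_mul_le hs ht

theorem logCutoff_sub_mul_sqrt_le (hm : 0 < m) (hL : 0 < L) (hR : m * Real.exp L * L ≤ R)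
    (hs : 0 < s) (ht : 0 < t) (hM : 0 ≤ M) (hst : |s - t| ≤ r) (hMN : |M - N| ≤ r) :
    (logCutoff m L R s M - logCutoff m L R t N) * √(s * t) ≤ 2 / L * r := by
  have hr : 0 ≤ r := (abs_nonneg _).trans hst
  have hb : 0 < m * Real.exp L := by positivity
  have hR0 : 0 < R := lt_of_lt_of_le (by positivity) hR
  have hq : 0 ≤ √(s * t) := Real.sqrt_nonneg _
  have hlog : |Real.log s - Real.log t| / L * √(s * t) ≤ r / L := by
    rw [div_mul_eq_mul_div]
    gcongr
    exact (abs_log_sub_log_mul_sqrt_le hs ht).trans hst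
  have hle : r / L ≤ 2 / L * r := by
    rw [div_mul_eq_mul_div]
    gcongr
    linarith
  rcases (logCutoff_nonneg m L R s M).eq_or_lt with h0 | h0
  · rw [← h0, zero_sub, neg_mul]
    exact (neg_nonpos.2 (mul_nonneg (logCutoff_nonneg m L R t N) hq)).trans (by positivity)
  obtain ⟨-, hsb, -⟩ := mem_of_logCutoff_pos hm hL hR0 hM h0
  rcases le_total t (m * Real.exp L) with htb | htb
  · have hsqrt : √(s * t) ≤ m * Real.exp L := by
      rw [Real.sqrt_le_left hb.le, sq]
      gcongr
    have hlin : |M - N| / R * √(s * t) ≤ r / L := by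
      rw [div_mul_eq_mul_div, div_le_div_iff₀ hR0 hL, mul_assoc]
      gcongr
      exact (mul_le_mul_of_nonneg_right hsqrt hL.le).trans hR
    calc (logCutoff m L R s M - logCutoff m L R t N) * √(s * t)
        ≤ (|Real.log s - Real.log t| / L + |M - N| / R) * √(s * t) :=
          mul_le_mul_of_nonneg_right (logCutoff_sub_le hm hL hR0 hs ht) hq
      _ ≤ r / L + r / L := by rw [add_mul]; exact add_le_add hlog hlin
      _ = 2 / L * r := by ring
  · exact ((mul_le_mul_of_nonneg_right
      (logCutoff_sub_le_of_le hm hL hR0.le hs hM htb) hq).trans hlog).trans hle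

theorem sq_logCutoff_sub_mul_le (hm : 0 < m) (hL : 0 < L) (hR : m * Real.exp L * L ≤ R)
    (hs : 0 < s) (ht : 0 < t) (hM : 0 ≤ M) (hN : 0 ≤ N) (hst : |s - t| ≤ r)
    (hMN : |M - N| ≤ r) :
    (logCutoff m L R s M - logCutoff m L R t N) ^ 2 * (s * t) ≤ (2 / L) ^ 2 * r ^ 2 := by
  have hle := logCutoff_sub_mul_sqrt_le hm hL hR hs ht hM hst hMN
  have hge := logCutoff_sub_mul_sqrt_le hm hL hR ht hs hN ((abs_sub_comm t s).trans_le hst)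
    ((abs_sub_comm N M).trans_le hMN)
  rw [mul_comm t s] at hge
  rw [← Real.sq_sqrt (show 0 ≤ s * t by positivity), ← mul_pow, ← mul_pow]
  exact sq_le_sq' (by linarith) hle

end LogCutoff

section Boxes

variable {n : ℕ}

local notation "𝔼" => EuclideanSpace ℝ (Fin n)

theorem setLIntegral_height_norm {e : 𝔼} (he : ‖e‖ = 1) (p : 𝔼) (i : Fin n)
    (P : ℝ → ℝ → Prop) (F : ℝ → ℝ → ℝ≥0∞) :
    ∫⁻ x in {x : 𝔼 | P (inner ℝ e (x - p)) ‖x - p‖}, F (inner ℝ e (x - p)) ‖x - p‖ =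
      ∫⁻ z in {z : 𝔼 | P (z i) ‖z‖}, F (z i) ‖z‖ := by
  obtain ⟨Φ, hΦ⟩ := exists_isometry_map_eq (v := EuclideanSpace.single i (1 : ℝ)) (w := e)
    (by simp [he])
  have hinner (z : 𝔼) : inner ℝ e (Φ z + p - p) = z i := by
    rw [add_sub_cancel_right, ← hΦ, Φ.inner_map_map, EuclideanSpace.inner_single_left]
    simp
  have hnorm (z : 𝔼) : ‖Φ z + p - p‖ = ‖z‖ := by rw [add_sub_cancel_right, Φ.norm_map]
  have hT : MeasurePreserving (fun z => Φ z + p) :=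
    (measurePreserving_add_right volume p).comp Φ.measurePreserving
  have hTe : MeasurableEmbedding fun z => Φ z + p :=
    (measurableEmbedding_addRight p).comp Φ.toHomeomorph.measurableEmbedding
  rw [← hT.setLIntegral_comp_preimage_emb hTe]
  simp only [preimage_ofPred_eq, hinner, hnorm]

/-- The box of points with `i`-th coordinate between `a` and `b` and the others smaller than `ρ`
in absolute value. -/
def heightBox (i : Fin n) (a b ρ : ℝ) : Set (EuclideanSpace ℝ (Fin n)) :=
  {z | ∀ j, z j ∈ if j = i then Ioo a b else Ioo (-ρ) ρ}

variable {i : Fin n} {a b ρ : ℝ} {z : EuclideanSpace ℝ (Fin n)}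

theorem apply_mem_of_mem_heightBox (hz : z ∈ heightBox i a b ρ) : z i ∈ Ioo a b := by
  simpa using hz i

theorem measurableSet_heightBox (i : Fin n) (a b ρ : ℝ) :
    MeasurableSet (heightBox i a b ρ) := by
  simp only [heightBox, ofPred_forall]
  refine MeasurableSet.iInter fun j => ?_
  split_ifs <;> exact measurableSet_Ioo.preimage (by fun_prop)

theorem norm_le_of_mem_heightBox (ha : 0 ≤ a) (hb : b ≤ ρ) (hz : z ∈ heightBox i a b ρ) :
    ‖z‖ ≤ n * ρ := by
  have hcoord : ∀ j, |z j| ≤ ρ := by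
    intro j
    have hj := hz j
    split_ifs at hj with hji
    · rw [abs_of_nonneg (ha.trans hj.1.le)]
      exact hj.2.le.trans hb
    · exact (abs_lt.2 hj).le
  have hρ : 0 ≤ ρ := (abs_nonneg _).trans (hcoord i)
  have hn : (1 : ℝ) ≤ n := by exact_mod_cast Fin.pos i
  refine le_of_sq_le_sq ?_ (by positivity)
  calc ‖z‖ ^ 2 = ∑ j, |z j| ^ 2 := EuclideanSpace.norm_sq_eq z
    _ ≤ ∑ _j : Fin n, ρ ^ 2 := by gcongr with j; exact hcoord j
    _ = n * ρ ^ 2 := by simp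
    _ ≤ (n * ρ) ^ 2 := by
        rw [mul_pow]
        gcongr
        exact le_self_pow₀ hn two_ne_zero

theorem lintegral_heightBox (i : Fin n) (a b ρ : ℝ) {g : ℝ → ℝ≥0∞} (hg : Measurable g) :
    ∫⁻ z in heightBox i a b ρ, g (z i) =
      ENNReal.ofReal (2 * ρ) ^ (n - 1) * ∫⁻ t in Ioo a b, g t := by
  set s : Fin n → Set ℝ := fun j => if j = i then Ioo a b else Ioo (-ρ) ρ
  have hpre : heightBox i a b ρ =
      (MeasurableEquiv.toLp 2 (Fin n → ℝ)).symm ⁻¹' univ.pi s := by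
    ext z
    simp [heightBox, s]
  have hcard : ∏ j ∈ Finset.univ.erase i, volume (s j) = ENNReal.ofReal (2 * ρ) ^ (n - 1) := by
    rw [Finset.prod_congr rfl fun j hj => ?_, Finset.prod_const,
      Finset.card_erase_of_mem (Finset.mem_univ i), Finset.card_univ, Fintype.card_fin]
    simp only [s, if_neg (Finset.ne_of_mem_erase hj), Real.volume_Ioo]
    ring_nf
  rw [hpre]
  refine ((EuclideanSpace.volume_preserving_symm_measurableEquiv_toLp
    (Fin n)).setLIntegral_comp_preimage_emb (MeasurableEquiv.measurableEmbedding _)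
      (fun x => g (x i)) _).trans ?_
  rw [volume_pi, Measure.restrict_pi_pi]
  refine (lintegral_map hg (measurable_pi_apply i)).symm.trans ?_
  rw [Measure.pi_map_eval, lintegral_smul_measure]
  simp [hcard, s]

theorem lintegral_Ioo_ofReal_inv (ha : 0 < a) (hab : a ≤ b) :
    ∫⁻ t in Ioo a b, ENNReal.ofReal t⁻¹ = ENNReal.ofReal (Real.log (b / a)) := by
  have hpos : ∀ t ∈ uIcc a b, 0 < t := fun t ht => pos_of_mem_uIcc ha (ha.trans_le hab) ht
  have hint : IntervalIntegrable (fun t : ℝ => t⁻¹) volume a b :=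
    intervalIntegral.intervalIntegrable_inv (fun t ht => (hpos t ht).ne') continuousOn_id
  rw [restrict_Ioo_eq_restrict_Ioc, ← integral_inv_of_pos ha (ha.trans_le hab),
    intervalIntegral.integral_of_le hab, ofReal_integral_eq_lintegral_ofReal hint.1]
  exact ae_restrict_of_forall_mem measurableSet_Ioc fun t ht => (inv_pos.2 (ha.trans ht.1)).le

end Boxes

noncomputable section CutoffGroundState

variable {F : Type*} [NormedAddCommGroup F] [InnerProductSpace ℝ F]

/-- The logarithmic cutoff of the half-space `halfSpace e p` near its boundary point `p`. -/
def cutoffProfile (e p : F) (m L R : ℝ) (x : F) : ℝ :=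
  logCutoff m L R (inner ℝ e (x - p)) ‖x - p‖

/-- The set outside which `cutoffProfile e p m L R` vanishes. -/
def cutoffRegion (e p : F) (m L R : ℝ) : Set F :=
  {x | m * Real.exp (-L) < inner ℝ e (x - p) ∧ inner ℝ e (x - p) < m * Real.exp L ∧ ‖x - p‖ < R}

/-- The ground state `dist(x, ∂H)^((α - 1) / 2)` of the half-space, multiplied by the cutoff. -/
def cutoffGroundState (e p : F) (α m L R : ℝ) (x : F) : ℝ :=
  max 0 (inner ℝ e (x - p)) ^ ((α - 1) / 2) * cutoffProfile e p m L R x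

variable {e p x y : F} {α m L R r : ℝ}

theorem cutoffRegion_subset_halfSpace (hm : 0 ≤ m) : cutoffRegion e p m L R ⊆ halfSpace e p :=
  fun _ hx => lt_of_le_of_lt (by positivity) hx.1

theorem measurableSet_cutoffRegion [MeasurableSpace F] [OpensMeasurableSpace F] (e p : F)
    (m L R : ℝ) : MeasurableSet (cutoffRegion e p m L R) := by
  have hcont : Continuous fun x : F => (inner ℝ e (x - p) : ℝ) := by fun_prop
  have hnorm : Continuous fun x : F => ‖x - p‖ := by fun_prop
  exact ((isOpen_lt continuous_const hcont).inter
    ((isOpen_lt hcont continuous_const).inter (isOpen_lt hnorm continuous_const))).measurableSet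

theorem continuous_cutoffProfile (hm : 0 < m) : Continuous (cutoffProfile e p m L R) :=
  (continuous_logCutoff hm).comp
    (by fun_prop : Continuous fun x : F => (inner ℝ e (x - p), ‖x - p‖))

theorem cutoffProfile_mem_Icc (hL : 0 ≤ L) (hR : 0 ≤ R) (x : F) :
    cutoffProfile e p m L R x ∈ Icc 0 1 :=
  ⟨logCutoff_nonneg _ _ _ _ _, logCutoff_le_one hL hR (norm_nonneg _)⟩

theorem cutoffProfile_eq_zero (hm : 0 < m) (hL : 0 < L) (hR : 0 < R)
    (hx : x ∉ cutoffRegion e p m L R) : cutoffProfile e p m L R x = 0 := by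
  by_contra hne
  exact hx (mem_of_logCutoff_pos hm hL hR (norm_nonneg _)
    ((cutoffProfile_mem_Icc hL.le hR.le x).1.lt_of_ne' hne))

theorem sq_cutoffProfile_sub_le_one (hL : 0 ≤ L) (hR : 0 ≤ R) (x y : F) :
    (cutoffProfile e p m L R x - cutoffProfile e p m L R y) ^ 2 ≤ 1 := by
  obtain ⟨hx0, hx1⟩ := cutoffProfile_mem_Icc (e := e) (p := p) (m := m) hL hR x
  obtain ⟨hy0, hy1⟩ := cutoffProfile_mem_Icc (e := e) (p := p) (m := m) hL hR y
  exact sq_le_one_iff_abs_le_one _ |>.2 (abs_le.2 ⟨by linarith, by linarith⟩)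

theorem sq_cutoffProfile_sub_mul_le (he : ‖e‖ ≤ 1) (hm : 0 < m) (hL : 0 < L)
    (hmR : m * Real.exp L * L ≤ R) (hx : x ∈ halfSpace e p) (hy : y ∈ halfSpace e p) :
    (cutoffProfile e p m L R x - cutoffProfile e p m L R y) ^ 2 *
      (inner ℝ e (x - p) * inner ℝ e (y - p)) ≤ (2 / L) ^ 2 * ‖x - y‖ ^ 2 :=
  sq_logCutoff_sub_mul_le hm hL hmR hx hy (norm_nonneg _) (norm_nonneg _)
    (abs_inner_sub_inner_sub_le he p x y)
    (by simpa only [sub_sub_sub_cancel_right] using abs_norm_sub_norm_le (x - p) (y - p))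

theorem cutoffGroundState_eq (hx : x ∈ halfSpace e p) :
    cutoffGroundState e p α m L R x =
      inner ℝ e (x - p) ^ ((α - 1) / 2) * cutoffProfile e p m L R x := by
  rw [cutoffGroundState, max_eq_right (le_of_lt hx)]

theorem continuous_cutoffGroundState (hα : 1 ≤ α) (hm : 0 < m) :
    Continuous (cutoffGroundState e p α m L R) :=
  ((by fun_prop : Continuous fun x : F => max 0 (inner ℝ e (x - p))).rpow_const
    fun _ => Or.inr (by linarith)).mul (continuous_cutoffProfile hm)

theorem sq_cutoffGroundState_mul (hx : x ∈ halfSpace e p) :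
    cutoffGroundState e p α m L R x ^ 2 * inner ℝ e (x - p) ^ (-α) =
      cutoffProfile e p m L R x ^ 2 * (inner ℝ e (x - p))⁻¹ := by
  have hx' : 0 < inner ℝ e (x - p) := hx
  rw [cutoffGroundState_eq hx, mul_pow, ← Real.rpow_mul_natCast hx'.le, mul_right_comm,
    ← Real.rpow_add hx', ← Real.rpow_neg_one, mul_comm]
  congr 2
  push_cast
  ring

theorem mem_ball_of_le_inner {a : ℝ} (he : ‖e‖ = 1) (hr : 0 ≤ r) (hRr : R ^ 2 < 2 * r * a)
    (ha : a ≤ inner ℝ e (x - p)) (hR : ‖x - p‖ ≤ R) : x ∈ Metric.ball (p + r • e) r := by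
  rw [Metric.mem_ball, dist_eq_norm, ← sub_sub]
  refine lt_of_pow_lt_pow_left₀ 2 hr ?_
  rw [norm_sub_sq_real, norm_smul, he, mul_one, Real.norm_of_nonneg hr,
    real_inner_smul_right, real_inner_comm]
  have hnorm : ‖x - p‖ ^ 2 ≤ R ^ 2 := pow_le_pow_left₀ (norm_nonneg _) hR 2
  linarith [mul_le_mul_of_nonneg_left ha hr]

theorem isCompact_inter_closedBall [ProperSpace F] (e p : F) (a R : ℝ) :
    IsCompact ({x | a ≤ inner ℝ e (x - p)} ∩ Metric.closedBall p R) :=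
  (isCompact_closedBall p R).inter_left (isClosed_le continuous_const (by fun_prop))

theorem tsupport_cutoffGroundState_subset (hm : 0 < m) (hL : 0 < L) (hR : 0 < R) :
    tsupport (cutoffGroundState e p α m L R) ⊆
      {x | m * Real.exp (-L) ≤ inner ℝ e (x - p)} ∩ Metric.closedBall p R := by
  refine closure_minimal (fun x hx => ?_)
    ((isClosed_le continuous_const (by fun_prop)).inter Metric.isClosed_closedBall)
  have hmem : x ∈ cutoffRegion e p m L R :=
    by_contra fun h => right_ne_zero_of_mul hx (cutoffProfile_eq_zero hm hL hR h)
  exact ⟨hmem.1.le, mem_closedBall_iff_norm.2 hmem.2.2.le⟩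

theorem exists_cutoff_parameters (hL : 0 < L) (hr : 0 < r) :
    ∃ m R : ℝ, 0 < m ∧ m * Real.exp L * L = R ∧ R ^ 2 < 2 * r * (m * Real.exp (-L)) := by
  have hexp : Real.exp (-L) * Real.exp L = 1 := by
    rw [← Real.exp_add, neg_add_cancel, Real.exp_zero]
  refine ⟨r * Real.exp (-L) ^ 3 / L ^ 2, r * Real.exp (-L) ^ 2 / L, by positivity, ?_, ?_⟩
  · calc r * Real.exp (-L) ^ 3 / L ^ 2 * Real.exp L * L
        = r * Real.exp (-L) ^ 2 / L * (Real.exp (-L) * Real.exp L) := by field_simp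
      _ = r * Real.exp (-L) ^ 2 / L := by rw [hexp, mul_one]
  · have hpos : 0 < (r * Real.exp (-L) ^ 2 / L) ^ 2 := by positivity
    have hdouble : 2 * r * (r * Real.exp (-L) ^ 3 / L ^ 2 * Real.exp (-L)) =
        2 * (r * Real.exp (-L) ^ 2 / L) ^ 2 := by ring
    linarith

end CutoffGroundState

noncomputable section CutoffMass

variable {n : ℕ}

local notation "𝔼" => EuclideanSpace ℝ (Fin n)

variable {e p : EuclideanSpace ℝ (Fin n)} {α m L R : ℝ}

/-- The Hardy integral `∫_H u(x)² / dist(x, ∂H)^α dx` of the cut-off ground state `u`. -/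
def cutoffMass (e p : 𝔼) (m L R : ℝ) : ℝ≥0∞ :=
  ∫⁻ x in halfSpace e p,
    ENNReal.ofReal (cutoffProfile e p m L R x ^ 2 * (inner ℝ e (x - p))⁻¹)

theorem setLIntegral_sq_cutoffGroundState_mul (e p : 𝔼) (α m L R : ℝ) :
    ∫⁻ x in halfSpace e p, ENNReal.ofReal (cutoffGroundState e p α m L R x ^ 2) *
      ENNReal.ofReal (inner ℝ e (x - p) ^ (-α)) = cutoffMass e p m L R :=
  setLIntegral_congr_fun (isOpen_halfSpace e p).measurableSet fun x hx => by
    simp only [← ENNReal.ofReal_mul (sq_nonneg _), sq_cutoffGroundState_mul hx]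

theorem log_mul_exp_div (hm : 0 < m) (s : ℝ) :
    Real.log (m * Real.exp s / (m * Real.exp (-s))) = 2 * s := by
  rw [mul_div_mul_left _ _ hm.ne', ← Real.exp_sub, Real.log_exp]
  ring

theorem lintegral_heightBox_exp (i : Fin n) (hm : 0 < m) (hL : 0 ≤ L) (ρ : ℝ) :
    ∫⁻ z in heightBox i (m * Real.exp (-L)) (m * Real.exp L) ρ, ENNReal.ofReal (z i)⁻¹ =
      ENNReal.ofReal (2 * ρ) ^ (n - 1) * ENNReal.ofReal (2 * L) := by
  rw [lintegral_heightBox i _ _ _ (by fun_prop : Measurable fun t : ℝ => ENNReal.ofReal t⁻¹),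
    lintegral_Ioo_ofReal_inv (by positivity) (by gcongr; linarith), log_mul_exp_div hm]

theorem lintegral_cutoffRegion_le [NeZero n] (he : ‖e‖ = 1) (hm : 0 < m) (hL : 0 ≤ L) (R : ℝ) :
    ∫⁻ x in cutoffRegion e p m L R, ENNReal.ofReal (inner ℝ e (x - p))⁻¹ ≤
      ENNReal.ofReal (2 * R) ^ (n - 1) * ENNReal.ofReal (2 * L) := by
  rw [← lintegral_heightBox_exp (0 : Fin n) hm hL]
  refine (setLIntegral_height_norm he p 0
    (fun h N => m * Real.exp (-L) < h ∧ h < m * Real.exp L ∧ N < R)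
    fun h _ => ENNReal.ofReal h⁻¹).trans_le (lintegral_mono_set fun z hz j => ?_)
  split_ifs with hj
  · exact hj ▸ ⟨hz.1, hz.2.1⟩
  · exact abs_lt.1 ((PiLp.norm_apply_le z j).trans_lt hz.2.2)

theorem heightBox_le_cutoffMass [NeZero n] (he : ‖e‖ = 1) (hm : 0 < m) (hL : 0 < L) (hR : 0 < R)
    (hmR : m * Real.exp (L / 2) * (4 * n) ≤ R) :
    ENNReal.ofReal (1 / 16) *
      (ENNReal.ofReal (2 * (R / (4 * n))) ^ (n - 1) * ENNReal.ofReal L) ≤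
        cutoffMass e p m L R := by
  have hn : (0 : ℝ) < n := by exact_mod_cast NeZero.pos n
  set B := heightBox (0 : Fin n) (m * Real.exp (-(L / 2))) (m * Real.exp (L / 2)) (R / (4 * n))
  have hpos : ∀ z ∈ B, 0 < z 0 := fun z hz =>
    lt_trans (by positivity) (apply_mem_of_mem_heightBox hz).1
  have hnorm : ∀ z ∈ B, ‖z‖ ≤ R / 4 := fun z hz =>
    (norm_le_of_mem_heightBox (by positivity) ((le_div_iff₀ (by positivity)).2 hmR) hz).trans_eq
      (by field_simp)
  have hbox : ∫⁻ z in B, ENNReal.ofReal (z 0)⁻¹ =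
      ENNReal.ofReal (2 * (R / (4 * n))) ^ (n - 1) * ENNReal.ofReal L := by
    rw [lintegral_heightBox_exp _ hm (by positivity), mul_div_cancel₀ _ two_ne_zero]
  have hmass : cutoffMass e p m L R = ∫⁻ z in {z : 𝔼 | 0 < z 0},
      ENNReal.ofReal (logCutoff m L R (z 0) ‖z‖ ^ 2 * (z 0)⁻¹) :=
    setLIntegral_height_norm he p 0 (fun h _ => 0 < h)
      fun h N => ENNReal.ofReal (logCutoff m L R h N ^ 2 * h⁻¹)
  rw [← hbox, hmass, ← lintegral_const_mul' _ _ ENNReal.ofReal_ne_top]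
  refine (setLIntegral_mono' (measurableSet_heightBox _ _ _ _) fun z hz => ?_).trans
    (lintegral_mono_set hpos)
  obtain ⟨hlow, hupp⟩ := apply_mem_of_mem_heightBox hz
  have hquarter := quarter_le_logCutoff hm hL hR hlow.le hupp.le (hnorm z hz)
  rw [← ENNReal.ofReal_mul (by norm_num)]
  refine ENNReal.ofReal_le_ofReal (mul_le_mul_of_nonneg_right ?_ (inv_nonneg.2 (hpos z hz).le))
  exact (by norm_num : (1 / 16 : ℝ) = (1 / 4) ^ 2).trans_le (by gcongr)

theorem lintegral_cutoffRegion_le_cutoffMass [NeZero n] (he : ‖e‖ = 1) (hm : 0 < m) (hL : 0 < L)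
    (hR : 0 < R) (hmR : m * Real.exp (L / 2) * (4 * n) ≤ R) :
    ∫⁻ x in cutoffRegion e p m L R, ENNReal.ofReal (inner ℝ e (x - p))⁻¹ ≤
      ENNReal.ofReal (32 * (4 * n) ^ (n - 1)) * cutoffMass e p m L R := by
  have hn : (0 : ℝ) < n := by exact_mod_cast NeZero.pos n
  have hscale : (4 * (n : ℝ)) ^ (n - 1) * (2 * (R / (4 * n))) ^ (n - 1) = (2 * R) ^ (n - 1) := by
    rw [← mul_pow]
    congr 1
    field_simp
  refine ((lintegral_cutoffRegion_le he hm hL.le R).trans_eq ?_).trans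
    (mul_le_mul_right (heightBox_le_cutoffMass he hm hL hR hmR) _)
  rw [← ENNReal.ofReal_pow (by positivity), ← ENNReal.ofReal_pow (by positivity),
    ← ENNReal.ofReal_mul (by positivity), ← ENNReal.ofReal_mul (by positivity),
    ← ENNReal.ofReal_mul (by norm_num), ← ENNReal.ofReal_mul (by positivity), ← hscale]
  ring_nf

theorem cutoffMass_ne_zero [NeZero n] (he : ‖e‖ = 1) (hm : 0 < m) (hL : 0 < L) (hR : 0 < R)
    (hmR : m * Real.exp (L / 2) * (4 * n) ≤ R) : cutoffMass e p m L R ≠ 0 := by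
  have hn : (0 : ℝ) < n := by exact_mod_cast NeZero.pos n
  have hpos : ENNReal.ofReal (1 / 16) *
      (ENNReal.ofReal (2 * (R / (4 * n))) ^ (n - 1) * ENNReal.ofReal L) ≠ 0 :=
    mul_ne_zero (by simp) (mul_ne_zero (pow_ne_zero _ (by positivity)) (by simpa))
  exact (hpos.bot_lt.trans_le (heightBox_le_cutoffMass he hm hL hR hmR)).ne'

theorem cutoffMass_le_lintegral_cutoffRegion (hm : 0 < m) (hL : 0 < L) (hR : 0 < R) :
    cutoffMass e p m L R ≤
      ∫⁻ x in cutoffRegion e p m L R, ENNReal.ofReal (inner ℝ e (x - p))⁻¹ := by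
  rw [cutoffMass, ← lintegral_indicator (isOpen_halfSpace e p).measurableSet,
    ← lintegral_indicator (measurableSet_cutoffRegion e p m L R)]
  refine lintegral_mono fun x => ?_
  by_cases hx : x ∈ cutoffRegion e p m L R
  · have hxH := cutoffRegion_subset_halfSpace hm.le hx
    obtain ⟨h0, h1⟩ := cutoffProfile_mem_Icc (e := e) (p := p) (m := m) hL.le hR.le x
    rw [indicator_of_mem hx, indicator_of_mem hxH]
    exact ENNReal.ofReal_le_ofReal
      (mul_le_of_le_one_left (inv_nonneg.2 (le_of_lt hxH)) (pow_le_one₀ h0 h1))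
  · refine indicator_apply_le' (fun _ => ?_) fun _ => zero_le
    simp [cutoffProfile_eq_zero hm hL hR hx]

theorem cutoffMass_ne_top [NeZero n] (he : ‖e‖ = 1) (hm : 0 < m) (hL : 0 < L) (hR : 0 < R) :
    cutoffMass e p m L R ≠ ∞ :=
  ne_top_of_le_ne_top (by finiteness) ((cutoffMass_le_lintegral_cutoffRegion hm hL hR).trans
    (lintegral_cutoffRegion_le he hm hL.le R))

end CutoffMass

section HalfSpaceSharpness

open Filter Topology

variable {n : ℕ}

local notation "𝔼" => EuclideanSpace ℝ (Fin n)
local notation "dS" => Measure.toSphere (volume : Measure (EuclideanSpace ℝ (Fin n)))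

theorem IsCc.mono {Ω Ω' : Set 𝔼} {u : 𝔼 → ℝ} (hu : IsCc Ω u) (h : Ω ⊆ Ω') : IsCc Ω' u :=
  ⟨hu.continuous, hu.hasCompactSupport, hu.tsupport_subset.trans h⟩

theorem tendsto_oscConst {α : ℝ} (hα : 1 < α) :
    Tendsto (fun L => oscConst α (2 / L)) atTop (𝓝 0) := by
  have hdiv : Tendsto (fun L : ℝ => 2 / L) atTop (𝓝 0) := tendsto_const_nhds.div_atTop tendsto_id
  have hrpow := hdiv.rpow_const (p := α - 1) (Or.inr (by linarith))
  rw [Real.zero_rpow (by linarith)] at hrpow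
  simpa [oscConst] using (((hdiv.pow 2).const_mul 2).div_const (2 - α)).add (hrpow.const_mul 2)

variable {e p : EuclideanSpace ℝ (Fin n)} {α m L R r : ℝ}

theorem isCc_cutoffGroundState (hα : 1 ≤ α) (he : ‖e‖ = 1) (hm : 0 < m) (hL : 0 < L)
    (hR : 0 < R) (hr : 0 ≤ r) (hRr : R ^ 2 < 2 * r * (m * Real.exp (-L))) :
    IsCc (Metric.ball (p + r • e) r) (cutoffGroundState e p α m L R) where
  continuous := continuous_cutoffGroundState hα hm
  hasCompactSupport := (isCompact_inter_closedBall e p _ R).of_isClosed_subset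
    (isClosed_tsupport _) (tsupport_cutoffGroundState_subset hm hL hR)
  tsupport_subset := (tsupport_cutoffGroundState_subset hm hL hR).trans fun _ hx =>
    mem_ball_of_le_inner he hr hRr hx.1 (mem_closedBall_iff_norm.1 hx.2)

theorem groundEnergy_cutoffProfile_le [NeZero n] (hα1 : 1 ≤ α) (hα2 : α < 2) (he : ‖e‖ = 1)
    (hm : 0 < m) (hL : 0 < L) (hR : 0 < R) (hmLR : m * Real.exp L * L ≤ R)
    (hmR : m * Real.exp (L / 2) * (4 * n) ≤ R) :
    groundEnergy e p α (cutoffProfile e p m L R) ≤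
      2 * (ENNReal.ofReal (oscConst α (2 / L)) * dS univ *
        (ENNReal.ofReal (32 * (4 * n) ^ (n - 1)) * cutoffMass e p m L R)) := by
  refine (groundEnergy_le hα1 hα2 he.le (by positivity) (measurableSet_cutoffRegion e p m L R)
    (cutoffRegion_subset_halfSpace hm.le) (fun x hx => cutoffProfile_eq_zero hm hL hR hx)
    (sq_cutoffProfile_sub_le_one hL.le hR.le)
    fun x hx y hy => sq_cutoffProfile_sub_mul_le he.le hm hL hmLR hx hy).trans ?_
  gcongr
  exact lintegral_cutoffRegion_le_cutoffMass he hm hL hR hmR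

theorem regionalForm_cutoffGroundState_le [NeZero n] (hα1 : 1 ≤ α) (hα2 : α < 2) (he : ‖e‖ = 1)
    (hm : 0 < m) (hL : 0 < L) (hR : 0 < R) (hmLR : m * Real.exp L * L ≤ R)
    (hmR : m * Real.exp (L / 2) * (4 * n) ≤ R) :
    regionalForm (halfSpace e p) α (cutoffGroundState e p α m L R) ≤
      (ENNReal.ofReal (hardyKappa n α) + ENNReal.ofReal (oscConst α (2 / L)) * dS univ *
        ENNReal.ofReal (32 * (4 * n) ^ (n - 1))) * cutoffMass e p m L R := by
  have hmass : ∫⁻ x in halfSpace e p, ENNReal.ofReal (cutoffGroundState e p α m L R x ^ 2) *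
      dirIntegral (halfGauge e p) α x =
        ENNReal.ofReal (sphereMoment n α) * cutoffMass e p m L R := by
    rw [← setLIntegral_sq_cutoffGroundState_mul e p α,
      ← lintegral_const_mul' _ _ ENNReal.ofReal_ne_top]
    refine setLIntegral_congr_fun (isOpen_halfSpace e p).measurableSet fun x hx => ?_
    simp only [dirIntegral_halfGauge he (by linarith : 0 < α) hx]
    ring
  have hκ : hardyKappa n α = lineKappa α / 2 * sphereMoment n α := by
    linarith [two_mul_hardyKappa n α]
  have henergy := regionalForm_halfSpace_le hα1 hα2 (norm_ne_zero_iff.1 (by simp [he]))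
    (continuous_cutoffGroundState hα1 hm).measurable (fun x hx => cutoffGroundState_eq hx)
    (hmass.trans_ne (ENNReal.mul_ne_top ENNReal.ofReal_ne_top (cutoffMass_ne_top he hm hL hR)))
  rw [hmass] at henergy
  refine henergy.trans ((add_le_add_right (mul_le_mul_right
    (groundEnergy_cutoffProfile_le hα1 hα2 he hm hL hR hmLR hmR) _) _).trans_eq ?_)
  rw [← mul_assoc (1 / 2 : ℝ≥0∞), one_div, ENNReal.inv_mul_cancel two_ne_zero (by simp), one_mul,
    hκ, ENNReal.ofReal_mul (div_nonneg (lineKappa_nonneg hα1 hα2) two_pos.le)]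
  ring

theorem exists_ofReal_add_oscConst_lt (hα : 1 < α) {A C : ℝ} (hC0 : 0 < C) (hAC : A < C)
    {σ : ℝ≥0∞} (hσ : σ ≠ ∞) (L₀ : ℝ) : ∃ L, L₀ ≤ L ∧
      ENNReal.ofReal A + ENNReal.ofReal (oscConst α (2 / L)) * σ < ENNReal.ofReal C := by
  have hosc := ENNReal.Tendsto.mul_const (ENNReal.tendsto_ofReal (tendsto_oscConst hα))
    (Or.inr hσ)
  have htend := hosc.const_add (ENNReal.ofReal A)
  rw [ENNReal.ofReal_zero, zero_mul, add_zero] at htend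
  exact ((eventually_ge_atTop L₀).and (htend.eventually_lt_const
    ((ENNReal.ofReal_lt_ofReal_iff hC0).2 hAC))).exists

theorem exists_isCc_ball_regionalForm_halfSpace_lt [NeZero n] (hα1 : 1 < α) (hα2 : α < 2)
    (he : ‖e‖ = 1) (p : 𝔼) {C : ℝ} (hr : 0 < r) (hC : hardyKappa n α < C) :
    ∃ u : 𝔼 → ℝ, IsCc (Metric.ball (p + r • e) r) u ∧ regionalForm (halfSpace e p) α u <
      ENNReal.ofReal C * ∫⁻ x in halfSpace e p,
        ENNReal.ofReal (u x ^ 2) * ENNReal.ofReal (inner ℝ e (x - p) ^ (-α)) := by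
  have hn : (0 : ℝ) < n := by exact_mod_cast NeZero.pos n
  have hκ : 0 ≤ hardyKappa n α := by
    have := mul_nonneg (lineKappa_nonneg hα1.le hα2) (sphereMoment_pos n (by linarith : 0 < α)).le
    linarith [two_mul_hardyKappa n α]
  obtain ⟨L, hnL, hlt⟩ := exists_ofReal_add_oscConst_lt hα1 (hκ.trans_lt hC) hC
    (by finiteness : dS univ * ENNReal.ofReal (32 * (4 * n) ^ (n - 1)) ≠ ∞) (4 * n)
  have hL : 0 < L := lt_of_lt_of_le (by positivity) hnL
  obtain ⟨m, R, hm, hmLR, hRr⟩ := exists_cutoff_parameters hL hr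
  have hR : 0 < R := hmLR ▸ by positivity
  have hmR : m * Real.exp (L / 2) * (4 * n) ≤ R := by
    rw [← hmLR]
    gcongr
    linarith
  refine ⟨cutoffGroundState e p α m L R, isCc_cutoffGroundState hα1.le he hm hL hR hr.le hRr, ?_⟩
  rw [setLIntegral_sq_cutoffGroundState_mul]
  refine (regionalForm_cutoffGroundState_le hα1.le hα2 he hm hL hR hmLR.le hmR).trans_lt ?_
  rw [mul_assoc (ENNReal.ofReal (oscConst _ _))]
  exact ENNReal.mul_lt_mul_left (cutoffMass_ne_zero he hm hL hR hmR)
    (cutoffMass_ne_top he hm hL hR) hlt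

end HalfSpaceSharpness

section ConvexSharpness

variable {F : Type*} [NormedAddCommGroup F] [InnerProductSpace ℝ F] {Ω : Set F} {e p x : F}

theorem sub_inner_smul_notMem (he : ‖e‖ = 1) (hsub : Ω ⊆ halfSpace e p) (x : F) :
    x - (inner ℝ e (x - p) : ℝ) • e ∉ Ω := fun hmem => by
  have hpos : 0 < inner ℝ e (x - (inner ℝ e (x - p) : ℝ) • e - p) := hsub hmem
  rw [sub_right_comm, inner_sub_right, real_inner_smul_right, real_inner_self_eq_norm_sq, he,
    one_pow, mul_one, sub_self] at hpos
  exact lt_irrefl _ hpos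

theorem eq_add_smul_of_le_inner {r : ℝ} (he : ‖e‖ = 1) (hr : ‖x - p‖ ≤ r)
    (hin : r ≤ inner ℝ e (x - p)) : x = p + r • e := by
  have hr0 : 0 ≤ r := (norm_nonneg _).trans hr
  rw [← sub_eq_iff_eq_add', ← sub_eq_zero, ← norm_le_zero_iff]
  refine le_of_sq_le_sq ?_ le_rfl
  rw [norm_sub_sq_real, norm_smul, he, mul_one, Real.norm_of_nonneg hr0, real_inner_smul_right,
    real_inner_comm]
  have hsq : ‖x - p‖ ^ 2 ≤ r ^ 2 := pow_le_pow_left₀ (norm_nonneg _) hr 2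
  linarith [mul_le_mul_of_nonneg_left hin hr0]

variable {n : ℕ}

local notation "𝔼" => EuclideanSpace ℝ (Fin n)

theorem exists_ball_subset_subset_halfSpace [NeZero n] {Ω : Set 𝔼} (hΩ : IsOpen Ω)
    (hne : Ω.Nonempty) (hc : Convex ℝ Ω) (hb : Bornology.IsBounded Ω) :
    ∃ e p : 𝔼, ∃ r : ℝ, ‖e‖ = 1 ∧ 0 < r ∧ Ω ⊆ halfSpace e p ∧ Metric.ball (p + r • e) r ⊆ Ω := by
  obtain ⟨c, hcΩ⟩ := hne
  obtain ⟨y, hy, hr, -, hball⟩ := exists_distCompl_eq_dist hΩ hb hcΩ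
  obtain ⟨e, he, hpos⟩ := exists_norm_eq_one_inner_pos_of_notMem hΩ ⟨c, hcΩ⟩ hc hy
  refine ⟨e, y, dist c y, he, hr, hpos, ?_⟩
  have hin : dist c y ≤ inner ℝ e (c - y) := by
    by_contra! hlt
    refine sub_inner_smul_notMem he hpos c (hball ?_)
    rwa [Metric.mem_ball, dist_eq_norm, sub_sub_cancel_left, norm_neg, norm_smul, he, mul_one,
      Real.norm_of_nonneg (hpos c hcΩ).le]
  rwa [← eq_add_smul_of_le_inner he (dist_eq_norm c y).ge hin]

theorem distCompl_le_of_subset_halfSpace {Ω : Set 𝔼} {e p x : 𝔼} (he : ‖e‖ = 1)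
    (hsub : Ω ⊆ halfSpace e p) (hx : x ∈ halfSpace e p) :
    distCompl Ω x ≤ ENNReal.ofReal (inner ℝ e (x - p)) := by
  refine (Metric.infEDist_le_edist_of_mem (sub_inner_smul_notMem he hsub x)).trans_eq ?_
  rw [edist_dist, dist_eq_norm, sub_sub_cancel, norm_smul, he, mul_one,
    Real.norm_of_nonneg (le_of_lt hx)]

theorem regionalForm_mono {Ω Ω' : Set 𝔼} (h : Ω ⊆ Ω') (α : ℝ) (u : 𝔼 → ℝ) :
    regionalForm Ω α u ≤ regionalForm Ω' α u :=
  mul_le_mul_right ((lintegral_mono_set h).trans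
    (lintegral_mono fun _ => lintegral_mono_set h)) _

theorem lintegral_halfSpace_le_weightedInt_distCompl {Ω : Set 𝔼} {e p : 𝔼} {β : ℝ} (hβ : 0 ≤ β)
    (he : ‖e‖ = 1) (hΩ : IsOpen Ω) (hsub : Ω ⊆ halfSpace e p) {u : 𝔼 → ℝ}
    (hu : ∀ x ∉ Ω, u x = 0) :
    ∫⁻ x in halfSpace e p, ENNReal.ofReal (u x ^ 2) * ENNReal.ofReal (inner ℝ e (x - p) ^ (-β)) ≤
      weightedInt Ω (distCompl Ω) β u := by
  rw [weightedInt, ← lintegral_indicator (isOpen_halfSpace e p).measurableSet,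
    ← lintegral_indicator hΩ.measurableSet]
  refine lintegral_mono fun x => ?_
  by_cases hx : x ∈ Ω
  · have hx' : 0 < inner ℝ e (x - p) := hsub hx
    rw [indicator_of_mem hx, indicator_of_mem (hsub hx), div_eq_mul_inv,
      Real.rpow_neg hx'.le, ENNReal.ofReal_inv_of_pos (by positivity),
      ← ENNReal.ofReal_rpow_of_pos hx']
    gcongr
    exact distCompl_le_of_subset_halfSpace he hsub (hsub hx)
  · refine indicator_apply_le' (fun _ => ?_) fun _ => zero_le
    simp [hu x hx]

theorem exists_isCc_regionalForm_lt_distCompl [NeZero n] {α : ℝ} (hα1 : 1 < α) (hα2 : α < 2)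
    {Ω : Set 𝔼} (hΩ : IsOpen Ω) (hne : Ω.Nonempty) (hc : Convex ℝ Ω)
    (hb : Bornology.IsBounded Ω) {C : ℝ} (hC : hardyKappa n α < C) :
    ∃ u : 𝔼 → ℝ, IsCc Ω u ∧
      regionalForm Ω α u < ENNReal.ofReal C * weightedInt Ω (distCompl Ω) α u := by
  obtain ⟨e, p, r, he, hr, hsub, hball⟩ := exists_ball_subset_subset_halfSpace hΩ hne hc hb
  obtain ⟨u, hu, hlt⟩ := exists_isCc_ball_regionalForm_halfSpace_lt hα1 hα2 he p hr hC
  have huΩ := hu.mono hball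
  refine ⟨u, huΩ, (regionalForm_mono hsub α u).trans_lt (hlt.trans_le (mul_le_mul_right ?_ _))⟩
  exact lintegral_halfSpace_le_weightedInt_distCompl (by linarith) he hΩ hsub fun x hx =>
    image_eq_zero_of_notMem_tsupport fun hxt => hx (huΩ.tsupport_subset hxt)

end ConvexSharpness

theorem IsCc.memLp {n : ℕ} {Ω : Set (EuclideanSpace ℝ (Fin n))} {u : EuclideanSpace ℝ (Fin n) → ℝ}
    (hu : IsCc Ω u) (q : ℝ≥0∞) : MemLp u q :=
  hu.continuous.memLp_of_hasCompactSupport hu.hasCompactSupport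

theorem theorem1p3_general (n : ℕ) [NeZero n] (α : ℝ) (hα1 : 1 < α) (hα2 : α < 2) :
    (∀ Ω : Set (EuclideanSpace ℝ (Fin n)), IsOpen Ω → Bornology.IsBounded Ω →
      ∀ u : EuclideanSpace ℝ (Fin n) → ℝ, Measurable u → MemLp u 2 → HasCompactSupport u →
        tsupport u ⊆ Ω →
        ENNReal.ofReal (hardyKappa n α) * weightedInt Ω (lossSloaneM Ω α) α u +
          ENNReal.ofReal (hardyLambda n α * (1 / Metric.diam Ω)) *
            weightedInt Ω (lossSloaneM Ω (α - 1)) (α - 1) u ≤ regionalForm Ω α u) ∧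
    (∀ Ω : Set (EuclideanSpace ℝ (Fin n)), IsOpen Ω → Convex ℝ Ω → Bornology.IsBounded Ω →
      ∀ u : EuclideanSpace ℝ (Fin n) → ℝ, Measurable u → MemLp u 2 → HasCompactSupport u →
        tsupport u ⊆ Ω →
        ENNReal.ofReal (hardyKappa n α) * weightedInt Ω (distCompl Ω) α u +
          ENNReal.ofReal (hardyLambda n α * (1 / Metric.diam Ω)) *
            weightedInt Ω (distCompl Ω) (α - 1) u ≤ regionalForm Ω α u) ∧
    (∀ Ω : Set (EuclideanSpace ℝ (Fin n)), IsOpen Ω → Ω.Nonempty → Convex ℝ Ω →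
      Bornology.IsBounded Ω →
      ∀ C : ℝ, hardyKappa n α < C →
        (∃ u : EuclideanSpace ℝ (Fin n) → ℝ, IsCc Ω u ∧
          regionalForm Ω α u <
            ENNReal.ofReal C * weightedInt Ω (lossSloaneM Ω α) α u +
              ENNReal.ofReal (hardyLambda n α * (1 / Metric.diam Ω)) *
                weightedInt Ω (lossSloaneM Ω (α - 1)) (α - 1) u) ∧
        (∃ u : EuclideanSpace ℝ (Fin n) → ℝ, IsCc Ω u ∧
          regionalForm Ω α u <
            ENNReal.ofReal C * weightedInt Ω (distCompl Ω) α u +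
              ENNReal.ofReal (hardyLambda n α * (1 / Metric.diam Ω)) *
                weightedInt Ω (distCompl Ω) (α - 1) u)) := by
  refine ⟨fun Ω hΩ hb u hu hL2 hcs hs => hardy_lossSloane hα1 hα2 hΩ hb hu hL2 hcs hs,
    fun Ω hΩ hc hb u hu hL2 hcs hs => hardy_distCompl hα1 hα2 hΩ hc hb hu hL2 hcs hs,
    fun Ω hΩ hne hc hb C hC => ?_⟩
  obtain ⟨u, hu, hlt⟩ := exists_isCc_regionalForm_lt_distCompl hα1 hα2 hΩ hne hc hb hC
  have hweight := weightedInt_distCompl_le_lossSloaneM (by linarith : 0 < α) hΩ hc hb u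
  exact ⟨⟨u, hu, hlt.trans_le ((mul_le_mul_right hweight _).trans le_self_add)⟩,
    u, hu, hlt.trans_le le_self_add⟩

theorem theorem1p3 (n : ℕ) [NeZero n] (α : ℝ) (hα1 : 1 < α) (hα2 : α < 2) :
    -- the inequality on bounded domains
    (∀ Ω : Set (EuclideanSpace ℝ (Fin n)), IsOpen Ω → IsConnected Ω → Bornology.IsBounded Ω →
      ∀ u : EuclideanSpace ℝ (Fin n) → ℝ, IsCc Ω u →
        ENNReal.ofReal (hardyKappa n α) * weightedInt Ω (lossSloaneM Ω α) α u +
          ENNReal.ofReal (hardyLambda n α * (1 / Metric.diam Ω)) *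
            weightedInt Ω (lossSloaneM Ω (α - 1)) (α - 1) u ≤ regionalForm Ω α u) ∧
    -- the inequality on bounded convex domains
    (∀ Ω : Set (EuclideanSpace ℝ (Fin n)), IsOpen Ω → Ω.Nonempty → Convex ℝ Ω →
      Bornology.IsBounded Ω →
      ∀ u : EuclideanSpace ℝ (Fin n) → ℝ, IsCc Ω u →
        ENNReal.ofReal (hardyKappa n α) * weightedInt Ω (distCompl Ω) α u +
          ENNReal.ofReal (hardyLambda n α * (1 / Metric.diam Ω)) *
            weightedInt Ω (distCompl Ω) (α - 1) u ≤ regionalForm Ω α u) ∧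
    -- on every bounded convex domain, no constant larger than `κ` is possible in either one
    (∀ Ω : Set (EuclideanSpace ℝ (Fin n)), IsOpen Ω → Ω.Nonempty → Convex ℝ Ω →
      Bornology.IsBounded Ω →
      ∀ C : ℝ, hardyKappa n α < C →
        (∃ u : EuclideanSpace ℝ (Fin n) → ℝ, IsCc Ω u ∧
          regionalForm Ω α u <
            ENNReal.ofReal C * weightedInt Ω (lossSloaneM Ω α) α u +
              ENNReal.ofReal (hardyLambda n α * (1 / Metric.diam Ω)) *
                weightedInt Ω (lossSloaneM Ω (α - 1)) (α - 1) u) ∧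
        (∃ u : EuclideanSpace ℝ (Fin n) → ℝ, IsCc Ω u ∧
          regionalForm Ω α u <
            ENNReal.ofReal C * weightedInt Ω (distCompl Ω) α u +
              ENNReal.ofReal (hardyLambda n α * (1 / Metric.diam Ω)) *
                weightedInt Ω (distCompl Ω) (α - 1) u)) := by
  obtain ⟨hM, hdist, hsharp⟩ := theorem1p3_general n α hα1 hα2
  exact ⟨fun Ω hΩ _ hb u hu => hM Ω hΩ hb u hu.continuous.measurable (hu.memLp 2)
      hu.hasCompactSupport hu.tsupport_subset,
    fun Ω hΩ _ hc hb u hu => hdist Ω hΩ hc hb u hu.continuous.measurable (hu.memLp 2)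
      hu.hasCompactSupport hu.tsupport_subset, hsharp⟩
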